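/- Fix an integer $r\ge 1$. Let $\mathcal U_r$ be the (localized) algebra over $\mathbb Z[q^{1/2},q^{-1/2}]$ generated by $M_{\alpha,n}^{\pm1}$ ($1\le\alpha\le r+1$, $n\in\mathbb Z$), $A^{\pm1}$, $\Delta^{\pm1}$, with the conventions $M_{0,n}=1$, $M_{r+2,n}=0$, subject to $$q^{\alpha}M_{\alpha,n+1}M_{\alpha,n-1}=M_{\alpha,n}^2-M_{\alpha+1,n}M_{\alpha-1,n}\quad(1\le\alpha\le r+1),\qquad M_{\alpha,n}M_{\beta,n+\epsilon}=q^{\epsilon\min(\alpha,\beta)}M_{\beta,n+\epsilon}M_{\alpha,n}\quad(\epsilon\in\{0,1\}),$$ $$\Delta M_{\alpha,n}=q^{\alpha n}M_{\alpha,n}\Delta,\qquad M_{r+1,n}=A^n\Delta .$$ Let $\tau$ be the anti-automorphism of $\mathcal U_r$ with $\tau(M_{\alpha,n})=q^{-\alpha n}M_{\alpha,-n}$, $\tau(A)=A^{-1}$, $\tau(\Delta)=\Delta$; let $\sigma$ be the automorphism with $\sigma(M_{\alpha,n})=A^{-n}M_{r+1-\alpha,n}\Delta^{-1}$, $\sigma(A)=A^{-1}$,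 $\sigma(\Delta)=\Delta^{-1}$; and let $D$ be the shift automorphism $M_{\alpha,n}\mapsto M_{\alpha,n+1}$ (so $A\mapsto A$, $\Delta\mapsto A\Delta$). Put $\xi_{\alpha,n}=M_{\alpha,n}M_{\alpha,n+1}^{-1}$, $x_{\alpha,n}=\xi_{\alpha,n}^{-1}\xi_{\alpha-1,n}$, fix any base point $n\in\mathbb Z$, and let $C_0,\dots,C_{r+1}$ be the coefficients of the Miura operator $$\mu_n=(D-x_{r+1,n})(D-x_{r,n})\cdots(D-x_{1,n})=\sum_{m=0}^{r+1}(-1)^mC_m\,D^{r+1-m},$$ a skew polynomial in $D$ with $D\,a=D(a)\,D$; one has $C_0=1$ and $C_{r+1}=A$. Put $C(z)=\sum_{m=0}^{r+1}(-z)^mC_m$, and define $$\mathfrak m(z)=\sum_{n\in\mathbb Z}M_{1,n}z^n,\qquad \mathfrak e(z)=\mathfrak m(q^{1/2}z),\qquad \mathfrak f(z)=\sigma\tau(\mathfrak e(z))=\sum_{n\in\mathbb Z}z^{-n}q^{n/2}A^{-n}M_{r,n}\Delta^{-1},\qquad \delta(z)=\sum_{n\in\mathbb Z}z^n,$$ $$\psi^+(z)=(-q^{-1/2}z)^{r+1}A\,C(q^{1/2}z)^{-1}C(q^{-1/2}z)^{-1}\in\mathcal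 U_r[[z]],$$ $$\psi^-(z)=(-q^{1/2}z)^{-r-1}A\left(\frac{C(q^{1/2}z)}{(q^{1/2}z)^{r+1}}\right)^{-1}\left(\frac{C(q^{-1/2}z)}{(q^{-1/2}z)^{r+1}}\right)^{-1}\in\mathcal U_r[[z^{-1}]],$$ where the inverses are taken in $\mathcal U_r[[z]]$ and in $\mathcal U_r[[z^{-1}]]$ respectively. Then, as identities of formal distributions in $z,w$ with coefficients in $\mathcal U_r$, \begin{align*} (z-qw)\,\mathfrak e(z)\mathfrak e(w)+(w-qz)\,\mathfrak e(w)\mathfrak e(z)&=0,\\ (z-q^{-1}w)\,\mathfrak f(z)\mathfrak f(w)+(w-q^{-1}z)\,\mathfrak f(w)\mathfrak f(z)&=0,\\ (z-qw)\,\psi^\pm(z)\mathfrak e(w)+(w-qz)\,\mathfrak e(w)\psi^\pm(z)&=0,\\ (z-q^{-1}w)\,\psi^\pm(z)\mathfrak f(w)+(w-q^{-1}z)\,\mathfrak f(w)\psi^\pm(z)&=0,\\ [\mathfrak e(z),\mathfrak f(w)]&=(1-q)\,\delta(z/w)\,\bigl(\psi^+(z)-\psi^-(z)\bigr). \end{align*}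 Moreover the Cartan currents have valuation exactly $r+1$: the lowest power of $z$ in $\psi^+(z)$ is $z^{r+1}$, with coefficient $(-q^{-1/2})^{r+1}A\neq0$, and the lowest power of $z^{-1}$ in $\psi^-(z)$ is $z^{-r-1}$, with coefficient $(-q^{1/2})^{-r-1}A^{-1}\neq0$. -/

import Mathlib

noncomputable section

namespace QSystem

/-- The coefficient ring `ℤ[q^{1/2}, q^{-1/2}]`; the variable of the Laurent polynomial ring is
`q^{1/2}`. -/
abbrev Rq : Type := LaurentPolynomial ℤ

/-- `qh n = q^{n/2}`. -/
def qh (n : ℤ) : Rq := LaurentPolynomial.T n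

/-- `qp n = q^n`. -/
def qp (n : ℤ) : Rq := qh (2 * n)

theorem qh_add (m n : ℤ) : qh (m + n) = qh m * qh n := LaurentPolynomial.T_add m n

theorem qh_zero : qh 0 = 1 := LaurentPolynomial.T_zero

theorem qp_add (m n : ℤ) : qp (m + n) = qp m * qp n := by
  simp [qp, mul_add, qh_add]

theorem qp_zero : qp 0 = 1 := by simp [qp, qh_zero]

/-! ### The localized algebra of the `M`-system -/

/-- Symbols for the generators `M_{α,n}`, `M_{α,n}⁻¹`, `A`, `A⁻¹`, `Δ`, `Δ⁻¹`. -/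
inductive Gen : Type
  | M (α : ℕ) (n : ℤ)
  | Mi (α : ℕ) (n : ℤ)
  | A
  | Ai
  | D
  | Di

/-- A generator as an element of the free algebra. -/
abbrev gen (g : Gen) : FreeAlgebra Rq Gen := FreeAlgebra.ι Rq g

/-- The defining relations. The generators with index `α ≥ r + 2` are zero, so that the actual
generators are `M_{α,n}` and their inverses for `1 ≤ α ≤ r + 1`, `A^{±1}` and `Δ^{±1}`.
The relations `top_zero` and `top_succ` say that `M_{r+1,n} = A^n Δ` for all integers `n`. -/
inductive Rel (r : ℕ) : FreeAlgebra Rq Gen → FreeAlgebra Rq Gen → Prop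
  | M_zero (n : ℤ) : Rel r (gen (.M 0 n)) 1
  | M_rank (α : ℕ) (n : ℤ) (h : r + 2 ≤ α) : Rel r (gen (.M α n)) 0
  | Mi_rank (α : ℕ) (n : ℤ) (h : r + 2 ≤ α) : Rel r (gen (.Mi α n)) 0
  | M_Mi (α : ℕ) (n : ℤ) (h : α ≤ r + 1) : Rel r (gen (.M α n) * gen (.Mi α n)) 1
  | Mi_M (α : ℕ) (n : ℤ) (h : α ≤ r + 1) : Rel r (gen (.Mi α n) * gen (.M α n)) 1
  | A_Ai : Rel r (gen .A * gen .Ai) 1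
  | Ai_A : Rel r (gen .Ai * gen .A) 1
  | D_Di : Rel r (gen .D * gen .Di) 1
  | Di_D : Rel r (gen .Di * gen .D) 1
  | msys (α : ℕ) (n : ℤ) (h1 : 1 ≤ α) (h2 : α ≤ r + 1) :
      Rel r (qp α • (gen (.M α (n + 1)) * gen (.M α (n - 1))))
        (gen (.M α n) * gen (.M α n) - gen (.M (α + 1) n) * gen (.M (α - 1) n))
  | comm_zero (α β : ℕ) (n : ℤ) :
      Rel r (gen (.M α n) * gen (.M β n)) (gen (.M β n) * gen (.M α n))
  | comm_one (α β : ℕ) (n : ℤ) :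
      Rel r (gen (.M α n) * gen (.M β (n + 1)))
        (qp (min α β : ℕ) • (gen (.M β (n + 1)) * gen (.M α n)))
  | degree (α : ℕ) (n : ℤ) :
      Rel r (gen .D * gen (.M α n)) (qp (α * n) • (gen (.M α n) * gen .D))
  | top_zero : Rel r (gen (.M (r + 1) 0)) (gen .D)
  | top_succ (n : ℤ) : Rel r (gen (.M (r + 1) (n + 1))) (gen .A * gen (.M (r + 1) n))

/-- The localized algebra `𝒰_r` over `ℤ[q^{1/2}, q^{-1/2}]`. -/
def U (r : ℕ) : Type := RingQuot (Rel r)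

instance (r : ℕ) : Ring (U r) := inferInstanceAs (Ring (RingQuot (Rel r)))

instance (r : ℕ) : Algebra Rq (U r) := inferInstanceAs (Algebra Rq (RingQuot (Rel r)))

/-- The quotient map from the free algebra. -/
def mk (r : ℕ) : FreeAlgebra Rq Gen →ₐ[Rq] U r := RingQuot.mkAlgHom Rq (Rel r)

theorem mk_rel {r : ℕ} {x y : FreeAlgebra Rq Gen} (h : Rel r x y) : mk r x = mk r y :=
  RingQuot.mkAlgHom_rel Rq h

/-- The universal property of `U r`. -/
def lift {r : ℕ} {B : Type} [Ring B] [Algebra Rq B] (φ : Gen → B)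
    (h : ∀ ⦃x y⦄, Rel r x y → FreeAlgebra.lift Rq φ x = FreeAlgebra.lift Rq φ y) :
    U r →ₐ[Rq] B :=
  RingQuot.liftAlgHom Rq ⟨FreeAlgebra.lift Rq φ, h⟩

theorem lift_mk {r : ℕ} {B : Type} [Ring B] [Algebra Rq B] (φ : Gen → B)
    (h : ∀ ⦃x y⦄, Rel r x y → FreeAlgebra.lift Rq φ x = FreeAlgebra.lift Rq φ y) (g : Gen) :
    lift φ h (mk r (gen g)) = φ g := by
  have := RingQuot.liftAlgHom_mkAlgHom_apply Rq (FreeAlgebra.lift Rq φ) h (gen g)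
  rw [FreeAlgebra.lift_ι_apply] at this
  exact this

section Elements

variable (r : ℕ)

/-- The generator `M_{α,n}`. -/
def M (α : ℕ) (n : ℤ) : U r := mk r (gen (.M α n))

/-- The inverse `M_{α,n}⁻¹`. -/
def Mi (α : ℕ) (n : ℤ) : U r := mk r (gen (.Mi α n))

/-- The invertible element `A`. -/
def A : (U r)ˣ where
  val := mk r (gen .A)
  inv := mk r (gen .Ai)
  val_inv := by simpa using mk_rel (Rel.A_Ai (r := r))
  inv_val := by simpa using mk_rel (Rel.Ai_A (r := r))

/-- The invertible degree operator `Δ`. -/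
def D : (U r)ˣ where
  val := mk r (gen .D)
  inv := mk r (gen .Di)
  val_inv := by simpa using mk_rel (Rel.D_Di (r := r))
  inv_val := by simpa using mk_rel (Rel.Di_D (r := r))

/-- The power `A^n`, for an integer `n`. -/
def Ap (n : ℤ) : U r := ((A r ^ n : (U r)ˣ) : U r)

/-- The power `Δ^n`, for an integer `n`. -/
def Dp (n : ℤ) : U r := ((D r ^ n : (U r)ˣ) : U r)

end Elements

section Relations

variable {r : ℕ}

theorem mk_A : mk r (gen .A) = Ap r 1 := by simp [Ap, A]
theorem mk_Ai : mk r (gen .Ai) = Ap r (-1) := by rw [Ap, zpow_neg_one]; rfl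
theorem mk_D : mk r (gen .D) = Dp r 1 := by simp [Dp, D]
theorem mk_Di : mk r (gen .Di) = Dp r (-1) := by rw [Dp, zpow_neg_one]; rfl

theorem Ap_zero : Ap r 0 = 1 := by simp [Ap]
theorem Dp_zero : Dp r 0 = 1 := by simp [Dp]
theorem Ap_mul (m n : ℤ) : Ap r m * Ap r n = Ap r (m + n) := by simp [Ap, zpow_add]
theorem Dp_mul (m n : ℤ) : Dp r m * Dp r n = Dp r (m + n) := by simp [Dp, zpow_add]

theorem M_zero (n : ℤ) : M r 0 n = 1 := by simpa [M, Mi] using mk_rel (Rel.M_zero (r := r) n)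

theorem M_rank {α : ℕ} (n : ℤ) (h : r + 2 ≤ α) : M r α n = 0 := by
  simpa [M, Mi] using mk_rel (Rel.M_rank α n h)

theorem Mi_rank {α : ℕ} (n : ℤ) (h : r + 2 ≤ α) : Mi r α n = 0 := by
  simpa [M, Mi] using mk_rel (Rel.Mi_rank α n h)

theorem M_Mi {α : ℕ} (n : ℤ) (h : α ≤ r + 1) : M r α n * Mi r α n = 1 := by
  simpa [M, Mi] using mk_rel (Rel.M_Mi α n h)

theorem Mi_M {α : ℕ} (n : ℤ) (h : α ≤ r + 1) : Mi r α n * M r α n = 1 := by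
  simpa [M, Mi] using mk_rel (Rel.Mi_M α n h)

theorem msys {α : ℕ} (n : ℤ) (h1 : 1 ≤ α) (h2 : α ≤ r + 1) :
    qp α • (M r α (n + 1) * M r α (n - 1)) =
      M r α n * M r α n - M r (α + 1) n * M r (α - 1) n := by
  simpa [M, Mi] using mk_rel (Rel.msys α n h1 h2)

theorem comm_zero (α β : ℕ) (n : ℤ) : M r α n * M r β n = M r β n * M r α n := by
  simpa [M, Mi] using mk_rel (Rel.comm_zero (r := r) α β n)

theorem comm_one (α β : ℕ) (n : ℤ) :
    M r α n * M r β (n + 1) = qp (min α β : ℕ) • (M r β (n + 1) * M r α n) := by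
  simpa [M, Mi] using mk_rel (Rel.comm_one (r := r) α β n)

theorem degree (α : ℕ) (n : ℤ) : Dp r 1 * M r α n = qp (α * n) • (M r α n * Dp r 1) := by
  rw [← mk_D]; simpa [M, Mi] using mk_rel (Rel.degree (r := r) α n)

theorem top_zero : M r (r + 1) 0 = Dp r 1 := by
  rw [← mk_D]; exact mk_rel Rel.top_zero

theorem top_succ (n : ℤ) : M r (r + 1) (n + 1) = Ap r 1 * M r (r + 1) n := by
  rw [← mk_A]; simpa [M, Mi] using mk_rel (Rel.top_succ (r := r) n)

theorem top (n : ℤ) : M r (r + 1) n = Ap r n * Dp r 1 := by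
  induction n using Int.induction_on with
  | zero => rw [top_zero, Ap_zero, one_mul]
  | succ i ih => rw [top_succ, ih, ← mul_assoc, Ap_mul, add_comm]
  | pred i ih =>
    have h := top_succ (r := r) (-(i : ℤ) - 1)
    rw [sub_add_cancel, ih] at h
    have h2 := congrArg (fun x => Ap r (-1) * x) h
    simp only [← mul_assoc, Ap_mul] at h2
    rw [show (-1 : ℤ) + 1 = 0 by ring, Ap_zero, one_mul] at h2
    rw [← h2]; congr 2; ring

theorem M_A_one (α : ℕ) (n : ℤ) : M r α n * Ap r 1 = qp α • (Ap r 1 * M r α n) := by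
  by_cases h : r + 2 ≤ α
  · simp [M_rank n h]
  · have hα : α ≤ r + 1 := by omega
    have h1 := comm_one (r := r) α (r + 1) n
    rw [min_eq_left hα, top_succ, ← mul_assoc, mul_assoc (Ap r 1), ← comm_zero α (r + 1) n,
      ← mul_assoc (Ap r 1), ← smul_mul_assoc] at h1
    have h2 := congrArg (fun x => x * Mi r (r + 1) n) h1
    simpa only [mul_assoc, M_Mi n le_rfl, mul_one, smul_mul_assoc] using h2

theorem qcomm_zpow {B : Type} [Ring B] [Algebra Rq B] (u : Bˣ) (x : B) (j : ℤ)
    (h : x * u = qp j • ((u : B) * x)) (k : ℤ) :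
    x * ((u ^ k : Bˣ) : B) = qp (j * k) • (((u ^ k : Bˣ) : B) * x) := by
  have h' : x * ((u⁻¹ : Bˣ) : B) = qp (-j) • (((u⁻¹ : Bˣ) : B) * x) := by
    have h2 := congrArg (fun y => qp (-j) • (((u⁻¹ : Bˣ) : B) * (y * ((u⁻¹ : Bˣ) : B)))) h
    simp only [mul_assoc, smul_mul_assoc, mul_smul_comm, smul_smul, ← qp_add, neg_add_cancel,
      qp_zero, one_smul, Units.mul_inv, mul_one, Units.inv_mul_cancel_left] at h2
    exact h2.symm
  induction k using Int.induction_on with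
  | zero => simp [qp_zero]
  | succ i ih =>
    rw [zpow_add_one, Units.val_mul, ← mul_assoc, ih, smul_mul_assoc, mul_assoc, h,
      mul_smul_comm, smul_smul, ← qp_add, ← mul_assoc]
    congr 2; ring
  | pred i ih =>
    rw [zpow_sub_one, Units.val_mul, ← mul_assoc, ih, smul_mul_assoc, mul_assoc, h',
      mul_smul_comm, smul_smul, ← qp_add, ← mul_assoc]
    congr 2; ring

theorem M_Ap (α : ℕ) (n k : ℤ) : M r α n * Ap r k = qp (α * k) • (Ap r k * M r α n) :=
  qcomm_zpow (A r) _ _ (by simpa [Ap] using M_A_one (r := r) α n) k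

theorem M_Dp (α : ℕ) (n k : ℤ) :
    M r α n * Dp r k = qp (-(α * n) * k) • (Dp r k * M r α n) := by
  refine qcomm_zpow (D r) _ _ ?_ k
  have h := degree (r := r) α n
  rw [Dp, zpow_one] at h
  rw [h, smul_smul, ← qp_add, neg_add_cancel, qp_zero, one_smul]

theorem Dp_Ap (d k : ℤ) :
    Dp r d * Ap r k = qp ((r + 1) * d * k) • (Ap r k * Dp r d) := by
  refine qcomm_zpow (A r) _ _ ?_ k
  have h : Ap r 1 * Dp r d = qp (-(r + 1) * d) • (Dp r d * Ap r 1) := by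
    refine qcomm_zpow (D r) _ _ ?_ d
    have h := degree (r := r) (r + 1) 1
    rw [top, Dp, zpow_one, ← mul_assoc, ← smul_mul_assoc] at h
    have h2 := (Units.mul_left_inj _).1 h
    rw [h2, smul_smul, ← qp_add]
    rw [show -((r : ℤ) + 1) + ((r + 1 : ℕ) : ℤ) * 1 = 0 by push_cast; ring, qp_zero, one_smul]
  rw [show ((A r : (U r)ˣ) : U r) = Ap r 1 by simp [Ap], h, smul_smul, ← qp_add,
    show ((r : ℤ) + 1) * d + -(r + 1) * d = 0 by ring, qp_zero, one_smul]

theorem M_Ap' (α : ℕ) (n k : ℤ) (x : U r) :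
    M r α n * (Ap r k * x) = qp (α * k) • (Ap r k * (M r α n * x)) := by
  rw [← mul_assoc, M_Ap, smul_mul_assoc, mul_assoc]

theorem M_Dp' (α : ℕ) (n k : ℤ) (x : U r) :
    M r α n * (Dp r k * x) = qp (-(α * n) * k) • (Dp r k * (M r α n * x)) := by
  rw [← mul_assoc, M_Dp, smul_mul_assoc, mul_assoc]

theorem Dp_Ap' (d k : ℤ) (x : U r) :
    Dp r d * (Ap r k * x) = qp ((r + 1) * d * k) • (Ap r k * (Dp r d * x)) := by
  rw [← mul_assoc, Dp_Ap, smul_mul_assoc, mul_assoc (Ap r k)]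

theorem Ap_mul' (m n : ℤ) (x : U r) : Ap r m * (Ap r n * x) = Ap r (m + n) * x := by
  rw [← mul_assoc, Ap_mul]

theorem Dp_mul' (m n : ℤ) (x : U r) : Dp r m * (Dp r n * x) = Dp r (m + n) * x := by
  rw [← mul_assoc, Dp_mul]

theorem qp_congr {a b : ℤ} (h : a = b) (x : U r) : qp a • x = qp b • x := by rw [h]

/-! ### The shift, the time reversal and the Weyl reflection -/

/-- Values of the time shift on the generators. -/
def shiftGen (r : ℕ) : Gen → U r
  | .M α n => M r α (n + 1)
  | .Mi α n => Mi r α (n + 1)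
  | .A => Ap r 1
  | .Ai => Ap r (-1)
  | .D => Ap r 1 * Dp r 1
  | .Di => Dp r (-1) * Ap r (-1)

theorem shift_rel : ∀ ⦃x y⦄, Rel r x y →
    FreeAlgebra.lift Rq (shiftGen r) x = FreeAlgebra.lift Rq (shiftGen r) y := by
  intro x y h
  cases h with
  | M_zero n => simp [shiftGen, M_zero]
  | M_rank α n h => simp [shiftGen, M_rank _ h]
  | Mi_rank α n h => simp [shiftGen, Mi_rank _ h]
  | M_Mi α n h => simp [shiftGen, M_Mi _ h]
  | Mi_M α n h => simp [shiftGen, Mi_M _ h]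
  | A_Ai => simp [shiftGen, Ap_mul, Ap_zero]
  | Ai_A => simp [shiftGen, Ap_mul, Ap_zero]
  | D_Di => simp [shiftGen, mul_assoc, Dp_mul', Dp_zero, Ap_mul, Ap_zero]
  | Di_D => simp [shiftGen, mul_assoc, Ap_mul', Ap_zero, Dp_mul, Dp_zero]
  | msys α n h1 h2 =>
    have h := msys (r := r) (n + 1) h1 h2
    rw [show n + 1 - 1 = n - 1 + 1 by ring] at h
    simpa [shiftGen] using h
  | comm_zero α β n => simpa [shiftGen] using comm_zero α β (n + 1)
  | comm_one α β n => simpa [shiftGen] using comm_one α β (n + 1)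
  | degree α n =>
    simp only [map_mul, map_smul, FreeAlgebra.lift_ι_apply, shiftGen, mul_assoc, M_Ap', M_Dp,
      mul_smul_comm, smul_smul, ← qp_add]
    rw [show (α : ℤ) * n + (α * 1 + -(α * (n + 1)) * 1) = 0 by ring, qp_zero, one_smul]
  | top_zero => simp [shiftGen, top]
  | top_succ n => simpa [shiftGen] using top_succ (n + 1)

/-- The time shift `D`: `M_{α,n} ↦ M_{α,n+1}`, hence `A ↦ A` and `Δ = M_{r+1,0} ↦ A Δ`. -/
def shift (r : ℕ) : U r →ₐ[Rq] U r := lift (shiftGen r) shift_rel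

/-- Values of the time reversal on the generators. -/
def tauGen (r : ℕ) : Gen → (U r)ᵐᵒᵖ
  | .M α n => MulOpposite.op (qp (-(α * n)) • M r α (-n))
  | .Mi α n => MulOpposite.op (qp (α * n) • Mi r α (-n))
  | .A => MulOpposite.op (Ap r (-1))
  | .Ai => MulOpposite.op (Ap r 1)
  | .D => MulOpposite.op (Dp r 1)
  | .Di => MulOpposite.op (Dp r (-1))

theorem tau_rel : ∀ ⦃x y⦄, Rel r x y →
    FreeAlgebra.lift Rq (tauGen r) x = FreeAlgebra.lift Rq (tauGen r) y := by
  intro x y h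
  apply MulOpposite.unop_injective
  cases h with
  | M_zero n => simp [tauGen, M_zero, qp_zero]
  | M_rank α n h => simp [tauGen, M_rank _ h]
  | Mi_rank α n h => simp [tauGen, Mi_rank _ h]
  | M_Mi α n h => simp [tauGen, Mi_M _ h, smul_smul, ← qp_add, qp_zero]
  | Mi_M α n h => simp [tauGen, M_Mi _ h, smul_smul, ← qp_add, qp_zero]
  | A_Ai => simp [tauGen, Ap_mul, Ap_zero]
  | Ai_A => simp [tauGen, Ap_mul, Ap_zero]
  | D_Di => simp [tauGen, Dp_mul, Dp_zero]
  | Di_D => simp [tauGen, Dp_mul, Dp_zero]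
  | msys α n h1 h2 =>
    have h := msys (r := r) (-n) h1 h2
    have e1 : -(n - 1) = -n + 1 := by ring
    have e2 : -(n + 1) = -n - 1 := by ring
    have h3 := congrArg (fun x => qp (-(2 * α * n)) • x) h
    simp only [map_mul, map_smul, map_sub, FreeAlgebra.lift_ι_apply, tauGen, MulOpposite.unop_mul,
      MulOpposite.unop_sub, MulOpposite.unop_smul, MulOpposite.unop_op, smul_mul_assoc,
      mul_smul_comm, smul_smul, ← qp_add, smul_sub, e1, e2, comm_zero (α - 1) (α + 1)] at h3 ⊢
    refine (qp_congr ?_ _).trans (h3.trans (congrArg₂ (· - ·) (qp_congr ?_ _) (qp_congr ?_ _)))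
    all_goals push_cast [Nat.cast_sub h1]; ring
  | comm_zero α β n =>
    simp only [map_mul, FreeAlgebra.lift_ι_apply, tauGen, MulOpposite.unop_mul,
      MulOpposite.unop_op, smul_mul_assoc, mul_smul_comm, smul_smul, ← qp_add,
      comm_zero β α, add_comm]
  | comm_one α β n =>
    have h := comm_one (r := r) β α (-(n + 1))
    rw [show -(n + 1) + 1 = -n by ring] at h
    simp only [map_mul, map_smul, FreeAlgebra.lift_ι_apply, tauGen, MulOpposite.unop_mul,
      MulOpposite.unop_smul, MulOpposite.unop_op, smul_mul_assoc, mul_smul_comm, smul_smul,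
      ← qp_add, h, min_comm β α]
    congr 2; ring
  | degree α n =>
    simp only [map_mul, map_smul, FreeAlgebra.lift_ι_apply, tauGen, MulOpposite.unop_mul,
      MulOpposite.unop_smul, MulOpposite.unop_op, smul_mul_assoc, mul_smul_comm, smul_smul,
      ← qp_add, M_Dp]
    congr 2; ring
  | top_zero => simp [tauGen, top, qp_zero, Ap_zero]
  | top_succ n =>
    simp only [map_mul, FreeAlgebra.lift_ι_apply, tauGen, MulOpposite.unop_mul,
      MulOpposite.unop_op, smul_mul_assoc, mul_assoc, top, Dp_Ap, Ap_mul', mul_smul_comm,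
      smul_smul, ← qp_add]
    rw [show -(n + 1) = -n + -1 by ring]
    congr 2; push_cast; ring

/-- The time-reversal anti-automorphism `τ`, as a homomorphism to the opposite algebra:
`M_{α,n} ↦ q^{-αn} M_{α,-n}`, `A ↦ A⁻¹`, `Δ ↦ Δ`. -/
def tau (r : ℕ) : U r →ₐ[Rq] (U r)ᵐᵒᵖ := lift (tauGen r) tau_rel

/-- Values of the Weyl reflection on the generators. -/
def sigmaGen (r : ℕ) : Gen → U r
  | .M α n => if α ≤ r + 1 then Ap r (-n) * M r (r + 1 - α) n * Dp r (-1) else 0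
  | .Mi α n => if α ≤ r + 1 then Dp r 1 * Mi r (r + 1 - α) n * Ap r n else 0
  | .A => Ap r (-1)
  | .Ai => Ap r 1
  | .D => Dp r (-1)
  | .Di => Dp r 1

theorem sigma_rel : ∀ ⦃x y⦄, Rel r x y →
    FreeAlgebra.lift Rq (sigmaGen r) x = FreeAlgebra.lift Rq (sigmaGen r) y := by
  intro x y h
  cases h with
  | M_zero n =>
    simp [sigmaGen, top, Ap_mul', Dp_mul, Dp_zero, Ap_zero]
  | M_rank α n h => simp [sigmaGen, show ¬ α ≤ r + 1 by omega]
  | Mi_rank α n h => simp [sigmaGen, show ¬ α ≤ r + 1 by omega]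
  | M_Mi α n h =>
    have e : M r (r + 1 - α) n * (Mi r (r + 1 - α) n * Ap r n) = Ap r n := by
      rw [← mul_assoc, M_Mi n (by omega), one_mul]
    simp [sigmaGen, h, mul_assoc, Dp_mul', Dp_zero, e, Ap_mul, Ap_zero]
  | Mi_M α n h =>
    have e : Mi r (r + 1 - α) n * (M r (r + 1 - α) n * Dp r (-1)) = Dp r (-1) := by
      rw [← mul_assoc, Mi_M n (by omega), one_mul]
    simp [sigmaGen, h, mul_assoc, Ap_mul', Ap_zero, e, Dp_mul, Dp_zero]
  | A_Ai => simp [sigmaGen, Ap_mul, Ap_zero]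
  | Ai_A => simp [sigmaGen, Ap_mul, Ap_zero]
  | D_Di => simp [sigmaGen, Dp_mul, Dp_zero]
  | Di_D => simp [sigmaGen, Dp_mul, Dp_zero]
  | msys α n h1 h2 =>
    obtain ⟨β, hβ⟩ : ∃ β, r + 1 = α + β := ⟨r + 1 - α, by omega⟩
    have hβ' : (r : ℤ) + 1 = α + β := by exact_mod_cast hβ
    have eα : r + 1 - α = β := by omega
    have e1 : r + 1 - (α - 1) = β + 1 := by omega
    have i1 : α - 1 ≤ r + 1 := by omega
    rcases Nat.eq_zero_or_pos β with hb | hb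
    · subst hb
      have i2 : ¬ α + 1 ≤ r + 1 := by omega
      simp only [map_mul, map_smul, map_sub, FreeAlgebra.lift_ι_apply, sigmaGen, if_pos h2,
        if_neg i2, eα, M_zero, mul_assoc, mul_smul_comm, smul_smul, ← qp_add, one_mul,
        zero_mul, sub_zero, Dp_Ap', Ap_mul', Dp_mul]
      rw [show -(n + 1) + -(n - 1) = -n + -n by ring]
      refine qp_congr ?_ _
      rw [hβ']; push_cast; ring
    · have i2 : α + 1 ≤ r + 1 := by omega
      have e2 : r + 1 - (α + 1) = β - 1 := by omega
      have h := msys (r := r) n hb (by omega)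
      have h3 := congrArg (fun x => qp ((α + 3 * β) * n) • (Ap r (-n + -n) *
        (Dp r (-1 + -1) * x))) h
      simp only [map_mul, map_smul, map_sub, FreeAlgebra.lift_ι_apply, sigmaGen, if_pos h2,
        if_pos i1, if_pos i2, eα, e1, e2, mul_assoc, smul_mul_assoc, mul_smul_comm, smul_smul, ← qp_add,
        Dp_Ap', Ap_mul', Dp_mul', M_Ap', M_Dp, M_Dp', mul_sub, smul_sub,
        comm_zero (β - 1) (β + 1)] at h3 ⊢
      rw [show -(n + 1) + -(n - 1) = -n + -n by ring]
      refine (qp_congr ?_ _).trans (h3.trans (congrArg₂ (· - ·) (qp_congr ?_ _) (qp_congr ?_ _)))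
      all_goals rw [hβ']; push_cast [Nat.cast_sub hb]; ring
  | comm_zero α β n =>
    by_cases hα : α ≤ r + 1
    · by_cases hβ : β ≤ r + 1
      · simp only [map_mul, FreeAlgebra.lift_ι_apply, sigmaGen, if_pos hα, if_pos hβ, mul_assoc, smul_mul_assoc,
          mul_smul_comm, smul_smul, ← qp_add, Dp_Ap', Ap_mul', Dp_mul', M_Ap', M_Dp, M_Dp',
          comm_zero (r + 1 - β) (r + 1 - α)]
        refine qp_congr ?_ _
        ring
      · simp [sigmaGen, hβ]
    · simp [sigmaGen, hα]
  | comm_one α β n =>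
    by_cases hα : α ≤ r + 1
    · by_cases hβ : β ≤ r + 1
      · simp only [map_mul, map_smul, FreeAlgebra.lift_ι_apply, sigmaGen, if_pos hα, if_pos hβ,
          mul_assoc, smul_mul_assoc, mul_smul_comm, smul_smul, ← qp_add, Dp_Ap', Ap_mul', Dp_mul', M_Ap',
          M_Dp, M_Dp', comm_one (r + 1 - α) (r + 1 - β)]
        rw [add_comm (-(n + 1)) (-n)]
        refine qp_congr ?_ _
        rcases le_total α β with hab | hab
        · rw [min_eq_left hab, min_eq_right (by omega)]
          push_cast [Nat.cast_sub hα, Nat.cast_sub hβ]; ring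
        · rw [min_eq_right hab, min_eq_left (by omega)]
          push_cast [Nat.cast_sub hα, Nat.cast_sub hβ]; ring
      · simp [sigmaGen, hβ]
    · simp [sigmaGen, hα]
  | degree α n =>
    by_cases hα : α ≤ r + 1
    · simp only [map_mul, map_smul, FreeAlgebra.lift_ι_apply, sigmaGen, if_pos hα, mul_assoc, smul_mul_assoc,
        mul_smul_comm, smul_smul, ← qp_add, Dp_Ap', Dp_mul', M_Dp]
      refine qp_congr ?_ _
      push_cast [Nat.cast_sub hα]; ring
    · simp [sigmaGen, hα]
  | top_zero => simp [sigmaGen, M_zero, Ap_zero]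
  | top_succ n => simp [sigmaGen, M_zero, ← mul_assoc, Ap_mul, add_comm]

/-- The Weyl reflection automorphism `σ`: `M_{α,n} ↦ A^{-n} M_{r+1-α,n} Δ⁻¹`, `A ↦ A⁻¹`,
`Δ ↦ Δ⁻¹`. -/
def sigma (r : ℕ) : U r →ₐ[Rq] U r := lift (sigmaGen r) sigma_rel

theorem shift_M (α : ℕ) (n : ℤ) : shift r (M r α n) = M r α (n + 1) := lift_mk _ _ _
theorem shift_Mi (α : ℕ) (n : ℤ) : shift r (Mi r α n) = Mi r α (n + 1) := lift_mk _ _ _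

theorem tau_M (α : ℕ) (n : ℤ) :
    (tau r (M r α n)).unop = qp (-(α * n)) • M r α (-n) := by
  rw [tau, M, lift_mk]; rfl

theorem sigma_M {α : ℕ} (n : ℤ) (h : α ≤ r + 1) :
    sigma r (M r α n) = Ap r (-n) * M r (r + 1 - α) n * Dp r (-1) := by
  rw [sigma, M, lift_mk, sigmaGen, if_pos h]

end Relations

/-! ### The Miura operator and the conserved quantities -/

/-- The variable of the skew polynomial ring over `U r` acts as the time shift: `D a = D(a) D`. -/
instance (r : ℕ) : MulSemiringAction (Multiplicative ℕ) (U r) :=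
  MulSemiringAction.compHom (U r) (powersHom (U r →+* U r) (shift r).toRingHom)

section Miura

variable (r : ℕ)

/-- `x_{α,n} = ξ_{α,n}⁻¹ ξ_{α-1,n}` where `ξ_{α,n} = M_{α,n} M_{α,n+1}⁻¹`, for `1 ≤ α ≤ r + 1`. -/
def x (α : ℕ) (n : ℤ) : U r :=
  (M r α (n + 1) * Mi r α n) * (M r (α - 1) n * Mi r (α - 1) (n + 1))

/-- The product `(D - x_{k,n}) ⋯ (D - x_{1,n})` of skew polynomials in `D`. -/
def miuraAux (n : ℤ) : ℕ → SkewPolynomial (U r)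
  | 0 => 1
  | k + 1 => (SkewPolynomial.X - SkewPolynomial.C (x r (k + 1) n)) * miuraAux n k

/-- The Miura operator `μ_n = (D - x_{r+1,n}) ⋯ (D - x_{1,n})`. -/
def miura (n : ℤ) : SkewPolynomial (U r) := miuraAux r n (r + 1)

/-- The conserved quantities: `μ_n = ∑_{m=0}^{r+1} (-1)^m C_m D^{r+1-m}`. They are read off from
the Miura operator at a base point `n`. -/
def cons (n : ℤ) (m : ℕ) : U r := (-1) ^ m * (miura r n).coeff (r + 1 - m)

end Miura

section MiuraFacts

variable {r : ℕ}

theorem smul_eq_shift (a : U r) : Multiplicative.ofAdd 1 • a = shift r a := by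
  change (powersHom (U r →+* U r) (shift r).toRingHom (Multiplicative.ofAdd 1)) a = _
  rw [powersHom_apply, toAdd_ofAdd, pow_one]; rfl

theorem coeff_sub (p q : SkewPolynomial (U r)) (j : ℕ) :
    (p - q).coeff j = p.coeff j - q.coeff j := by
  have h := SkewPolynomial.coeff_add (p - q) q j
  rw [sub_add_cancel] at h
  rw [h, add_sub_cancel_right]

theorem coeff_C_mul (a : U r) (p : SkewPolynomial (U r)) (j : ℕ) :
    (SkewPolynomial.C a * p).coeff j = a * p.coeff j :=
  SkewMonoidAlgebra.coeff_single_one_mul p a (Multiplicative.ofAdd j)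

theorem coeff_X_mul_zero (p : SkewPolynomial (U r)) :
    (SkewPolynomial.X * p).coeff 0 = 0 := by
  refine SkewMonoidAlgebra.coeff_single_mul_of_not_exists_mul (1 : U r) p ?_
  rintro ⟨d, hd⟩
  have := congrArg Multiplicative.toAdd hd
  simp only [toAdd_mul, toAdd_ofAdd] at this
  omega

theorem coeff_X_mul_succ (p : SkewPolynomial (U r)) (j : ℕ) :
    (SkewPolynomial.X * p).coeff (j + 1) = shift r (p.coeff j) := by
  have h := SkewMonoidAlgebra.coeff_single_mul_aux p (r := (1 : U r))
    (x := Multiplicative.ofAdd 1) (y := Multiplicative.ofAdd (j + 1))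
    (z := Multiplicative.ofAdd j) (fun a => by
      rw [add_comm j 1, ofAdd_add, mul_right_inj])
  rw [one_mul, smul_eq_shift] at h
  exact h

theorem miuraAux_coeff_zero (n : ℤ) (k : ℕ) :
    (miuraAux r n (k + 1)).coeff 0 = -(x r (k + 1) n * (miuraAux r n k).coeff 0) := by
  rw [miuraAux, sub_mul, coeff_sub, coeff_X_mul_zero, coeff_C_mul, zero_sub]

theorem miuraAux_coeff_succ (n : ℤ) (k j : ℕ) :
    (miuraAux r n (k + 1)).coeff (j + 1) =
      shift r ((miuraAux r n k).coeff j) - x r (k + 1) n * (miuraAux r n k).coeff (j + 1) := by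
  rw [miuraAux, sub_mul, coeff_sub, coeff_X_mul_succ, coeff_C_mul]

theorem miuraAux_coeff_gt (n : ℤ) (k : ℕ) :
    (miuraAux r n k).coeff k = 1 ∧ ∀ j, k < j → (miuraAux r n k).coeff j = 0 := by
  induction k with
  | zero => exact ⟨by simp [miuraAux], fun j hj => by
      rw [miuraAux, SkewPolynomial.coeff_one, if_neg (by omega)]⟩
  | succ k ih =>
    refine ⟨by rw [miuraAux_coeff_succ, ih.1, ih.2 _ (Nat.lt_succ_self k)]; simp, fun j hj => ?_⟩
    obtain ⟨i, rfl⟩ : ∃ i, j = i + 1 := ⟨j - 1, by omega⟩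
    rw [miuraAux_coeff_succ, ih.2 i (by omega), ih.2 (i + 1) (by omega)]; simp

theorem cons_zero (n : ℤ) : cons r n 0 = 1 := by
  simp [cons, miura, (miuraAux_coeff_gt n (r + 1)).1]

theorem miuraAux_coeff_zero_eq (n : ℤ) {k : ℕ} (hk : k ≤ r + 1) :
    (miuraAux r n k).coeff 0 = (-1) ^ k * (M r k (n + 1) * Mi r k n) := by
  induction k with
  | zero =>
    have h : Mi r 0 n = 1 := by simpa [M_zero] using Mi_M (r := r) (α := 0) n (by omega)
    simp [miuraAux, M_zero, h]
  | succ k ih =>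
    have h1 : Mi r k (n + 1) * (M r k (n + 1) * Mi r k n) = Mi r k n := by
      rw [← mul_assoc, Mi_M _ (by omega), one_mul]
    have h2 : ∀ y : U r, y * (-1) ^ k = (-1) ^ k * y := fun y =>
      ((Commute.neg_one_right y).pow_right k).eq
    rw [miuraAux_coeff_zero, ih (by omega), x, Nat.add_sub_cancel, pow_succ, ← mul_assoc _ ((-1) ^ k),
      h2, mul_assoc, mul_assoc (M r (k + 1) (n + 1) * Mi r (k + 1) n), mul_assoc (M r k n), h1,
      M_Mi n (by omega), mul_one, mul_neg_one, neg_mul]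

/-- The last conserved quantity is `A`. -/
theorem cons_top (n : ℤ) : cons r n (r + 1) = Ap r 1 := by
  rw [cons, Nat.sub_self, miura, miuraAux_coeff_zero_eq n le_rfl, top_succ, mul_assoc (Ap r 1),
    M_Mi n le_rfl, mul_one, ← mul_assoc, ← pow_add, Even.neg_one_pow ⟨r + 1, rfl⟩, one_mul]

end MiuraFacts

/-! ### Formal distributions -/

/-- A formal distribution `∑_{i ∈ ℤ} a_i z^i`. -/
abbrev Dist (B : Type) : Type := ℤ → B

/-- A formal distribution `∑_{i,j ∈ ℤ} a_{i,j} z^i w^j`. -/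
abbrev Dist₂ (B : Type) : Type := ℤ → ℤ → B

section Distributions

variable {B : Type} [Ring B]

/-- The product `a(z) b(w)`. -/
def prodZW (a b : Dist B) : Dist₂ B := fun i j => a i * b j

/-- The product `b(w) a(z)`. -/
def prodWZ (b a : Dist B) : Dist₂ B := fun i j => b j * a i

/-- The product `(s z + t w) F(z, w)`, for scalars `s` and `t`. -/
def linMul [Algebra Rq B] (s t : Rq) (F : Dist₂ B) : Dist₂ B := fun i j =>
  s • F (i - 1) j + t • F i (j - 1)

/-- `δ(z/w) = ∑_{n ∈ ℤ} z^n w^{-n}`. -/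
def delta : Dist₂ B := fun i j => if i + j = 0 then 1 else 0

/-- The product `δ(z/w) g(z)`. For given `i` and `j` only one summand is nonzero. -/
def deltaMul (g : Dist B) : Dist₂ B := fun i j => ∑ᶠ n : ℤ, delta n j * g (i - n)

theorem deltaMul_apply (g : Dist B) (i j : ℤ) : deltaMul g i j = g (i + j) := by
  rw [deltaMul, finsum_eq_single _ (-j)]
  · simp [delta]
  · intro n hn
    rw [delta, if_neg (by omega), zero_mul]

/-- A power series in `z` as a formal distribution. -/
def ofSeries (s : PowerSeries B) : Dist B :=
  fun i => if 0 ≤ i then PowerSeries.coeff i.toNat s else 0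

/-- A power series in `z⁻¹` as a formal distribution in `z`. -/
def ofSeriesInv (s : PowerSeries B) : Dist B :=
  fun i => if i ≤ 0 then PowerSeries.coeff (-i).toNat s else 0

end Distributions

/-! ### The currents -/

section Currents

variable (r : ℕ)

/-- `𝔪(z) = ∑ M_{1,n} z^n`. -/
def m : Dist (U r) := fun n => M r 1 n

/-- `𝔢(z) = 𝔪(q^{1/2} z)`. -/
def e : Dist (U r) := fun n => qh n • m r n

/-- `𝔣(z) = σ(τ(𝔢(z)))`, where `σ` and `τ` are applied to the coefficients. -/
def f : Dist (U r) := fun n => sigma r (tau r (e r n)).unop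

/-- The polynomial `C(q^{c/2} z) = ∑_{m=0}^{r+1} (-q^{c/2} z)^m C_m` as a power series in `z`;
the conserved quantities are taken from the Miura operator at the base point `n`. -/
def consSeries (n c : ℤ) : PowerSeries (U r) :=
  PowerSeries.mk fun k => if k ≤ r + 1 then ((-1) ^ k * qh (c * k)) • cons r n k else 0

/-- `C(q^{c/2} z) / (q^{c/2} z)^{r+1} = ∑_{j=0}^{r+1} (-1)^{r+1-j} q^{-cj/2} C_{r+1-j} z^{-j}`
as a power series in `z⁻¹`. -/
def consSeriesInv (n c : ℤ) : PowerSeries (U r) :=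
  PowerSeries.mk fun j =>
    if j ≤ r + 1 then ((-1) ^ (r + 1 - j) * qh (-c * j)) • cons r n (r + 1 - j) else 0

/-- `ψ⁺(z) = (-q^{-1/2} z)^{r+1} A C(q^{1/2} z)⁻¹ C(q^{-1/2} z)⁻¹`, expanded in powers of `z`. -/
def psiPlus (n : ℤ) : Dist (U r) :=
  ofSeries (PowerSeries.X ^ (r + 1) *
    PowerSeries.C (((-1) ^ (r + 1) * qh (-(r + 1))) • (A r : U r)) *
    PowerSeries.invOfUnit (consSeries r n 1) 1 * PowerSeries.invOfUnit (consSeries r n (-1)) 1)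

/-- `ψ⁻(z) = (-q^{1/2} z)^{-r-1} A (C(q^{1/2} z) / (q^{1/2} z)^{r+1})⁻¹
(C(q^{-1/2} z) / (q^{-1/2} z)^{r+1})⁻¹`, expanded in powers of `z⁻¹`. The constant term of each
of the two inverted series is the unit `(-1)^{r+1} A`. -/
def psiMinus (n : ℤ) : Dist (U r) :=
  ofSeriesInv (PowerSeries.X ^ (r + 1) *
    PowerSeries.C (((-1) ^ (r + 1) * qh (-(r + 1))) • (A r : U r)) *
    PowerSeries.invOfUnit (consSeriesInv r n 1) ((-1) ^ (r + 1) * A r) *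
    PowerSeries.invOfUnit (consSeriesInv r n (-1)) ((-1) ^ (r + 1) * A r))

end Currents

section CurrentFacts

variable {r : ℕ}

/-- The inverses in `psiPlus` are genuine inverses. -/
theorem consSeries_mul_inv (n c : ℤ) :
    consSeries r n c * PowerSeries.invOfUnit (consSeries r n c) 1 = 1 := by
  apply PowerSeries.mul_invOfUnit
  rw [← PowerSeries.coeff_zero_eq_constantCoeff_apply, consSeries, PowerSeries.coeff_mk]
  simp [cons_zero, qh_zero]

/-- The inverses in `psiMinus` are genuine inverses. -/
theorem consSeriesInv_mul_inv (n c : ℤ) :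
    consSeriesInv r n c *
      PowerSeries.invOfUnit (consSeriesInv r n c) ((-1) ^ (r + 1) * A r) = 1 := by
  apply PowerSeries.mul_invOfUnit
  rw [← PowerSeries.coeff_zero_eq_constantCoeff_apply, consSeriesInv, PowerSeries.coeff_mk]
  have h : ((-1 : Rq) ^ (r + 1)) • Ap r 1 = (-1) ^ (r + 1) * Ap r 1 := by
    rw [Algebra.smul_def]; simp
  simp only [Nat.zero_le, if_true, Nat.sub_zero, cons_top, Nat.cast_zero, mul_zero, qh_zero,
    mul_one, h]
  simp [Ap]

/-- `𝔣(z) = ∑ z^{-n} q^{n/2} A^{-n} M_{r,n} Δ⁻¹`. -/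
theorem f_neg (n : ℤ) : f r (-n) = qh n • (Ap r (-n) * M r r n * Dp r (-1)) := by
  have h : (tau r (e r (-n))).unop = (qh (-n) * qp n) • M r 1 n := by
    rw [e, m, map_smul, MulOpposite.unop_smul, tau_M, smul_smul]
    simp
  rw [f, h, map_smul, sigma_M n (by omega), qp, ← qh_add, Nat.add_sub_cancel]
  congr 2; ring

end CurrentFacts

end QSystem
end

/-! Write ζ for a central variable, M_n for M_{1,n} and F_n for A^{-n} M_{r,n} Δ⁻¹ (`dualM`).

The M-system says that the factorisations at base points n and n+1 differ by a gauge correction: the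
partial products P_k = (D - x_k)⋯(D - x_1) at n+1 are P_k - w_k P_{k-1} at n
(`coeff_miuraAux_succ`). Since M_{r+1,n+1} M_{r+1,n}⁻¹ = A for all n, w_{r+1} = 0, so the C_m do not
depend on the base point (`cons_base`). The same formula removes the shift from the skew product:
C(ζ) is a noncommutative continuant in the x_j and w_j (`miuraCont_full`), which can be expanded
from either end.

Among the x_j and w_j at base point n, only x_1 fails to commute with M_n. The low end expansion
therefore gives polynomials g_n (`currentPoly`) with C M_n = g_n - ζ g_{n+1} and M_n C = g_n - qζ
g_{n+1}. Hence C(ζ)⁻¹ g_n(ζ) and g_n(q⁻¹ζ) C(q⁻¹ζ)⁻¹ satisfy the same recursion G_n = M_n + ζ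
G_{n+1}. Both are half of the current: ∑_{k≥0} ζ^k M_{n+k} when expanded in ζ, and -∑_{k≥1} ζ^{-k}
M_{n-k} when expanded in ζ⁻¹.

For the bracket, C(ζ) [G_n, F_n] C(q⁻¹ζ) = g_n(ζ) F_n C(q⁻¹ζ) - C(ζ) F_n g_n(q⁻¹ζ), and an Euler
type identity for continuants evaluates this as a scalar times ζ^{r+1} A (`currentPoly_exchange`).
At ζ = q^{1/2} z, dividing back gives a multiple of ψ; the expansions at 0 and ∞ produce ψ⁺ and -ψ⁻.

The exchange rules of C(ζ) with M_n - ζ M_{n+1} and with F_{n+1} - ζ F_n (`consPoly_star`,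
`consPoly_dual_star`) give the 𝔢𝔢, ψ𝔢 and ψ𝔣 relations; 𝔣𝔣 is the image of 𝔢𝔢 under στ. The leading
coefficients are units times scalars that are units, so they are nonzero once the algebra is
nontrivial, which a representation at q = 1 shows. -/

noncomputable section
namespace QSystem

/-! ### Elements commuting up to a power of `q` -/

section QComm

variable {B B' : Type} [Ring B] [Algebra Rq B] [Ring B'] [Algebra Rq B']

/-- `a b = q^k b a`. -/
def QComm (k : ℤ) (a b : B) : Prop := a * b = qp k • (b * a)

theorem qp_smul_smul (i j : ℤ) (b : B) : qp i • qp j • b = qp (i + j) • b := by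
  rw [smul_smul, qp_add]

theorem qp_zero_smul (b : B) : qp 0 • b = b := by rw [qp_zero, one_smul]

theorem qp_smul_cancel {k : ℤ} {a b : B} (h : qp k • a = qp k • b) : a = b := by
  have h' := congrArg (fun y => qp (-k) • y) h
  simpa only [qp_smul_smul, neg_add_cancel, qp_zero_smul] using h'

namespace QComm

variable {k l : ℤ} {a b c : B}

theorem eq (h : QComm k a b) : a * b = qp k • (b * a) := h

theorem congr (h : QComm k a b) (e : k = l) : QComm l a b := e ▸ h

theorem commute (h : QComm k a b) (e : k = 0) : Commute a b := by
  subst e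
  rw [Commute, SemiconjBy, h.eq, qp_zero_smul]

theorem of_commute (h : Commute a b) : QComm 0 a b := by
  rw [QComm, qp_zero_smul, h.eq]

theorem symm (h : QComm k a b) : QComm (-k) b a := by
  rw [QComm, h.eq, qp_smul_smul, neg_add_cancel, qp_zero_smul]

theorem mul_right (h : QComm k a b) (h' : QComm l a c) : QComm (k + l) a (b * c) := by
  rw [QComm, ← mul_assoc, h.eq, smul_mul_assoc, mul_assoc, h'.eq, mul_smul_comm, qp_smul_smul,
    mul_assoc]

theorem mul_left (h : QComm k a c) (h' : QComm l b c) : QComm (k + l) (a * b) c :=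
  ((h.symm.mul_right h'.symm).symm).congr (by ring)

theorem neg_right (h : QComm k a b) : QComm k a (-b) := by
  rw [QComm, mul_neg, h.eq, neg_mul, smul_neg]

theorem neg_left (h : QComm k a b) : QComm k (-a) b := by
  rw [QComm, neg_mul, h.eq, mul_neg, smul_neg]

theorem smul_left (s : Rq) (h : QComm k a b) : QComm k (s • a) b := by
  rw [QComm, smul_mul_assoc, h.eq, mul_smul_comm, smul_comm]

theorem inv_right (h : QComm k a b) (h1 : b * c = 1) (h2 : c * b = 1) : QComm (-k) a c := by
  have h3 := congrArg (fun y => qp (-k) • (c * y * c)) h.eq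
  simp only [mul_smul_comm, smul_mul_assoc, qp_smul_smul, neg_add_cancel, qp_zero_smul] at h3
  rw [← mul_assoc c b a, h2, one_mul, mul_assoc, mul_assoc a, h1, mul_one] at h3
  exact h3.symm

theorem inv_left (h : QComm k b a) (h1 : b * c = 1) (h2 : c * b = 1) : QComm (-k) c a :=
  ((h.symm.inv_right h1 h2).symm).congr (by ring)

theorem map (φ : B →ₐ[Rq] B') (h : QComm k a b) : QComm k (φ a) (φ b) := by
  rw [QComm, ← map_mul, h.eq, map_smul, map_mul]

end QComm

end QComm

/-! ### Ratios of consecutive generators -/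

section Ratios

variable {r : ℕ}

theorem qcomm_M (α β : ℕ) (n : ℤ) : QComm 0 (M r α n) (M r β n) :=
  .of_commute (comm_zero α β n)

theorem qcomm_M_succ (α β : ℕ) (n : ℤ) : QComm (min α β : ℕ) (M r α n) (M r β (n + 1)) :=
  comm_one α β n

theorem qcomm_succ_M (α β : ℕ) (n : ℤ) : QComm (-(min α β : ℕ)) (M r α (n + 1)) (M r β n) := by
  rw [min_comm]; exact (qcomm_M_succ β α n).symm

theorem QComm.Mi_right {k : ℤ} {a : U r} {β : ℕ} {n : ℤ} (hβ : β ≤ r + 1)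
    (h : QComm k a (M r β n)) : QComm (-k) a (Mi r β n) :=
  h.inv_right (M_Mi n hβ) (Mi_M n hβ)

theorem QComm.Mi_left {k : ℤ} {a : U r} {β : ℕ} {n : ℤ} (hβ : β ≤ r + 1)
    (h : QComm k (M r β n) a) : QComm (-k) (Mi r β n) a :=
  h.inv_left (M_Mi n hβ) (Mi_M n hβ)

variable (r) in
/-- The ratio `M_{k,n+1} M_{k,n}⁻¹`. -/
def ratio (k : ℕ) (n : ℤ) : U r := M r k (n + 1) * Mi r k n

variable (r) in
/-- The ratio `ξ_{k,n} = M_{k,n} M_{k,n+1}⁻¹`. -/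
def ratioInv (k : ℕ) (n : ℤ) : U r := M r k n * Mi r k (n + 1)

theorem ratio_mul_inv {k : ℕ} (hk : k ≤ r + 1) (n : ℤ) : ratio r k n * ratioInv r k n = 1 := by
  rw [ratio, ratioInv, mul_assoc, ← mul_assoc (Mi r k n), Mi_M n hk, one_mul, M_Mi _ hk]

theorem ratioInv_mul {k : ℕ} (hk : k ≤ r + 1) (n : ℤ) : ratioInv r k n * ratio r k n = 1 := by
  rw [ratio, ratioInv, mul_assoc, ← mul_assoc (Mi r k (n + 1)), Mi_M _ hk, one_mul, M_Mi _ hk]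

theorem x_succ (k : ℕ) (n : ℤ) : x r (k + 1) n = ratio r (k + 1) n * ratioInv r k n := rfl

theorem Mi_zero (n : ℤ) : Mi r 0 n = 1 := by
  simpa [M_zero] using Mi_M (r := r) (α := 0) n (by omega)

theorem ratioInv_zero (n : ℤ) : ratioInv r 0 n = 1 := by simp [ratioInv, M_zero, Mi_zero]

theorem ratio_top (n : ℤ) : ratio r (r + 1) n = Ap r 1 := by
  rw [ratio, top_succ, mul_assoc, M_Mi n le_rfl, mul_one]

/-- This is the M-system at time n+1 divided by M_{k+1,n+1} M_{k+1,n}; the factor q^{k+1} is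
absorbed by exchanging these two generators. -/
theorem ratio_succ_sub {k : ℕ} (hk : k + 1 ≤ r + 1) (n : ℤ) :
    ratio r (k + 1) (n + 1) - ratio r (k + 1) n =
      -(M r (k + 2) (n + 1) * Mi r (k + 1) (n + 1) * (M r k (n + 1) * Mi r (k + 1) n)) := by
  have h := msys (r := r) (n + 1) (Nat.succ_pos k) hk
  rw [add_sub_cancel_right, Nat.succ_eq_add_one, Nat.add_sub_cancel] at h
  have hc := (qcomm_M_succ (r := r) (k + 1) (k + 1) n).eq
  rw [min_self] at hc
  -- multiply by `M_{k+1,n+1} M_{k+1,n}` on the right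
  have e1 : ratio r (k + 1) (n + 1) * (M r (k + 1) (n + 1) * M r (k + 1) n) =
      M r (k + 1) (n + 1 + 1) * M r (k + 1) n := by
    rw [ratio, mul_assoc, ← mul_assoc (Mi r _ _), Mi_M _ hk, one_mul]
  have e2 : qp (k + 1 : ℕ) • (ratio r (k + 1) n * (M r (k + 1) (n + 1) * M r (k + 1) n)) =
      M r (k + 1) (n + 1) * M r (k + 1) (n + 1) := by
    rw [← mul_smul_comm, ← hc, ratio, mul_assoc, ← mul_assoc (Mi r _ _), Mi_M _ hk, one_mul]
  have e3 : M r (k + 2) (n + 1) * Mi r (k + 1) (n + 1) * (M r k (n + 1) * Mi r (k + 1) n) *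
      (qp (k + 1 : ℕ) • (M r (k + 1) (n + 1) * M r (k + 1) n)) =
      M r (k + 2) (n + 1) * M r k (n + 1) := by
    rw [← hc]
    calc _ = M r (k + 2) (n + 1) * Mi r (k + 1) (n + 1) * M r k (n + 1) *
          (Mi r (k + 1) n * M r (k + 1) n) * M r (k + 1) (n + 1) := by simp only [mul_assoc]
      _ = M r (k + 2) (n + 1) * (Mi r (k + 1) (n + 1) * M r (k + 1) (n + 1)) * M r k (n + 1) := by
          rw [Mi_M _ hk, mul_one, mul_assoc, comm_zero k (k + 1)]; simp only [mul_assoc]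
      _ = _ := by rw [Mi_M _ hk, mul_one]
  have key : (ratio r (k + 1) (n + 1) - ratio r (k + 1) n +
      M r (k + 2) (n + 1) * Mi r (k + 1) (n + 1) * (M r k (n + 1) * Mi r (k + 1) n)) *
      (qp (k + 1 : ℕ) • (M r (k + 1) (n + 1) * M r (k + 1) n)) = 0 := by
    rw [add_mul, sub_mul, e3, mul_smul_comm, mul_smul_comm, e1, e2, h]
    abel
  rw [mul_smul_comm, ← smul_zero (qp (k + 1 : ℕ))] at key
  have key' := congrArg (fun y => y * (Mi r (k + 1) n * Mi r (k + 1) (n + 1)))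
    (qp_smul_cancel key)
  simp only [zero_mul] at key'
  rw [mul_assoc, mul_assoc (M r (k + 1) (n + 1)), ← mul_assoc (M r (k + 1) n), M_Mi _ hk, one_mul,
    M_Mi _ hk, mul_one] at key'
  exact eq_neg_of_add_eq_zero_left key'

theorem ratioInv_sub_succ {k : ℕ} (hk : k + 1 ≤ r + 1) (n : ℤ) :
    ratioInv r (k + 1) n - ratioInv r (k + 1) (n + 1) =
      ratioInv r (k + 1) (n + 1) * (ratio r (k + 1) (n + 1) - ratio r (k + 1) n) *
        ratioInv r (k + 1) n := by
  rw [mul_sub, sub_mul, ratioInv_mul hk, one_mul, mul_assoc, ratio_mul_inv hk, mul_one]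

variable (r) in
/-- The coefficients `w_{k,n}` of the correction terms relating the partial Miura operators at two
consecutive base points. -/
def w : ℕ → ℤ → U r
  | 0, _ => 0
  | k + 1, n => (ratio r (k + 1) (n + 1) - ratio r (k + 1) n) * ratioInv r k n

theorem w_top (n : ℤ) : w r (r + 1) n = 0 := by
  rw [w, ratio_top, ratio_top, sub_self, zero_mul]

/-- In this monomial form only times n and n+1 occur, so commutation with M_{β,n} and M_{β,n+1} can
be read off from the defining relations. -/
theorem w_eq {k : ℕ} (hk : k + 1 ≤ r + 1) (n : ℤ) :
    w r (k + 1) n =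
      -(M r (k + 2) (n + 1) * Mi r (k + 1) (n + 1) * (M r k n * Mi r (k + 1) n)) := by
  have hc : Commute (M r k (n + 1)) (Mi r (k + 1) n * M r k n) :=
    (((qcomm_succ_M k (k + 1) n).Mi_right hk).mul_right (qcomm_succ_M k k n)).commute (by simp)
  have hc' : Commute (M r k n) (Mi r (k + 1) n) := ((qcomm_M k (k + 1) n).Mi_right hk).commute rfl
  rw [w, ratio_succ_sub hk, neg_mul, neg_inj, mul_assoc]
  congr 1
  rw [ratioInv, ← mul_assoc, mul_assoc (M r k (n + 1)), hc.eq, mul_assoc, M_Mi _ (by omega),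
    mul_one, hc'.eq]

/-- The definition of w differences the ratio on the left; this second form differences the inverse
ratio on the right. Having both is what makes the two compatibility identities `x_add_w` and
`x_mul_w` telescope. -/
theorem w_succ_eq {k : ℕ} (hk : k ≤ r) (n : ℤ) :
    w r k (n + 1) = ratio r (k + 1) (n + 1) * (ratioInv r k n - ratioInv r k (n + 1)) := by
  obtain _ | k := k
  · rw [ratioInv_zero, ratioInv_zero, sub_self, mul_zero, w]
  have h1 : k + 1 ≤ r + 1 := by omega
  have h2 : k + 2 ≤ r + 1 := by omega
  have hc : Commute (Mi r (k + 2) (n + 1) * M r (k + 1) (n + 1)) (Mi r (k + 1) (n + 1 + 1)) :=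
    ((((qcomm_M_succ (k + 2) (k + 1) (n + 1)).Mi_right h1).Mi_left h2).mul_left
      ((qcomm_M_succ (k + 1) (k + 1) (n + 1)).Mi_right h1)).commute (by simp)
  rw [ratioInv_sub_succ h1, ratio_succ_sub h1, w_eq h1, mul_neg, neg_mul, mul_neg, neg_inj]
  symm
  calc _ = M r (k + 2) (n + 1 + 1) * (Mi r (k + 2) (n + 1) * M r (k + 1) (n + 1) *
          Mi r (k + 1) (n + 1 + 1)) * M r (k + 2) (n + 1) * Mi r (k + 1) (n + 1) * M r k (n + 1) *
          (Mi r (k + 1) n * M r (k + 1) n) * Mi r (k + 1) (n + 1) := by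
        simp only [ratio, ratioInv, mul_assoc]
    _ = M r (k + 2) (n + 1 + 1) * Mi r (k + 1) (n + 1 + 1) * (Mi r (k + 2) (n + 1) *
          (M r (k + 1) (n + 1) * M r (k + 2) (n + 1)) * Mi r (k + 1) (n + 1)) * M r k (n + 1) *
          Mi r (k + 1) (n + 1) := by
        rw [Mi_M _ h1, mul_one, hc.eq]; simp only [mul_assoc]
    _ = _ := by
        rw [comm_zero (k + 1) (k + 2), ← mul_assoc (Mi r _ _), Mi_M _ h2, one_mul, M_Mi _ h1,
          mul_one]
        simp only [mul_assoc]

/-- Both sides equal `ratio r (k + 1) (n + 1) * ratioInv r k n`. -/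
theorem x_add_w {k : ℕ} (hk : k ≤ r) (n : ℤ) :
    x r (k + 1) (n + 1) + w r k (n + 1) = x r (k + 1) n + w r (k + 1) n := by
  rw [w_succ_eq hk, x_succ, x_succ, w]
  noncomm_ring

/-- Together with `x_add_w` this is the condition for (D - x_{k+1,n+1})(P_k - w_{k,n} P_{k-1}) =
P_{k+1} - w_{k+1,n} P_k, where P_k is the partial Miura product at n. -/
theorem x_mul_w {k : ℕ} (hk : k + 1 ≤ r) (n : ℤ) :
    x r (k + 2) (n + 1) * w r (k + 1) n = w r (k + 1) (n + 1) * x r (k + 1) n := by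
  have h := ratioInv_mul (r := r) (k := k + 1) (by omega) n
  have h' := ratioInv_mul (r := r) (k := k + 1) (by omega) (n + 1)
  rw [w_succ_eq hk, x_succ, x_succ, w]
  calc _ = ratio r (k + 2) (n + 1) * (ratioInv r (k + 1) (n + 1) * ratio r (k + 1) (n + 1) -
        ratioInv r (k + 1) (n + 1) * ratio r (k + 1) n) * ratioInv r k n := by noncomm_ring
    _ = ratio r (k + 2) (n + 1) * (ratioInv r (k + 1) n * ratio r (k + 1) n -
        ratioInv r (k + 1) (n + 1) * ratio r (k + 1) n) * ratioInv r k n := by rw [h, h']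
    _ = _ := by noncomm_ring

/-! ### Commutation relations of the coefficients -/

theorem min_succ_sub (β j : ℕ) :
    ((min β (j + 1) : ℕ) : ℤ) - (min β j : ℕ) = if j < β then 1 else 0 := by
  split_ifs <;> omega

/-- Since x_{j+1} is a monomial in generators with indices j+1 and j, the exponent is a difference
of consecutive values of min(β, ·), hence 0 or 1. The same principle governs all the exponents
below. -/
theorem qcomm_M_x (β : ℕ) {j : ℕ} (hj : j ≤ r) (n : ℤ) :
    QComm (if j < β then 1 else 0) (M r β n) (x r (j + 1) n) :=
  (((qcomm_M_succ β (j + 1) n).mul_right ((qcomm_M β (j + 1) n).Mi_right (by omega))).mul_right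
    ((qcomm_M β j n).mul_right ((qcomm_M_succ β j n).Mi_right (by omega)))).congr (by
      rw [← min_succ_sub]; ring)

theorem qcomm_succ_x (β : ℕ) {j : ℕ} (hj : j ≤ r) (n : ℤ) :
    QComm (if j < β then 1 else 0) (M r β (n + 1)) (x r (j + 1) n) :=
  (((qcomm_M β (j + 1) (n + 1)).mul_right ((qcomm_succ_M β (j + 1) n).Mi_right
    (by omega))).mul_right ((qcomm_succ_M β j n).mul_right
      ((qcomm_M β j (n + 1)).Mi_right (by omega)))).congr (by rw [← min_succ_sub]; ring)

theorem qcomm_M_w (β : ℕ) {j : ℕ} (hj : j ≤ r) (n : ℤ) :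
    QComm (if j + 1 < β then 1 else 0) (M r β n) (w r (j + 1) n) := by
  rw [w_eq (by omega)]
  exact ((((qcomm_M_succ β (j + 2) n).mul_right ((qcomm_M_succ β (j + 1) n).Mi_right
    (by omega))).mul_right ((qcomm_M β j n).mul_right
      ((qcomm_M β (j + 1) n).Mi_right (by omega)))).congr (by rw [← min_succ_sub]; ring)).neg_right

theorem qcomm_succ_w (β : ℕ) {j : ℕ} (hj : j ≤ r) (n : ℤ) :
    QComm (if j < β then 1 else 0) (M r β (n + 1)) (w r (j + 1) n) := by
  rw [w_eq (by omega)]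
  exact ((((qcomm_M β (j + 2) (n + 1)).mul_right ((qcomm_M β (j + 1) (n + 1)).Mi_right
    (by omega))).mul_right ((qcomm_succ_M β j n).mul_right
      ((qcomm_succ_M β (j + 1) n).Mi_right (by omega)))).congr
        (by rw [← min_succ_sub]; ring)).neg_right

theorem commute_x_x {i j : ℕ} (hij : i < j) (hj : j ≤ r) (n : ℤ) :
    Commute (x r (i + 1) n) (x r (j + 1) n) :=
  (((qcomm_succ_x (i + 1) hj n).mul_left ((qcomm_M_x (i + 1) hj n).Mi_left (by omega))).mul_left
    ((qcomm_M_x i hj n).mul_left ((qcomm_succ_x i hj n).Mi_left (by omega)))).commute (by ring)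

theorem commute_x_w {i j : ℕ} (hij : i < j) (hj : j ≤ r) (n : ℤ) :
    Commute (x r (i + 1) n) (w r (j + 1) n) :=
  (((qcomm_succ_w (i + 1) hj n).mul_left ((qcomm_M_w (i + 1) hj n).Mi_left (by omega))).mul_left
    ((qcomm_M_w i hj n).mul_left ((qcomm_succ_w i hj n).Mi_left (by omega)))).commute (by
      split_ifs <;> omega)

theorem qcomm_w_x {i j : ℕ} (hij : i < j) (hj : j ≤ r) (n : ℤ) :
    QComm (if j = i + 1 then 1 else 0) (w r (i + 1) n) (x r (j + 1) n) := by
  rw [w_eq (by omega)]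
  exact ((((qcomm_succ_x (i + 2) hj n).mul_left ((qcomm_succ_x (i + 1) hj n).Mi_left
    (by omega))).mul_left ((qcomm_M_x i hj n).mul_left
      ((qcomm_M_x (i + 1) hj n).Mi_left (by omega)))).congr (by split_ifs <;> omega)).neg_left

theorem qcomm_w_w {i j : ℕ} (hij : i < j) (hj : j ≤ r) (n : ℤ) :
    QComm (if j = i + 1 then 1 else 0) (w r (i + 1) n) (w r (j + 1) n) := by
  rw [w_eq (k := i) (by omega)]
  exact ((((qcomm_succ_w (i + 2) hj n).mul_left ((qcomm_succ_w (i + 1) hj n).Mi_left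
    (by omega))).mul_left ((qcomm_M_w i hj n).mul_left
      ((qcomm_M_w (i + 1) hj n).Mi_left (by omega)))).congr (by split_ifs <;> omega)).neg_left

theorem qcomm_A_M (α : ℕ) (n : ℤ) : QComm (-α) (Ap r 1) (M r α n) :=
  QComm.symm (QComm.congr (M_Ap α n 1) (mul_one _))

theorem commute_A_x {j : ℕ} (hj : j ≤ r) (n : ℤ) : Commute (Ap r 1) (x r (j + 1) n) :=
  (((qcomm_A_M (j + 1) (n + 1)).mul_right ((qcomm_A_M (j + 1) n).Mi_right (by omega))).mul_right
    ((qcomm_A_M j n).mul_right ((qcomm_A_M j (n + 1)).Mi_right (by omega)))).commute (by ring)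

theorem commute_A_w {j : ℕ} (hj : j ≤ r) (n : ℤ) : Commute (Ap r 1) (w r (j + 1) n) := by
  rw [w_eq (by omega)]
  exact (((qcomm_A_M (j + 2) (n + 1)).mul_right ((qcomm_A_M (j + 1) (n + 1)).Mi_right
    (by omega))).mul_right ((qcomm_A_M j n).mul_right
      ((qcomm_A_M (j + 1) n).Mi_right (by omega)))).neg_right.commute (by push_cast; ring)

end Ratios

/-! ### The Weyl reflected generators -/

section Dual

variable {r : ℕ}

variable (r) in
/-- The element `A^{-n} M_{r,n} Δ⁻¹`, the image of `M_{1,n}` under the Weyl reflection. -/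
def dualM (n : ℤ) : U r := Ap r (-n) * M r r n * Dp r (-1)

theorem dualM_mul (n : ℤ) : dualM r n * M r (r + 1) n = qp (-n) • M r r n := by
  have h : Dp r (-1) * M r (r + 1) n = qp (-((r + 1) * n)) • (M r (r + 1) n * Dp r (-1)) := by
    have := QComm.symm (M_Dp (r := r) (r + 1) n (-1))
    exact this.congr (by push_cast; ring)
  rw [dualM, mul_assoc, h, mul_smul_comm, ← mul_assoc, mul_assoc (Ap r (-n)), comm_zero r (r + 1),
    top, mul_assoc (Ap r n), ← mul_assoc (Ap r (-n)), Ap_mul, neg_add_cancel,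
    Ap_zero, one_mul, mul_assoc, M_Dp, mul_smul_comm, ← mul_assoc, Dp_mul, add_neg_cancel, Dp_zero,
    one_mul, qp_smul_smul]
  exact qp_congr (by ring) _

theorem dualM_eq (n : ℤ) : dualM r n = qp (-n) • (M r r n * Mi r (r + 1) n) := by
  rw [← smul_mul_assoc, ← dualM_mul, mul_assoc, M_Mi n le_rfl, mul_one]

/-- Up to a scalar F_n is M_{r,n} M_{r+1,n}⁻¹, so exponents subtract. Against x_{j+1} this leaves [j
< r] - [j < r+1], so only the top factor x_{r+1} notices F. -/
theorem qcomm_dual {k l : ℤ} {a : U r} {n : ℤ} (h : QComm k (M r r n) a)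
    (h' : QComm l (M r (r + 1) n) a) : QComm (k - l) (dualM r n) a := by
  rw [dualM_eq]
  exact ((h.mul_left (h'.Mi_left le_rfl)).smul_left _).congr (by ring)

theorem qcomm_dual_x {j : ℕ} (hj : j ≤ r) (n : ℤ) :
    QComm (if j = r then -1 else 0) (dualM r n) (x r (j + 1) n) :=
  (qcomm_dual (qcomm_M_x r hj n) (qcomm_M_x (r + 1) hj n)).congr (by split_ifs <;> omega)

theorem qcomm_dual_succ_x {j : ℕ} (hj : j ≤ r) (n : ℤ) :
    QComm (if j = r then -1 else 0) (dualM r (n + 1)) (x r (j + 1) n) :=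
  (qcomm_dual (qcomm_succ_x r hj n) (qcomm_succ_x (r + 1) hj n)).congr (by split_ifs <;> omega)

theorem qcomm_dual_w {j : ℕ} (hj : j < r) (n : ℤ) :
    QComm (if j + 1 = r then -1 else 0) (dualM r n) (w r (j + 1) n) :=
  (qcomm_dual (qcomm_M_w r hj.le n) (qcomm_M_w (r + 1) hj.le n)).congr (by split_ifs <;> omega)

theorem commute_dual_succ_w {j : ℕ} (hj : j < r) (n : ℤ) :
    Commute (dualM r (n + 1)) (w r (j + 1) n) :=
  (qcomm_dual (qcomm_succ_w r hj.le n) (qcomm_succ_w (r + 1) hj.le n)).commute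
    (by split_ifs <;> omega)

theorem commute_dual_M (β : ℕ) (n : ℤ) : Commute (dualM r n) (M r β n) :=
  (qcomm_dual (qcomm_M r β n) (qcomm_M (r + 1) β n)).commute (by simp)

theorem qcomm_A_dual (n : ℤ) : QComm 1 (Ap r 1) (dualM r n) := by
  have h := (qcomm_dual (qcomm_A_M r n).symm (qcomm_A_M (r + 1) n).symm).symm
  exact h.congr (by push_cast; ring)

/-- The mirror image, at the top end of the Miura product, of x_{1,n} M_{1,n} = M_{1,n+1}. -/
theorem x_top_mul_dual (n : ℤ) : x r (r + 1) n * dualM r (n + 1) = dualM r n := by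
  have hc : Commute (Ap r 1) (ratioInv r r n) :=
    ((qcomm_A_M r n).mul_right ((qcomm_A_M r (n + 1)).Mi_right (by omega))).commute (by ring)
  rw [x_succ, ratio_top, hc.eq, dualM, mul_assoc, ← mul_assoc (Ap r 1), ← mul_assoc (Ap r 1),
    Ap_mul]
  have hc2 : Commute (ratioInv r r n) (Ap r (1 + -(n + 1))) := by
    have h := hc.symm
    rw [show Ap r 1 = ((A r : (U r)ˣ) : U r) by simp [Ap]] at h
    exact h.units_zpow_right _
  rw [← mul_assoc, ← mul_assoc, hc2.eq, ratioInv, mul_assoc (Ap r _), mul_assoc (M r r n),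
    Mi_M _ (by omega), mul_one, dualM]
  congr 3; ring

/-- The product `x_{r+1} w_r ⋯ w_{i+1}` for `i + l = r`. -/
def xwProd (n : ℤ) : ℕ → ℕ → U r
  | _, 0 => x r (r + 1) n
  | i, l + 1 => xwProd n (i + 1) l * w r (i + 1) n

/-- Multiplication by w_{k+1} raises the index of the monomial M_{k+1,n+1} M_{k,n}⁻¹ by one, at the
cost of -q⁻¹. Iterating this collapses the whole product `xwProd`. -/
theorem w_mul_M {k : ℕ} (hk : k + 1 ≤ r + 1) (n : ℤ) :
    w r (k + 1) n * (M r (k + 1) (n + 1) * Mi r k n) =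
      -(qp (-1) • (M r (k + 2) (n + 1) * Mi r (k + 1) n)) := by
  have h : QComm (-1) (M r k n * Mi r (k + 1) n) (M r (k + 1) (n + 1)) :=
    ((qcomm_M_succ k (k + 1) n).mul_left ((qcomm_M_succ (k + 1) (k + 1) n).Mi_left hk)).congr
      (by simp)
  have hc : Commute (M r k n) (Mi r (k + 1) n) := ((qcomm_M k (k + 1) n).Mi_right hk).commute rfl
  rw [w_eq hk, neg_mul, neg_inj, mul_assoc, ← mul_assoc (M r k n * _), h.eq, smul_mul_assoc,
    mul_smul_comm, hc.eq, mul_assoc (M r (k + 1) (n + 1)), mul_assoc (Mi r (k + 1) n),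
    M_Mi _ (by omega), mul_one, mul_assoc, ← mul_assoc (Mi r _ _), Mi_M _ hk, one_mul]

theorem xwProd_mul (n : ℤ) : ∀ (l i : ℕ), i + l = r →
    xwProd n i l * (M r (i + 1) (n + 1) * Mi r i n) =
      ((-1) ^ l * qp (-l)) • (x r (r + 1) n * (M r (r + 1) (n + 1) * Mi r r n))
  | 0, i, h => by
    obtain rfl : i = r := by omega
    simp [xwProd, qp_zero]
  | l + 1, i, h => by
    rw [xwProd, mul_assoc, w_mul_M (by omega), mul_neg, mul_smul_comm,
      xwProd_mul n l (i + 1) (by omega), smul_smul, ← neg_smul]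
    congr 1
    rw [show -((l + 1 : ℕ) : ℤ) = -1 + -l by push_cast; ring, qp_add]
    ring

/-- The monomial left over by the continuant exchange identity; its value is the source of A in the
Cartan currents. -/
theorem xwProd_mul_dual (n : ℤ) :
    xwProd n 0 r * (M r 1 (n + 1) * dualM r (n + 1)) =
      ((-1) ^ r * qp (-r - (n + 1))) • Ap r 1 := by
  have h := xwProd_mul (r := r) n r 0 (by omega)
  rw [Mi_zero, mul_one] at h
  have h1 : QComm r (M r (r + 1) (n + 1)) (Mi r r n) :=
    ((qcomm_succ_M (r + 1) r n).Mi_right (by omega)).congr (by simp)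
  have h2 : QComm (-r) (Mi r r (n + 1)) (Mi r r n) :=
    (((qcomm_succ_M r r n).Mi_right (by omega)).Mi_left (by omega)).congr (by simp)
  have h3 : x r (r + 1) n * (M r (r + 1) (n + 1) * Mi r r n) =
      Ap r 1 * (Mi r r (n + 1) * M r (r + 1) (n + 1)) := by
    rw [h1.eq, x_succ, ratio_top, ratioInv, mul_smul_comm, mul_assoc, mul_assoc,
      ← mul_assoc (Mi r r (n + 1)), h2.eq, smul_mul_assoc, mul_smul_comm, mul_smul_comm,
      qp_smul_smul, add_neg_cancel, qp_zero_smul, ← mul_assoc (M r r n), ← mul_assoc (M r r n),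
      M_Mi _ (by omega), one_mul]
  have h4 : Commute (M r (r + 1) (n + 1)) (dualM r (n + 1)) := (commute_dual_M _ _).symm
  rw [← mul_assoc, h, h3, smul_mul_assoc, mul_assoc, mul_assoc, h4.eq, dualM_mul, mul_smul_comm,
    Mi_M _ (by omega), mul_smul_comm, mul_one, smul_smul, mul_assoc, ← qp_add, sub_eq_add_neg]

end Dual

/-! ### The Miura operator at consecutive base points -/

section MiuraShift

variable {r : ℕ}

theorem shift_w (k : ℕ) (n : ℤ) : shift r (w r k n) = w r k (n + 1) := by
  cases k <;> simp [w, ratio, ratioInv, shift_M, shift_Mi]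

theorem shift_x (k : ℕ) (n : ℤ) : shift r (x r k n) = x r k (n + 1) := by
  simp [x, shift_M, shift_Mi]

theorem shift_coeff_miuraAux (n : ℤ) (k : ℕ) : ∀ j : ℕ,
    shift r ((miuraAux r n k).coeff j) = (miuraAux r (n + 1) k).coeff j := by
  induction k with
  | zero => intro j; simp only [miuraAux, SkewPolynomial.coeff_one]; split_ifs <;> simp
  | succ k ih =>
    intro j
    cases j with
    | zero => rw [miuraAux_coeff_zero, miuraAux_coeff_zero, map_neg, map_mul, ih, shift_x]
    | succ j =>
      rw [miuraAux_coeff_succ, miuraAux_coeff_succ, map_sub, map_mul, ih, ih, shift_x]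

/-- Induction on k: multiply by D - x_{k+1,n+1} and replace D P_{k-1} by P_k + x_k P_{k-1};
`x_add_w` and `x_mul_w` match the coefficients. For k = 0 the truncated k - 1 is harmless since w_0
= 0. -/
theorem coeff_miuraAux_succ (n : ℤ) {k : ℕ} (hk : k ≤ r + 1) : ∀ j : ℕ,
    (miuraAux r (n + 1) k).coeff j =
      (miuraAux r n k).coeff j - w r k n * (miuraAux r n (k - 1)).coeff j := by
  induction k with
  | zero => intro j; simp [miuraAux, w]
  | succ k ih =>
    have ih := ih (by omega)
    have hxw := x_add_w (r := r) (k := k) (by omega) n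
    have key : ∀ j, x r (k + 1) (n + 1) * (w r k n * (miuraAux r n (k - 1)).coeff j) =
        w r k (n + 1) * (x r k n * (miuraAux r n (k - 1)).coeff j) := by
      intro j
      cases k with
      | zero => simp [w]
      | succ k => rw [← mul_assoc, x_mul_w (by omega), mul_assoc]
    intro j
    rw [Nat.add_sub_cancel]
    have hw : w r (k + 1) n = x r (k + 1) (n + 1) + w r k (n + 1) - x r (k + 1) n := by
      rw [hxw, add_sub_cancel_left]
    cases j with
    | zero =>
      rw [miuraAux_coeff_zero, miuraAux_coeff_zero, ih, mul_sub, key, hw]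
      cases k with
      | zero => simp [w]; noncomm_ring
      | succ k => rw [Nat.add_sub_cancel, miuraAux_coeff_zero]; noncomm_ring
    | succ j =>
      rw [miuraAux_coeff_succ, miuraAux_coeff_succ, ih j, map_sub, map_mul,
        shift_w, ih (j + 1), mul_sub, key, hw]
      cases k with
      | zero => simp [w, miuraAux, SkewPolynomial.coeff_one]
      | succ k => rw [Nat.add_sub_cancel, miuraAux_coeff_succ]; noncomm_ring

/-- Shifting coefficients only moves the base point, so the shift can be eliminated. What remains is
a three term recursion at a single base point, in which D behaves as a central variable. -/
theorem coeff_miuraAux_succ_succ (n : ℤ) {k : ℕ} (hk : k ≤ r + 1) (j : ℕ) :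
    (miuraAux r n (k + 1)).coeff (j + 1) =
      (miuraAux r n k).coeff j - w r k n * (miuraAux r n (k - 1)).coeff j -
        x r (k + 1) n * (miuraAux r n k).coeff (j + 1) := by
  rw [miuraAux_coeff_succ, shift_coeff_miuraAux, coeff_miuraAux_succ n hk]

theorem cons_succ (n : ℤ) (m : ℕ) : cons r (n + 1) m = cons r n m := by
  rw [cons, cons, miura, miura, coeff_miuraAux_succ n le_rfl, w_top, zero_mul, sub_zero]

theorem cons_base (n n' : ℤ) (m : ℕ) : cons r n m = cons r n' m := by
  have h : ∀ n : ℤ, cons r n m = cons r 0 m := by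
    intro n
    induction n using Int.induction_on with
    | zero => rfl
    | succ i ih => rw [cons_succ, ih]
    | pred i ih => rw [← ih, ← cons_succ, sub_add_cancel]
  rw [h n, h n']

end MiuraShift

/-! ### Noncommutative continuants -/

section Continuant

variable {B : Type} [Ring B]

/-- The continuant in the variables `X i, …, X (i + l - 1)` and `W i, …, W (i + l - 2)`. -/
def continuant (X W : ℕ → B) (ζ : B) (i : ℕ) : ℕ → B
  | 0 => 1
  | 1 => 1 - ζ * X i
  | l + 2 => (1 - ζ * X (i + l + 1)) * continuant X W ζ i (l + 1) -
      ζ * W (i + l) * continuant X W ζ i l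

variable {X W : ℕ → B} {ζ : B}

/-- The defining recursion peels off the highest variables on the left, this one the lowest on the
right. The two recursions act on opposite sides, so the induction closes without any commutativity.
-/
theorem continuant_bottom (l : ℕ) : ∀ i,
    continuant X W ζ i (l + 2) = continuant X W ζ (i + 1) (l + 1) * (1 - ζ * X i) -
      continuant X W ζ (i + 2) l * (ζ * W i) := by
  induction l using Nat.strong_induction_on with
  | _ l ih =>
    intro i
    match l with
    | 0 => simp [continuant]
    | 1 =>
      simp only [continuant, add_zero, mul_one, show i + 1 + 1 = i + 2 from rfl]
      noncomm_ring
    | l + 2 =>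
      have e1 := ih (l + 1) (by omega) i
      have e2 := ih l (by omega) i
      have e3 := continuant.eq_3 X W ζ (i + 1) (l + 1)
      have e4 := continuant.eq_3 X W ζ (i + 2) l
      rw [show i + 1 + (l + 1) + 1 = i + (l + 2) + 1 by omega,
        show i + 1 + (l + 1) = i + (l + 2) by omega] at e3
      rw [show i + 2 + l + 1 = i + (l + 2) + 1 by omega,
          show i + 2 + l = i + (l + 2) by omega] at e4
      rw [continuant.eq_3 X W ζ i (l + 2), show l + 2 + 1 = l + 1 + 2 from rfl, e1, e2, e3, e4]
      noncomm_ring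

theorem continuant_commute {a : B} (hζ : Commute a ζ) {i l : ℕ}
    (hX : ∀ j, i ≤ j → j < i + l → Commute a (X j))
    (hW : ∀ j, i ≤ j → j + 1 < i + l → Commute a (W j)) :
    Commute a (continuant X W ζ i l) := by
  induction l using Nat.strong_induction_on with
  | _ l ih =>
    match l with
    | 0 => exact Commute.one_right _
    | 1 => exact (Commute.one_right _).sub_right (hζ.mul_right (hX i le_rfl (by omega)))
    | l + 2 =>
      rw [continuant]
      refine (((Commute.one_right _).sub_right (hζ.mul_right (hX _ (by omega) (by
          omega)))).mul_right
        (ih (l + 1) (by omega) (fun j h h' => hX j h (by omega))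
          fun j h h' => hW j h (by omega))).sub_right
        ((hζ.mul_right (hW _ (by omega) (by omega))).mul_right
          (ih l (by omega) (fun j h h' => hX j h (by omega)) fun j h h' => hW j h (by omega)))

end Continuant

/-! ### The generating polynomial of the conserved quantities -/

section Generating

variable {r : ℕ} {B : Type} [Ring B] [Algebra Rq B] (ι : U r →ₐ[Rq] B) (ζ : B)

/-- The continuant in the coefficients `x_{i+1,n}, …, x_{i+l,n}` and `w_{i+1,n}, …`. -/
def miuraCont (n : ℤ) (i l : ℕ) : B :=
  continuant (fun j => ι (x r (j + 1) n)) (fun j => ι (w r (j + 1) n)) ζ i l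

theorem miuraCont_zero (n : ℤ) (i : ℕ) : miuraCont ι ζ n i 0 = 1 := rfl

theorem miuraCont_one (n : ℤ) (i : ℕ) : miuraCont ι ζ n i 1 = 1 - ζ * ι (x r (i + 1) n) := rfl

theorem miuraCont_top (n : ℤ) (i l : ℕ) :
    miuraCont ι ζ n i (l + 2) = (1 - ζ * ι (x r (i + l + 2) n)) * miuraCont ι ζ n i (l + 1) -
      ζ * ι (w r (i + l + 1) n) * miuraCont ι ζ n i l := rfl

/-- The polynomial `C(ζ) = ∑ (-ζ)^m C_m`. -/
def consPoly (n : ℤ) : B := ∑ m ∈ Finset.range (r + 2), ((-1) ^ m * ι (cons r n m)) * ζ ^ m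

theorem consPoly_base (n n' : ℤ) : consPoly ι ζ n = consPoly ι ζ n' := by
  simp only [consPoly, cons_base n n']

/-- The hypothesis covers the degenerate length l = 0, where the truncated l - 1 would leave a
spurious w term. -/
theorem miuraCont_bottom (n : ℤ) (i l : ℕ) (h : 1 ≤ l ∨ w r (i + 1) n = 0) :
    miuraCont ι ζ n i (l + 1) = miuraCont ι ζ n (i + 1) l * (1 - ζ * ι (x r (i + 1) n)) -
      miuraCont ι ζ n (i + 2) (l - 1) * (ζ * ι (w r (i + 1) n)) := by
  obtain _ | l := l
  · obtain h | h := h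
    · omega
    · rw [h, map_zero, mul_zero, mul_zero, sub_zero, miuraCont_zero, one_mul, miuraCont_one]
  · exact continuant_bottom l i

variable {ζ} (hζ : ∀ b, Commute ζ b)

include hζ

/-- Under D^j ↦ ζ^{k-j} the recursion `coeff_miuraAux_succ_succ` becomes the recursion defining the
continuant. -/
theorem miuraCont_eq_sum (n : ℤ) {k : ℕ} (hk : k ≤ r + 1) :
    miuraCont ι ζ n 0 k =
      ∑ j ∈ Finset.range (k + 1), ι ((miuraAux r n k).coeff j) * ζ ^ (k - j) := by
  induction k using Nat.strong_induction_on with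
  | _ k ih =>
    match k with
    | 0 => simp [miuraCont_zero, miuraAux, SkewPolynomial.coeff_one]
    | 1 =>
      rw [Finset.sum_range_succ, Finset.sum_range_one, (miuraAux_coeff_gt n 1).1,
        miuraAux_coeff_zero, miuraCont_one, (hζ _).eq]
      simp [miuraAux, SkewPolynomial.coeff_one]; abel
    | k + 2 =>
      have e1 : ∑ j ∈ Finset.range (k + 2), ι (w r (k + 1) n * (miuraAux r n k).coeff j) *
          ζ ^ (k + 1 - j) = ζ * ι (w r (k + 1) n) * miuraCont ι ζ n 0 k := by
        rw [ih k (by omega) (by omega), Finset.sum_range_succ,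
          (miuraAux_coeff_gt n k).2 (k + 1) (by omega), mul_zero, map_zero, zero_mul, add_zero,
          Finset.mul_sum]
        refine Finset.sum_congr rfl fun j hj => ?_
        have hj' : j < k + 1 := Finset.mem_range.1 hj
        rw [show k + 1 - j = k - j + 1 by omega, pow_succ, map_mul, mul_assoc ζ, (hζ _).eq]
        simp only [mul_assoc]
      have e2 : ι (x r (k + 2) n * (miuraAux r n (k + 1)).coeff 0) * ζ ^ (k + 2) +
          ∑ j ∈ Finset.range (k + 2), ι (x r (k + 2) n * (miuraAux r n (k + 1)).coeff (j + 1)) *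
          ζ ^ (k + 1 - j) = ζ * ι (x r (k + 2) n) * miuraCont ι ζ n 0 (k + 1) := by
        have h := Finset.sum_range_succ' (fun j => ι (x r (k + 2) n *
          (miuraAux r n (k + 1)).coeff j) * ζ ^ (k + 2 - j)) (k + 2)
        simp only [Nat.sub_zero, Nat.reduceSubDiff] at h
        rw [add_comm, ← h, ih (k + 1) (by omega) (by omega), Finset.sum_range_succ,
          (miuraAux_coeff_gt n (k + 1)).2 (k + 2) (by omega), mul_zero, map_zero, zero_mul,
          add_zero, Finset.mul_sum]
        refine Finset.sum_congr rfl fun j hj => ?_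
        have hj' : j < k + 2 := Finset.mem_range.1 hj
        rw [show k + 2 - j = k + 1 - j + 1 by omega, pow_succ, map_mul, mul_assoc ζ, (hζ _).eq]
        simp only [mul_assoc]
      rw [Finset.sum_range_succ', miuraAux_coeff_zero, miuraCont_top, zero_add]
      simp only [coeff_miuraAux_succ_succ n (show k + 1 ≤ r + 1 by omega), Nat.add_sub_cancel,
        map_sub, map_neg, sub_mul, Finset.sum_sub_distrib, Nat.reduceSubDiff, Nat.sub_zero]
      rw [e1, one_mul, ← e2, ← ih (k + 1) (by omega) (by omega)]
      noncomm_ring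

theorem miuraCont_full (n : ℤ) : miuraCont ι ζ n 0 (r + 1) = consPoly ι ζ n := by
  rw [miuraCont_eq_sum ι hζ n le_rfl, ← Finset.sum_range_reflect, consPoly]
  refine Finset.sum_congr rfl fun m hm => ?_
  have hm' : m < r + 2 := Finset.mem_range.1 hm
  rw [show r + 1 + 1 - 1 - m = r + 1 - m by omega, show r + 1 - (r + 1 - m) = m by omega, cons,
    miura, map_mul, map_pow, map_neg, map_one, ← mul_assoc, ← pow_add, Even.neg_one_pow ⟨m, rfl⟩,
    one_mul]

/-- The counterpart of `coeff_miuraAux_succ` for products ending at the top factor x_{r+1}. The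
induction starts at the top, where w_{r+1} = 0, and descends by bottom expansion. -/
theorem miuraCont_shift (n : ℤ) : ∀ (l i : ℕ), i + 1 + l = r + 1 →
    miuraCont ι ζ n (i + 1) l = miuraCont ι ζ (n + 1) (i + 1) l -
      miuraCont ι ζ (n + 1) (i + 2) (l - 1) * (ζ * ι (w r (i + 1) (n + 1))) := by
  intro l
  induction l using Nat.strong_induction_on with
  | _ l ih =>
    intro i hi
    match l with
    | 0 =>
      obtain rfl : i = r := by omega
      rw [w_top, map_zero, mul_zero, mul_zero, sub_zero]; rfl
    | 1 =>
      have h := x_add_w (r := r) (k := i + 1) (by omega) n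
      obtain rfl : r = i + 1 := by omega
      rw [w_top, add_zero] at h
      rw [miuraCont_one, miuraCont_one, ← h, map_add, miuraCont_zero]
      noncomm_ring
    | l + 2 =>
      have h := congrArg ι (x_add_w (r := r) (k := i + 1) (by omega) n)
      have h' := congrArg ι (x_mul_w (r := r) (k := i + 1) (by omega) n)
      rw [map_add, map_add] at h
      rw [map_mul, map_mul] at h'
      have hw : l = 0 → w r (i + 1 + 2) (n + 1) = 0 := fun hl => by
        rw [show i + 1 + 2 = r + 1 by omega, w_top]
      rw [miuraCont_bottom ι ζ n (i + 1) (l + 1) (by omega),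
          ih (l + 1) (by omega) (i + 1) (by omega),
        show l + 1 - 1 = l by omega, show i + 1 + 2 = i + 2 + 1 by omega,
        ih l (by omega) (i + 2) (by omega),
        miuraCont_bottom ι ζ (n + 1) (i + 1) (l + 1) (by omega), show l + 2 - 1 = l + 1 by omega,
        show l + 1 - 1 = l by omega, show i + 1 + 2 = i + 2 + 1 by omega]
      have hb := miuraCont_bottom ι ζ (n + 1) (i + 2) l (by
        rcases Nat.eq_zero_or_pos l with hl | hl
        · exact .inr (hw hl)
        · exact .inl hl)
      simp only [show i + 1 + 1 = i + 2 from rfl, show i + 2 + 1 = i + 3 from rfl,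
        show i + 2 + 2 = i + 4 from rfl] at *
      generalize miuraCont ι ζ (n + 1) (i + 2) (l + 1) = K1 at *
      generalize miuraCont ι ζ (n + 1) (i + 3) l = K2 at *
      generalize miuraCont ι ζ (n + 1) (i + 4) (l - 1) = K3 at *
      generalize ι (x r (i + 2) n) = X at *
      generalize ι (x r (i + 2) (n + 1)) = X1 at *
      generalize ι (x r (i + 3) (n + 1)) = X2 at *
      generalize ι (w r (i + 2) n) = W at *
      generalize ι (w r (i + 2) (n + 1)) = W1 at *
      generalize ι (w r (i + 3) (n + 1)) = W2 at *
      generalize ι (w r (i + 1) (n + 1)) = W0 at *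
      have hX : X = X1 + W0 - W := by rw [h]; abel
      calc _ = K1 * (1 - ζ * X) - K2 * (ζ * W1) + K2 * ((ζ * W1) * (ζ * X)) -
            (K2 - K3 * (ζ * W2)) * (ζ * W) := by noncomm_ring
        _ = K1 * (1 - ζ * X) - K2 * (ζ * W1) + K2 * ((ζ * X2) * (ζ * W)) -
            (K2 - K3 * (ζ * W2)) * (ζ * W) := by
          -- This is `x_mul_w`; it lets the terms regroup into the bottom expansion `hb` of K1.
          have : (ζ * W1) * (ζ * X) = (ζ * X2) * (ζ * W) := by
            rw [mul_assoc, ← mul_assoc W1, ← (hζ W1).eq, mul_assoc ζ W1, ← h', mul_assoc ζ X2,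
              ← mul_assoc X2 ζ, ← (hζ X2).eq, mul_assoc ζ X2]
          rw [this]
        _ = K1 * (1 - ζ * X) - K2 * (ζ * W1) - (K2 * (1 - ζ * X2) - K3 * (ζ * W2)) * (ζ * W) := by
          noncomm_ring
        _ = _ := by rw [← hb, hX]; noncomm_ring

end Generating

/-! ### Exchange relations of C(ζ) with M_{1,n} and its reflection -/

section Currents

variable {r : ℕ} {B : Type} [Ring B] [Algebra Rq B] (ι : U r →ₐ[Rq] B) {ζ : B}

theorem miuraCont_commute (hζ : ∀ b, Commute ζ b) {a : U r} {n : ℤ} {i l : ℕ}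
    (hX : ∀ j, i ≤ j → j < i + l → Commute a (x r (j + 1) n))
    (hW : ∀ j, i ≤ j → j + 1 < i + l → Commute a (w r (j + 1) n)) :
    Commute (ι a) (miuraCont ι ζ n i l) :=
  continuant_commute (hζ _).symm (fun j h h' => (hX j h h').map ι) fun j h h' => (hW j h h').map ι

theorem commute_A_consPoly (hζ : ∀ b, Commute ζ b) (n : ℤ) :
    Commute (ι (Ap r 1)) (consPoly ι ζ n) := by
  rw [← miuraCont_full ι hζ]
  exact miuraCont_commute ι hζ (fun j _ h => commute_A_x (by omega) n)
    fun j _ h => commute_A_w (by omega) n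

variable (ζ) in
/-- The polynomial `g_n(ζ)` with `C(ζ) M_{1,n} = g_n(ζ) - ζ g_{n+1}(ζ)`. -/
def currentPoly (n : ℤ) : B := miuraCont ι ζ (n - 1) 1 r * ι (M r 1 n)

theorem currentPoly_succ (n : ℤ) :
    currentPoly ι ζ (n + 1) = miuraCont ι ζ n 1 r * ι (M r 1 (n + 1)) := by
  rw [currentPoly, add_sub_cancel_right]

theorem currentPoly_eq (hζ : ∀ b, Commute ζ b) (n : ℤ) :
    currentPoly ι ζ n = (miuraCont ι ζ n 1 r -
      miuraCont ι ζ n 2 (r - 1) * (ζ * ι (w r 1 n))) * ι (M r 1 n) := by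
  have h := miuraCont_shift ι hζ (n - 1) r 0 (by omega)
  rw [sub_add_cancel] at h
  rw [currentPoly, h]

theorem consPoly_eq (hr : 1 ≤ r) (hζ : ∀ b, Commute ζ b) (n₀ n : ℤ) :
    consPoly ι ζ n₀ = miuraCont ι ζ n 1 r * (1 - ζ * ι (x r 1 n)) -
      miuraCont ι ζ n 2 (r - 1) * (ζ * ι (w r 1 n)) := by
  rw [consPoly_base ι ζ n₀ n, ← miuraCont_full ι hζ, miuraCont_bottom ι ζ n 0 r (.inl hr)]

theorem x_one_mul_M (n : ℤ) : x r 1 n * M r 1 n = M r 1 (n + 1) := by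
  rw [x_succ, ratioInv_zero, mul_one, ratio, mul_assoc, Mi_M _ (by omega), mul_one]

/-- In the bottom expansion the term with x_1 yields ζ g_{n+1}, because x_1 M_n = M_{n+1}; the other
terms are g_n rewritten at base point n by `miuraCont_shift`. -/
theorem consPoly_mul_M (hr : 1 ≤ r) (hζ : ∀ b, Commute ζ b) (n₀ n : ℤ) :
    consPoly ι ζ n₀ * ι (M r 1 n) = currentPoly ι ζ n - ζ * currentPoly ι ζ (n + 1) := by
  rw [consPoly_eq ι hr hζ n₀ n, currentPoly_eq ι hζ, currentPoly_succ, ← x_one_mul_M, map_mul,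
    ← mul_assoc ζ, (hζ (miuraCont ι ζ n 1 r)).eq]
  noncomm_ring

/-- Every entry of the continuant at base point n commutes with M_n except x_1, which contributes
the single factor q. -/
theorem M_mul_consPoly (hr : 1 ≤ r) (hζ : ∀ b, Commute ζ b) (n₀ n : ℤ) :
    ι (M r 1 n) * consPoly ι ζ n₀ =
      currentPoly ι ζ n - qp 1 • (ζ * currentPoly ι ζ (n + 1)) := by
  have h1 : Commute (ι (M r 1 n)) (miuraCont ι ζ n 1 r) :=
    miuraCont_commute ι hζ
      (fun j h h' => (qcomm_M_x 1 (by omega) n).commute (if_neg (by omega)))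
      fun j h h' => (qcomm_M_w 1 (by omega) n).commute (if_neg (by omega))
  have h2 : Commute (ι (M r 1 n)) (miuraCont ι ζ n 2 (r - 1)) :=
    miuraCont_commute ι hζ
      (fun j h h' => (qcomm_M_x 1 (by omega) n).commute (if_neg (by omega)))
      fun j h h' => (qcomm_M_w 1 (by omega) n).commute (if_neg (by omega))
  have h3 : Commute (ι (M r 1 n)) (ζ * ι (w r 1 n)) :=
    (hζ _).symm.mul_right (((qcomm_M_w 1 (by omega) n).commute (if_neg (by omega))).map ι)
  have h4 : QComm 1 (ι (M r 1 n)) (ι (x r 1 n)) :=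
    ((qcomm_M_x 1 (j := 0) (by omega) n).congr (if_pos (by omega))).map ι
  rw [consPoly_eq ι hr hζ n₀ n, currentPoly_eq ι hζ, currentPoly_succ, ← x_one_mul_M, map_mul]
  calc _ = miuraCont ι ζ n 1 r * (ι (M r 1 n) - ζ * (ι (M r 1 n) * ι (x r 1 n))) -
        miuraCont ι ζ n 2 (r - 1) * (ζ * ι (w r 1 n)) * ι (M r 1 n) := by
        rw [mul_sub, (h2.mul_right h3).eq, ← mul_assoc, h1.eq, mul_assoc _ (ι (M r 1 n)), mul_sub,
          mul_one, ← mul_assoc (ι (M r 1 n)) ζ, ← (hζ _).eq, mul_assoc ζ]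
    _ = _ := by
        rw [h4.eq, mul_smul_comm, ← mul_assoc ζ (miuraCont ι ζ n 1 r),
            (hζ (miuraCont ι ζ n 1 r)).eq,
          mul_sub, mul_smul_comm, sub_mul, mul_assoc (miuraCont ι ζ n 1 r) ζ]
        abel

/-- Both sides equal g_n - (1 + q) ζ g_{n+1} + q ζ² g_{n+2}. -/
theorem consPoly_star (hr : 1 ≤ r) (hζ : ∀ b, Commute ζ b) (n₀ n : ℤ) :
    consPoly ι ζ n₀ * (ι (M r 1 n) - qp 1 • (ζ * ι (M r 1 (n + 1)))) =
      (ι (M r 1 n) - ζ * ι (M r 1 (n + 1))) * consPoly ι ζ n₀ := by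
  rw [mul_sub, sub_mul, mul_smul_comm, ← mul_assoc _ ζ, ← (hζ _).eq, mul_assoc ζ, mul_assoc ζ,
    consPoly_mul_M ι hr hζ, consPoly_mul_M ι hr hζ, M_mul_consPoly ι hr hζ,
    M_mul_consPoly ι hr hζ, mul_sub, mul_sub, smul_sub, mul_smul_comm]
  abel

/-- Here C is expanded at the top end. F_{n+1} sees only x_{r+1}, F_n sees x_{r+1} and w_r, each
with exponent -1, and x_{r+1} F_{n+1} = F_n makes the cross terms cancel. -/
theorem consPoly_dual_star (hr : 1 ≤ r) (hζ : ∀ b, Commute ζ b) (n₀ n : ℤ) :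
    (ι (dualM r (n + 1)) - ζ * ι (dualM r n)) * consPoly ι ζ n₀ =
      consPoly ι ζ n₀ * (ι (dualM r (n + 1)) - qp (-1) • (ζ * ι (dualM r n))) := by
  obtain ⟨s, rfl⟩ : ∃ s, r = s + 1 := ⟨r - 1, by omega⟩
  have hc : consPoly ι ζ n₀ = (1 - ζ * ι (x (s + 1) (s + 2) n)) * miuraCont ι ζ n 0 (s + 1) -
      ζ * ι (w (s + 1) (s + 1) n) * miuraCont ι ζ n 0 s := by
    rw [consPoly_base ι ζ n₀ n, ← miuraCont_full ι hζ, miuraCont_top, zero_add]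
  have comm1 : ∀ l ≤ s + 1, Commute (ι (dualM (s + 1) (n + 1))) (miuraCont ι ζ n 0 l) :=
    fun l hl => miuraCont_commute ι hζ
      (fun j h h' => (qcomm_dual_succ_x (by omega) n).commute (if_neg (by omega)))
      fun j h h' => commute_dual_succ_w (by omega) n
  have comm0 : ∀ l ≤ s + 1, Commute (ι (dualM (s + 1) n)) (miuraCont ι ζ n 0 l) :=
    fun l hl => miuraCont_commute ι hζ
      (fun j h h' => (qcomm_dual_x (by omega) n).commute (if_neg (by omega)))
      fun j h h' => (qcomm_dual_w (by omega) n).commute (if_neg (by omega))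
  have x1 : QComm (-1) (ι (dualM (s + 1) (n + 1))) (ι (x (s + 1) (s + 2) n)) :=
    ((qcomm_dual_succ_x le_rfl n).congr (if_pos rfl)).map ι
  have x0 : QComm (-1) (ι (dualM (s + 1) n)) (ι (x (s + 1) (s + 2) n)) :=
    ((qcomm_dual_x le_rfl n).congr (if_pos rfl)).map ι
  have w1 : Commute (ι (dualM (s + 1) (n + 1))) (ι (w (s + 1) (s + 1) n)) :=
    (commute_dual_succ_w (by omega) n).map ι
  have w0 : QComm (-1) (ι (dualM (s + 1) n)) (ι (w (s + 1) (s + 1) n)) :=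
    ((qcomm_dual_w (by omega) n).congr (if_pos rfl)).map ι
  have p1 := comm1 (s + 1) le_rfl
  have p0 := comm0 (s + 1) le_rfl
  have o1 := comm1 s (by omega)
  have o0 := comm0 s (by omega)
  have hx : ι (x (s + 1) (s + 2) n) * ι (dualM (s + 1) (n + 1)) = ι (dualM (s + 1) n) := by
    rw [← map_mul, x_top_mul_dual]
  rw [hc]
  generalize ι (dualM (s + 1) (n + 1)) = F1 at *
  generalize ι (dualM (s + 1) n) = F0 at *
  generalize ι (x (s + 1) (s + 2) n) = X at *
  generalize ι (w (s + 1) (s + 1) n) = W at *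
  generalize miuraCont ι ζ n 0 (s + 1) = P at *
  generalize miuraCont ι ζ n 0 s = O at *
  have e1 : F1 * ((1 - ζ * X) * P - ζ * W * O) =
      ((1 - qp (-1) • (ζ * X)) * P - ζ * W * O) * F1 := by
    have : F1 * (ζ * X) = qp (-1) • (ζ * X) * F1 := by
      rw [← mul_assoc, ← (hζ _).eq, mul_assoc, x1.eq, mul_smul_comm, ← mul_assoc, smul_mul_assoc]
    have hw : Commute F1 (ζ * W) := (hζ _).symm.mul_right w1
    rw [mul_sub, ← mul_assoc, mul_sub, mul_one, this, (hw.mul_right o1).eq, sub_mul _ _ F1,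
      mul_assoc _ P, ← p1.eq]
    noncomm_ring
  have e0 : F0 * ((1 - ζ * X) * P - ζ * W * O) =
      ((1 - qp (-1) • (ζ * X)) * P - qp (-1) • (ζ * W) * O) * F0 := by
    have h1 : F0 * (ζ * X) = qp (-1) • (ζ * X) * F0 := by
      rw [← mul_assoc, ← (hζ _).eq, mul_assoc, x0.eq, mul_smul_comm, ← mul_assoc, smul_mul_assoc]
    have h2 : F0 * (ζ * W) = qp (-1) • (ζ * W) * F0 := by
      rw [← mul_assoc, ← (hζ _).eq, mul_assoc, w0.eq, mul_smul_comm, ← mul_assoc, smul_mul_assoc]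
    rw [mul_sub, ← mul_assoc, mul_sub, mul_one, h1, ← mul_assoc, h2, mul_assoc _ F0, o0.eq,
      sub_mul _ _ F0, mul_assoc _ P, ← p0.eq]
    noncomm_ring
  have hXP : ζ * X * P * F1 = ζ * (P * F0) := by
    rw [mul_assoc _ P, ← p1.eq, mul_assoc, ← mul_assoc X, hx, p0.eq]
  rw [sub_mul, mul_assoc ζ F0, e1, e0, mul_sub, mul_smul_comm, ← mul_assoc _ ζ, ← (hζ _).eq,
    mul_assoc ζ]
  simp only [sub_mul, mul_sub, one_mul, smul_mul_assoc, smul_sub, mul_smul_comm, hXP]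
  simp only [mul_assoc]
  abel

/-- A q-analogue of Euler's identity for continuants. Expand the longer continuants at the bottom:
moving N across turns the parameter q⁻¹ζ of the bottom factors into ζ, and the x_{i+1} terms cancel.
What remains is ζ times the same expression one level higher, with w_{i+1} in place of N, multiplied
by N. Keeping N general is what allows the induction. -/
theorem miuraCont_exchange (hζ : ∀ b, Commute ζ b) (n : ℤ) : ∀ (l i : ℕ) (N : U r), i + l = r →
    (∀ j, i < j → j ≤ r → Commute N (x r (j + 1) n)) →
    (∀ j, i < j → j ≤ r → Commute N (w r (j + 1) n)) →
    QComm 1 N (x r (i + 1) n) → QComm 1 N (w r (i + 1) n) → Commute N (dualM r (n + 1)) →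
    miuraCont ι ζ n (i + 1) l * ι N * ι (dualM r (n + 1)) *
        miuraCont ι (qp (-1) • ζ) n i (l + 1) -
      miuraCont ι ζ n i (l + 1) * ι (dualM r (n + 1)) *
        miuraCont ι (qp (-1) • ζ) n (i + 1) l * ι N =
      (1 - qp (-1)) • (ζ ^ (l + 1) * ι (xwProd n i l * (N * dualM r (n + 1)))) := by
  have hζ' : ∀ b, Commute (qp (-1) • ζ) b := fun b => (hζ b).smul_left _
  intro l
  induction l with
  | zero =>
    intro i N hi hX hW hNx hNw hNF
    obtain rfl : i = r := by omega
    have h : QComm 0 (ι (N * dualM i (n + 1))) (ι (x i (i + 1) n)) :=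
      ((hNx.mul_left ((qcomm_dual_succ_x le_rfl n).congr (if_pos rfl))).congr (by ring)).map ι
    have h := h.commute rfl
    rw [miuraCont_zero, miuraCont_zero, miuraCont_one, miuraCont_one, xwProd, zero_add, pow_one,
      one_mul, mul_one, mul_assoc _ _ (ι N), ← map_mul, ← map_mul, ← hNF.eq, map_mul _ (x _ _ _),
      ← h.eq,
      mul_sub, sub_mul, mul_one, one_mul, smul_mul_assoc, mul_smul_comm, ← mul_assoc _ ζ,
      ← (hζ _).eq,
      mul_assoc ζ, mul_assoc ζ, ← h.eq, sub_smul, one_smul]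
    abel
  | succ l ih =>
    intro i N hi hX hW hNx hNw hNF
    have hwF : Commute (w r (i + 1) n) (dualM r (n + 1)) := (commute_dual_succ_w (by omega) n).symm
    -- The induction hypothesis is used with w_{i+1} in the role of N: it commutes with the x_j and
    -- w_j for j ≥ i+3 and has exponent 1 against those with j = i+2.
    have IH := ih (i + 1) (w r (i + 1) n) (by omega)
      (fun j h h' => (qcomm_w_x (by omega) h' n).commute (if_neg (by omega)))
      (fun j h h' => (qcomm_w_w (by omega) h' n).commute (if_neg (by omega)))
      ((qcomm_w_x (by omega) (by omega) n).congr (if_pos rfl))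
      (by
        rcases Nat.eq_or_lt_of_le (show i + 1 ≤ r by omega) with h | h
        · rw [h, w_top]; simp [QComm]
        · exact (qcomm_w_w (by omega) (by omega) n).congr (if_pos rfl)) hwF
    have hxF : Commute (ι (x r (i + 1) n)) (ι (dualM r (n + 1))) :=
      ((qcomm_dual_succ_x (by omega) n).commute (if_neg (by omega))).symm.map ι
    have hxK : ∀ ζ₁ : B, (∀ b, Commute ζ₁ b) →
        Commute (ι (x r (i + 1) n)) (miuraCont ι ζ₁ n (i + 1) (l + 1)) := fun ζ₁ h₁ =>
      miuraCont_commute ι h₁ (fun j h h' => commute_x_x (by omega) (by omega) n)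
        fun j h h' => commute_x_w (by omega) (by omega) n
    have hNK : ∀ l, l ≤ r - i → Commute (ι N) (miuraCont ι (qp (-1) • ζ) n (i + 1) l) := fun l hl =>
      miuraCont_commute ι hζ' (fun j h h' => hX j (by omega) (by omega))
        fun j h h' => hW j (by omega) (by omega)
    have hNK' : Commute (ι N) (miuraCont ι (qp (-1) • ζ) n (i + 2) l) :=
      miuraCont_commute ι hζ' (fun j h h' => hX j (by omega) (by omega))
        fun j h h' => hW j (by omega) (by omega)
    have hNK := hNK (l + 1) (by omega)
    have hxK1 := hxK ζ hζ
    have hxK2 := hxK _ hζ'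
    rw [miuraCont_bottom ι ζ n i (l + 1) (by omega),
      miuraCont_bottom ι (qp (-1) • ζ) n i (l + 1) (by omega), xwProd, Nat.add_sub_cancel]
    have hNx := hNx.map ι
    have hNw := hNw.map ι
    have hNF := hNF.map ι
    have hwF' := hwF.map ι
    have eR : ζ ^ (l + 1 + 1) * ι (xwProd n (i + 1) l * w r (i + 1) n * (N * dualM r (n + 1))) =
        ζ * (ζ ^ (l + 1) * ι (xwProd n (i + 1) l * (w r (i + 1) n * dualM r (n + 1)))) * ι N := by
      simp only [map_mul, hNF.eq, pow_succ' ζ (l + 1), mul_assoc]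
    have eN : ∀ y : B, QComm 1 (ι N) y → ι N * (qp (-1) • ζ * y) = ζ * y * ι N := by
      intro y hy
      rw [smul_mul_assoc, mul_smul_comm, ← mul_assoc, ← (hζ _).eq, mul_assoc, hy.eq, mul_smul_comm,
        qp_smul_smul, neg_add_cancel, qp_zero_smul, mul_assoc]
    have ex := eN _ hNx
    have ew := eN _ hNw
    have hxFL : Commute (ζ * ι (x r (i + 1) n))
        (ι (dualM r (n + 1)) * miuraCont ι (qp (-1) • ζ) n (i + 1) (l + 1)) :=
      (hζ _).mul_left (hxF.mul_right hxK2)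
    rw [eR]
    have IH' : miuraCont ι ζ n (i + 2) l * ι (w r (i + 1) n) * ι (dualM r (n + 1)) *
        miuraCont ι (qp (-1) • ζ) n (i + 1) (l + 1) -
      miuraCont ι ζ n (i + 1) (l + 1) * ι (dualM r (n + 1)) *
        miuraCont ι (qp (-1) • ζ) n (i + 2) l * ι (w r (i + 1) n) =
      (1 - qp (-1)) • (ζ ^ (l + 1) * ι (xwProd n (i + 1) l *
        (w r (i + 1) n * dualM r (n + 1)))) := IH
    rw [← smul_mul_assoc, ← mul_smul_comm, ← IH']
    clear IH IH' eR hxK hxK1 hNw hNx eN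
    generalize miuraCont ι ζ n (i + 1) (l + 1) = K1 at *
    generalize miuraCont ι ζ n (i + 2) l = K2 at *
    generalize miuraCont ι (qp (-1) • ζ) n (i + 1) (l + 1) = L1 at *
    generalize miuraCont ι (qp (-1) • ζ) n (i + 2) l = L2 at *
    generalize ι (x r (i + 1) n) = X at *
    generalize ι (w r (i + 1) n) = W at *
    generalize ι (dualM r (n + 1)) = F at *
    generalize ι N = N at *
    have hN : N * (L1 * (1 - qp (-1) • ζ * X) - L2 * (qp (-1) • ζ * W)) =
        (L1 * (1 - ζ * X) - L2 * (ζ * W)) * N := by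
      rw [mul_sub, ← mul_assoc, ← mul_assoc, hNK.eq, hNK'.eq, mul_assoc L1, mul_assoc L2, ew,
        mul_sub N, ex]
      noncomm_ring
    have hz1 : L2 * (ζ * W) = ζ * (L2 * W) := by rw [← mul_assoc, ← (hζ _).eq, mul_assoc]
    have hz2 : K2 * (ζ * W) = ζ * (K2 * W) := by rw [← mul_assoc, ← (hζ _).eq, mul_assoc]
    have hz3 : K1 * F * ζ = ζ * (K1 * F) := (hζ _).eq.symm
    calc _ = K1 * F * (N * (L1 * (1 - qp (-1) • ζ * X) - L2 * (qp (-1) • ζ * W))) -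
          (K1 * (1 - ζ * X) - K2 * (ζ * W)) * F * L1 * N := by
          rw [mul_assoc K1 N F, hNF.eq]; simp only [mul_assoc]
      _ = -(K1 * (F * L1 * (ζ * X)) - K1 * (ζ * X * (F * L1))) * N +
          (K2 * (ζ * W) * F * L1 - K1 * F * (L2 * (ζ * W))) * N := by
          rw [hN]; noncomm_ring
      _ = _ := by
          rw [hxFL.eq, sub_self, neg_zero, zero_mul, zero_add, hz1, hz2, ← mul_assoc (K1 * F), hz3]
          noncomm_ring

/-- The case i = 0, N = M_{1,n} of `miuraCont_exchange`, taken at base point n-1, where the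
continuants of full length are C. -/
theorem currentPoly_exchange (hζ : ∀ b, Commute ζ b) (n₀ n : ℤ) :
    currentPoly ι ζ n * ι (dualM r n) * consPoly ι (qp (-1) • ζ) n₀ -
      consPoly ι ζ n₀ * ι (dualM r n) * currentPoly ι (qp (-1) • ζ) n =
      ((1 - qp 1) * ((-1) ^ (r + 1) * qp (-(r + 1) - n))) • (ζ ^ (r + 1) * ι (Ap r 1)) := by
  obtain ⟨n, rfl⟩ : ∃ n', n = n' + 1 := ⟨n - 1, by ring⟩
  have h := miuraCont_exchange ι hζ n r 0 (M r 1 (n + 1)) (by omega)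
    (fun j h h' => (qcomm_succ_x 1 h' n).commute (if_neg (by omega)))
    (fun j h h' => (qcomm_succ_w 1 h' n).commute (if_neg (by omega)))
    ((qcomm_succ_x 1 (by omega) n).congr (if_pos (by omega)))
    ((qcomm_succ_w 1 (by omega) n).congr (if_pos (by omega))) (commute_dual_M 1 _).symm
  rw [miuraCont_full ι hζ, miuraCont_full ι fun b => (hζ b).smul_left _, xwProd_mul_dual,
    map_smul, mul_smul_comm, smul_smul] at h
  rw [consPoly_base ι ζ n₀ n, consPoly_base ι _ n₀ n, currentPoly_succ, currentPoly_succ,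
    ← mul_assoc _ _ (ι (M r 1 (n + 1))), h]
  congr 1
  rw [show -((r : ℤ) + 1) - (n + 1) = -1 + (-r - (n + 1)) by ring, qp_add, pow_succ]
  have : qp 1 * qp (-1) = 1 := by rw [← qp_add, add_neg_cancel, qp_zero]
  linear_combination (-(-1) ^ r * qp (-r - (n + 1))) * this

end Currents

/-! ### Relations in an algebra where the generating polynomial is invertible -/

section Relations

variable {r : ℕ} {B : Type} [Ring B] [Algebra Rq B] (ι : U r →ₐ[Rq] B)

theorem qp_smul_qh (k s : ℤ) (b : B) : qp k • qh s • b = qh (2 * k + s) • b := by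
  rw [smul_smul, qp, ← qh_add]

theorem qh_smul_smul (k s : ℤ) (b : B) : qh k • qh s • b = qh (k + s) • b := by
  rw [smul_smul, ← qh_add]

theorem qh_zero_smul (b : B) : qh 0 • b = b := by rw [qh_zero, one_smul]

omit [Algebra Rq B] in
theorem IsUnit.cancel_left_right {a b x y : B} (ha : IsUnit a) (hb : IsUnit b)
    (h : a * x * b = a * y * b) : x = y :=
  ha.mul_left_cancel (hb.mul_right_cancel h)

/-- Because g_{n+1} is a continuant commuting with M_n and M_{n+1}, times M_{n+1}, it commutes with
M_{n+1} and M_n g_{n+1} = q g_{n+1} M_n. After multiplication by C on the left the relation is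
`consPoly_star` times G. -/
theorem current_quadratic (hr : 1 ≤ r) {ζ : B} (hζ : ∀ b, Commute ζ b) (n₀ n : ℤ)
    (hc : IsUnit (consPoly ι ζ n₀)) {G : B} (hG : consPoly ι ζ n₀ * G = currentPoly ι ζ (n + 1)) :
    ι (M r 1 n) * G - qp 1 • (G * ι (M r 1 n)) +
      ζ * (G * ι (M r 1 (n + 1)) - qp 1 • (ι (M r 1 (n + 1)) * G)) = 0 := by
  have h0 : Commute (ι (M r 1 n)) (miuraCont ι ζ n 1 r) :=
    miuraCont_commute ι hζ
      (fun j h h' => (qcomm_M_x 1 (by omega) n).commute (if_neg (by omega)))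
      fun j h h' => (qcomm_M_w 1 (by omega) n).commute (if_neg (by omega))
  have h1 : Commute (ι (M r 1 (n + 1))) (miuraCont ι ζ n 1 r) :=
    miuraCont_commute ι hζ
      (fun j h h' => (qcomm_succ_x 1 (by omega) n).commute (if_neg (by omega)))
      fun j h h' => (qcomm_succ_w 1 (by omega) n).commute (if_neg (by omega))
  have hq : QComm 1 (ι (M r 1 n)) (ι (M r 1 (n + 1))) := (qcomm_M_succ 1 1 n).map ι
  have g0 : qp 1 • (currentPoly ι ζ (n + 1) * ι (M r 1 n)) =
      ι (M r 1 n) * currentPoly ι ζ (n + 1) := by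
    rw [currentPoly_succ]
    exact (((QComm.of_commute h0).mul_right hq).eq.trans (by rw [zero_add])).symm
  have g1 : currentPoly ι ζ (n + 1) * ι (M r 1 (n + 1)) =
      ι (M r 1 (n + 1)) * currentPoly ι ζ (n + 1) := by
    rw [currentPoly_succ]; exact (h1.mul_right (Commute.refl _)).eq.symm
  have hs := consPoly_star ι hr hζ n₀ n
  refine hc.mul_left_cancel ?_
  rw [mul_zero, mul_add, mul_sub, ← mul_assoc, mul_smul_comm, ← mul_assoc, hG, g0, ← mul_assoc _ ζ,
    ← (hζ _).eq, mul_assoc ζ, mul_sub, ← mul_assoc, hG, g1, mul_smul_comm, ← hG]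
  have h2 := congrArg (fun y => y * G) hs
  simp only [mul_sub, sub_mul, mul_smul_comm, smul_mul_assoc] at h2
  rw [← mul_assoc (consPoly ι ζ n₀) ζ, ← (hζ (consPoly ι ζ n₀)).eq] at h2
  simp only [mul_sub, mul_smul_comm, mul_assoc] at h2 ⊢
  rw [← sub_eq_zero] at h2
  rw [← h2]
  abel

variable {z : B} {ψ : B} {s : Rq} {n₀ : ℤ}

/-- Here the exchange rules chain: `consPoly_star` at q^{-1/2} z produces exactly the combination
M_n - q^{1/2} z M_{n+1} needed by `consPoly_star` at q^{1/2} z, and passing A in between gives q⁻¹.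
-/
theorem cartan_mul_current (hr : 1 ≤ r) (hz : ∀ b, Commute z b)
    (h1 : IsUnit (consPoly ι (qh 1 • z) n₀)) (h2 : IsUnit (consPoly ι (qh (-1) • z) n₀))
    (hψ : consPoly ι (qh 1 • z) n₀ * ψ * consPoly ι (qh (-1) • z) n₀ =
      s • (z ^ (r + 1) * ι (Ap r 1))) (n : ℤ) :
    ψ * (ι (M r 1 n) - qh (-1) • (z * ι (M r 1 (n + 1)))) =
      qp (-1) • ((ι (M r 1 n) - qh 3 • (z * ι (M r 1 (n + 1)))) * ψ) := by
  have s1 := consPoly_star ι hr (ζ := qh 1 • z) (fun b => (hz b).smul_left _) n₀ n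
  have s2 := consPoly_star ι hr (ζ := qh (-1) • z) (fun b => (hz b).smul_left _) n₀ n
  simp only [smul_mul_assoc, qp_smul_qh] at s1 s2
  norm_num at s1 s2
  have hA : ∀ j, QComm (-1) (ι (Ap r 1)) (ι (M r 1 j)) := fun j => (qcomm_A_M 1 j).map ι
  have hA' : QComm (-1) (z ^ (r + 1) * ι (Ap r 1))
      (ι (M r 1 n) - qh 1 • (z * ι (M r 1 (n + 1)))) := by
    have e1 : QComm (-1) (ι (Ap r 1)) (ι (M r 1 n) - qh 1 • (z * ι (M r 1 (n + 1)))) := by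
      rw [QComm, mul_sub, sub_mul, (hA n).eq, mul_smul_comm, ← mul_assoc, ← (hz _).eq, mul_assoc,
        (hA (n + 1)).eq, mul_smul_comm, smul_sub, smul_mul_assoc, mul_assoc, smul_comm (qh 1)]
    have e2 := (QComm.of_commute ((hz _).pow_left (r + 1))).mul_left e1
    exact e2.congr (zero_add _)
  refine IsUnit.cancel_left_right h1 h2 ?_
  calc _ = consPoly ι (qh 1 • z) n₀ * ψ * ((ι (M r 1 n) - qh (-1) • (z * ι (M r 1 (n + 1)))) *
        consPoly ι (qh (-1) • z) n₀) := by simp only [mul_assoc]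
    _ = s • (z ^ (r + 1) * ι (Ap r 1) * (ι (M r 1 n) - qh 1 • (z * ι (M r 1 (n + 1))))) := by
        rw [← s2, ← mul_assoc, hψ, smul_mul_assoc]
    _ = qp (-1) • (ι (M r 1 n) - qh 1 • (z * ι (M r 1 (n + 1)))) *
        (consPoly ι (qh 1 • z) n₀ * ψ * consPoly ι (qh (-1) • z) n₀) := by
        rw [hA'.eq, hψ, mul_smul_comm, smul_mul_assoc]
    _ = _ := by
        rw [smul_mul_assoc, mul_smul_comm, smul_mul_assoc, ← mul_assoc, ← mul_assoc, ← s1]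
        simp only [mul_assoc]

/-- For F the two exchange rules do not chain in the order in which the factors of ψ stand, and
commutativity of C(q^{1/2} z) with C(q^{-1/2} z) is not used. Applying one more difference operator
in n repairs the mismatch, so one obtains only a recursion for the defect T. Its vanishing comes
later from a bound on exponents. -/
theorem cartan_mul_dual (hr : 1 ≤ r) (hz : ∀ b, Commute z b)
    (h1 : IsUnit (consPoly ι (qh 1 • z) n₀)) (h2 : IsUnit (consPoly ι (qh (-1) • z) n₀))
    (hψ : consPoly ι (qh 1 • z) n₀ * ψ * consPoly ι (qh (-1) • z) n₀ =
      s • (z ^ (r + 1) * ι (Ap r 1))) {T : ℤ → B}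
    (hT : ∀ n, T n = qp (-1) • (ψ * (ι (dualM r (n + 1)) - qh 1 • (z * ι (dualM r n)))) -
      (ι (dualM r (n + 1)) - qh (-3) • (z * ι (dualM r n))) * ψ) (n : ℤ) :
    T (n + 1) = qh (-1) • (z * T n) := by
  have s1 := consPoly_dual_star ι hr (ζ := qh 1 • z) (fun b => (hz b).smul_left _) n₀
  have s2 := consPoly_dual_star ι hr (ζ := qh (-1) • z) (fun b => (hz b).smul_left _) n₀
  simp only [smul_mul_assoc, qp_smul_qh] at s1 s2
  norm_num at s1 s2
  set c1 := consPoly ι (qh 1 • z) n₀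
  set c2 := consPoly ι (qh (-1) • z) n₀
  -- E is the second difference (1 - q^{1/2} z S)(1 - q^{-3/2} z S) applied to F_{n+2}, where S
  -- lowers the index by one. Both halves of T(n+1) - q^{-1/2} z T(n) reduce to E, on the right and
  -- on the left of c1 ψ c2.
  set E : B := ι (dualM r (n + 1 + 1)) - qh (-3) • (z * ι (dualM r (n + 1))) -
    qh 1 • (z * (ι (dualM r (n + 1)) - qh (-3) • (z * ι (dualM r n)))) with hE
  have zc : ∀ (t : ℤ) (a b : B), a * (qh t • (z * b)) = qh t • (z * (a * b)) := fun t a b => by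
    rw [mul_smul_comm, ← mul_assoc, ← (hz a).eq, mul_assoc]
  have zc' : ∀ (t : ℤ) (a b : B), qh t • (z * b) * a = qh t • (z * (b * a)) := fun t a b => by
    rw [smul_mul_assoc, mul_assoc]
  have hA : ∀ j, QComm 1 (ι (Ap r 1)) (ι (dualM r j)) := fun j => (qcomm_A_dual j).map ι
  have hsub : ∀ (t : ℤ) (a b : B), QComm 1 (ι (Ap r 1)) a → QComm 1 (ι (Ap r 1)) b →
      QComm 1 (ι (Ap r 1)) (a - qh t • (z * b)) := fun t a b ha hb => by
    rw [QComm, mul_sub, sub_mul, ha.eq, zc, hb.eq, zc', smul_sub, mul_smul_comm,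
      smul_comm (qh t)]
  have hAE : QComm 1 (z ^ (r + 1) * ι (Ap r 1)) E := by
    have e2 := (QComm.of_commute ((hz E).pow_left (r + 1))).mul_left
      (hsub _ _ _ (hsub _ _ _ (hA _) (hA _)) (hsub _ _ _ (hA _) (hA _)))
    exact e2.congr (zero_add _)
  have first : c1 * (ψ * (ι (dualM r (n + 1 + 1)) - qh 1 • (z * ι (dualM r (n + 1)))) -
      qh (-1) • (z * (ψ * (ι (dualM r (n + 1)) - qh 1 • (z * ι (dualM r n)))))) * c2 =
      c1 * ψ * c2 * E := by
    have e : (ι (dualM r (n + 1 + 1)) - qh (-1) • (z * ι (dualM r (n + 1)))) * c2 -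
        qh 1 • (z * ((ι (dualM r (n + 1)) - qh (-1) • (z * ι (dualM r n))) * c2)) = c2 * E := by
      rw [s2, s2, hE, mul_sub c2 (_ - _) (qh 1 • _), zc]
    have m : ι (dualM r (n + 1 + 1)) - qh 1 • (z * ι (dualM r (n + 1))) -
        qh (-1) • (z * (ι (dualM r (n + 1)) - qh 1 • (z * ι (dualM r n)))) =
        ι (dualM r (n + 1 + 1)) - qh (-1) • (z * ι (dualM r (n + 1))) -
        qh 1 • (z * (ι (dualM r (n + 1)) - qh (-1) • (z * ι (dualM r n)))) := by
      simp only [mul_sub, smul_sub, mul_smul_comm, smul_comm (qh (-1)) (qh 1)]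
      abel
    rw [← zc (-1) ψ, ← mul_sub ψ, m, mul_assoc c1, mul_assoc ψ, sub_mul _ _ c2, zc', e]
    simp only [mul_assoc]
  have second : c1 * ((ι (dualM r (n + 1 + 1)) - qh (-3) • (z * ι (dualM r (n + 1)))) * ψ -
      qh (-1) • (z * ((ι (dualM r (n + 1)) - qh (-3) • (z * ι (dualM r n))) * ψ))) * c2 =
      E * (c1 * ψ * c2) := by
    have e : c1 * (ι (dualM r (n + 1 + 1)) - qh (-1) • (z * ι (dualM r (n + 1)))) -
        qh (-3) • (z * (c1 * (ι (dualM r (n + 1)) - qh (-1) • (z * ι (dualM r n))))) = E * c1 := by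
      rw [← s1, ← s1, ← zc', ← sub_mul, hE]
      congr 1
      simp only [mul_sub, smul_sub, mul_smul_comm, smul_comm (qh (-3)) (qh 1)]
      abel
    have m : ι (dualM r (n + 1 + 1)) - qh (-3) • (z * ι (dualM r (n + 1))) -
        qh (-1) • (z * (ι (dualM r (n + 1)) - qh (-3) • (z * ι (dualM r n)))) =
        ι (dualM r (n + 1 + 1)) - qh (-1) • (z * ι (dualM r (n + 1))) -
        qh (-3) • (z * (ι (dualM r (n + 1)) - qh (-1) • (z * ι (dualM r n)))) := by
      simp only [mul_sub, smul_sub, mul_smul_comm, smul_comm (qh (-3)) (qh (-1))]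
      abel
    rw [← zc' (-1) ψ, ← sub_mul _ _ ψ, m, ← mul_assoc c1, mul_sub c1, zc (-3) c1, e]
    simp only [mul_assoc]
  rw [← sub_eq_zero]
  refine IsUnit.cancel_left_right h1 h2 (y := 0) ?_
  rw [mul_zero, zero_mul]
  have hd : T (n + 1) - qh (-1) • (z * T n) =
      qp (-1) • (ψ * (ι (dualM r (n + 1 + 1)) - qh 1 • (z * ι (dualM r (n + 1)))) -
      qh (-1) • (z * (ψ * (ι (dualM r (n + 1)) - qh 1 • (z * ι (dualM r n)))))) -
      ((ι (dualM r (n + 1 + 1)) - qh (-3) • (z * ι (dualM r (n + 1)))) * ψ -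
      qh (-1) • (z * ((ι (dualM r (n + 1)) - qh (-3) • (z * ι (dualM r n))) * ψ))) := by
    rw [hT, hT, mul_sub z, mul_smul_comm (qp (-1)) z, smul_sub (qh (-1)), smul_sub (qp (-1)),
      smul_comm (qh (-1)) (qp (-1))]
    abel
  rw [hd, mul_sub c1, sub_mul _ _ c2, mul_smul_comm, smul_mul_assoc (qp (-1)), first, second, hψ,
    smul_mul_assoc s, hAE.eq, smul_comm s (qp 1), qp_smul_smul, neg_add_cancel, qp_zero_smul,
    mul_smul_comm, sub_self]

theorem current_bracket_dual (hz : ∀ b, Commute z b)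
    (h1 : IsUnit (consPoly ι (qh 1 • z) n₀)) (h2 : IsUnit (consPoly ι (qh (-1) • z) n₀))
    (hψ : consPoly ι (qh 1 • z) n₀ * ψ * consPoly ι (qh (-1) • z) n₀ =
      ((-1) ^ (r + 1) * qh (-(r + 1))) • (z ^ (r + 1) * ι (Ap r 1))) {n : ℤ} {G : B}
    (hG : consPoly ι (qh 1 • z) n₀ * G = currentPoly ι (qh 1 • z) n)
    (hG' : G * consPoly ι (qh (-1) • z) n₀ = currentPoly ι (qh (-1) • z) n) :
    G * ι (dualM r n) - ι (dualM r n) * G = ((1 - qp 1) * qp (-n)) • ψ := by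
  have h := currentPoly_exchange ι (ζ := qh 1 • z) (fun b => (hz b).smul_left _) n₀ n
  rw [qp_smul_qh, show 2 * (-1 : ℤ) + 1 = -1 by norm_num, ← hG, ← hG'] at h
  refine IsUnit.cancel_left_right h1 h2 ?_
  rw [mul_smul_comm, smul_mul_assoc, hψ, smul_smul, mul_sub, sub_mul]
  simp only [mul_assoc] at h ⊢
  rw [h, smul_pow, smul_mul_assoc, smul_smul]
  congr 1
  have e : (qh 1) ^ (r + 1) = qh (r + 1) := by
    simp [qh, LaurentPolynomial.T_pow]
  rw [e, show -((r : ℤ) + 1) - n = -(r + 1) + -n by ring, qp_add,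
    show qp (-((r : ℤ) + 1)) = qh (-(r + 1)) * qh (-(r + 1)) by rw [qp, ← qh_add]; congr 1; ring]
  have e2 : qh (-((r : ℤ) + 1)) * qh (r + 1) = 1 := by rw [← qh_add, neg_add_cancel, qh_zero]
  linear_combination (1 - qp 1) * (-1) ^ (r + 1) * qh (-((r : ℤ) + 1)) * qp (-n) * e2

end Relations

/-! ### Laurent series over `U r` -/

section Laurent

variable {r : ℕ}

variable (r) in
/-- Laurent series with coefficients in `U r`. -/
abbrev Laurent : Type := HahnSeries ℤ (U r)

variable (r) in
/-- Constant Laurent series. -/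
def constL : U r →ₐ[Rq] Laurent r :=
  { (HahnSeries.C : U r →+* Laurent r) with
    commutes' := fun _ => HahnSeries.algebraMap_apply.symm }

variable (r) in
/-- The Laurent monomial `t^ε`. -/
def monoL (ε : ℤ) : Laurent r := HahnSeries.single ε 1

theorem constL_apply (a : U r) : constL r a = HahnSeries.C a := rfl

theorem coeff_constL_mul (a : U r) (b : Laurent r) (i : ℤ) :
    (constL r a * b).coeff i = a * b.coeff i :=
  HahnSeries.coeff_single_zero_mul

theorem coeff_mul_constL (a : U r) (b : Laurent r) (i : ℤ) :
    (b * constL r a).coeff i = b.coeff i * a :=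
  HahnSeries.coeff_mul_single_zero

theorem coeff_constL (a : U r) (i : ℤ) : (constL r a).coeff i = if i = 0 then a else 0 := by
  rw [constL_apply, HahnSeries.C_apply, HahnSeries.coeff_single]
  congr

theorem coeff_monoL_mul (ε : ℤ) (b : Laurent r) (i : ℤ) :
    (monoL r ε * b).coeff i = b.coeff (i - ε) := by
  rw [monoL, HahnSeries.coeff_single_mul, one_mul]

theorem monoL_commute (ε : ℤ) (b : Laurent r) : Commute (monoL r ε) b := by
  ext i
  rw [coeff_monoL_mul, monoL, HahnSeries.coeff_mul_single, mul_one]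

theorem monoL_mul (i j : ℤ) : monoL r i * monoL r j = monoL r (i + j) := by
  rw [monoL, monoL, HahnSeries.single_mul_single, one_mul, monoL]

theorem monoL_pow (i : ℤ) (k : ℕ) : monoL r i ^ k = monoL r (k * i) := by
  rw [monoL, HahnSeries.single_pow, one_pow, nsmul_eq_mul, monoL]

theorem monoL_zero : monoL r 0 = 1 := rfl

theorem coeff_smul' (s : Rq) (b : Laurent r) (i : ℤ) : (s • b).coeff i = s • b.coeff i := rfl

variable (r) in
/-- Power series as Laurent series. -/
def seriesL : PowerSeries (U r) →+* Laurent r := HahnSeries.ofPowerSeries ℤ (U r)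

theorem coeff_seriesL (s : PowerSeries (U r)) (i : ℤ) :
    (seriesL r s).coeff i = ofSeries s i := by
  rw [seriesL, PowerSeries.coeff_coe, ofSeries]
  split_ifs with h h' h'
  · omega
  · rfl
  · rw [show i.natAbs = i.toNat by omega]
  · omega

theorem coeff_seriesL_neg (s : PowerSeries (U r)) (i : ℤ) :
    (seriesL r s).coeff (-i) = ofSeriesInv s i := by
  rw [coeff_seriesL, ofSeries, ofSeriesInv]
  simp only [Left.nonneg_neg_iff]

theorem seriesL_C (a : U r) : seriesL r (PowerSeries.C a) = constL r a :=
  HahnSeries.ofPowerSeries_C a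

theorem seriesL_X : seriesL r PowerSeries.X = monoL r 1 := HahnSeries.ofPowerSeries_X

/-- A sequence of Laurent series without negative powers that is reproduced by multiplication by
`q^{s/2} t^{±1}` vanishes. -/
theorem eq_zero_of_shift {ε : ℤ} (hε : ε = 1 ∨ ε = -1) (s : ℤ) {d : ℤ → Laurent r}
    (hd : ∀ n, d n = qh s • (monoL r ε * d (n + 1)))
    (h0 : ∀ n i, i < 0 → (d n).coeff i = 0) (n : ℤ) : d n = 0 := by
  have key : ∀ (k : ℕ) (n i : ℤ), i < k → (d n).coeff i = 0 := by
    intro k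
    induction k with
    | zero => intro n i hi; exact h0 n i (by exact_mod_cast hi)
    | succ k ih =>
      intro n i hi
      push_cast at hi
      obtain rfl | rfl := hε
      · rw [hd, coeff_smul', coeff_monoL_mul, ih _ _ (by omega), smul_zero]
      -- For ε = -1 the relation is read backwards: coefficient i of d n is a scalar multiple of
      -- coefficient i-1 of d (n-1).
      · have h := ih (n - 1) (i - 1) (by omega)
        rw [hd, coeff_smul', coeff_monoL_mul, sub_add_cancel, sub_neg_eq_add, sub_add_cancel] at h
        rw [← qh_zero_smul ((d n).coeff i), ← neg_add_cancel s, ← qh_smul_smul, h, smul_zero]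
  ext i
  exact key (i + 1).toNat n i (by omega)

/-! ### Expansions of the generating polynomial -/

theorem smul_monoL_pow (s ε : ℤ) (k : ℕ) :
    (qh s • monoL r ε) ^ k = qh (s * k) • monoL r (k * ε) := by
  rw [smul_pow, monoL_pow]
  congr 1
  rw [qh, LaurentPolynomial.T_pow, qh, mul_comm]

theorem neg_one_pow_smul (k : ℕ) (t : Rq) (a : Laurent r) :
    ((-1) ^ k * t) • a = (-1) ^ k * (t • a) := by
  rcases Nat.even_or_odd k with h | h
  · rw [h.neg_one_pow, h.neg_one_pow, one_mul, one_mul]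
  · rw [h.neg_one_pow, h.neg_one_pow, neg_one_mul, neg_one_mul, neg_smul]

theorem mk_truncated (f : ℕ → U r) (N : ℕ) :
    PowerSeries.mk (fun k => if k ≤ N then f k else 0) =
      ∑ m ∈ Finset.range (N + 1), PowerSeries.C (f m) * PowerSeries.X ^ m := by
  ext k
  rw [PowerSeries.coeff_mk, map_sum]
  simp only [PowerSeries.coeff_C_mul_X_pow]
  rw [Finset.sum_ite_eq]
  simp

theorem seriesL_consSeries (n c : ℤ) :
    seriesL r (consSeries r n c) = consPoly (constL r) (qh c • monoL r 1) n := by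
  rw [consSeries, mk_truncated, map_sum, consPoly]
  refine Finset.sum_congr rfl fun m _ => ?_
  rw [map_mul, map_pow, seriesL_C, seriesL_X, monoL_pow, smul_monoL_pow, map_smul,
    neg_one_pow_smul, mul_assoc, mul_assoc, smul_mul_assoc]
  simp only [mul_smul_comm]

theorem seriesL_consSeriesInv (n c : ℤ) :
    qh (c * (r + 1)) • (monoL r (-(r + 1)) * seriesL r (consSeriesInv r n c)) =
      consPoly (constL r) (qh c • monoL r (-1)) n := by
  rw [consSeriesInv, mk_truncated, map_sum, consPoly, ← Finset.sum_range_reflect, Finset.mul_sum,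
    Finset.smul_sum]
  refine Finset.sum_congr rfl fun m hm => ?_
  have hm' : m < r + 2 := Finset.mem_range.1 hm
  rw [show r + 1 + 1 - 1 - m = r + 1 - m by omega, show r + 1 - (r + 1 - m) = m by omega]
  rw [map_mul, map_pow, seriesL_C, seriesL_X, monoL_pow, smul_monoL_pow, map_smul,
    neg_one_pow_smul, ← mul_assoc, (monoL_commute _ _).eq, mul_assoc, monoL_mul, mul_smul_comm,
    mul_smul_comm, smul_mul_assoc, qh_smul_smul, Nat.cast_sub (by omega)]
  congr 2
  · push_cast; ring
  · congr 1; push_cast; ring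

end Laurent

/-! ### Relations between the coefficients of an expansion of the Cartan current -/

section Expansion

variable {r : ℕ}

/-- The Laurent series `ψ` in `t = z^ε`, with `ε = ± 1`, is the expansion of the Cartan current;
the number `b` bounds from below the exponents of `C(z)⁻¹ g_n(z)` in `t`. -/
structure IsExpansion (n₀ ε b : ℤ) (ψ : Laurent r) : Prop where
  sign : ε = 1 ∨ ε = -1
  nonneg : 0 ≤ b
  unit : ∀ s, IsUnit (consPoly (constL r) (qh s • monoL r ε) n₀)
  eqn : consPoly (constL r) (qh 1 • monoL r ε) n₀ * ψ *
    consPoly (constL r) (qh (-1) • monoL r ε) n₀ =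
      ((-1) ^ (r + 1) * qh (-(r + 1))) • (monoL r ε ^ (r + 1) * constL r (Ap r 1))
  bound_left : ∀ (s n : ℤ) (G : Laurent r), consPoly (constL r) (qh s • monoL r ε) n₀ * G =
    currentPoly (constL r) (qh s • monoL r ε) n → ∀ i < b, G.coeff i = 0
  bound_right : ∀ (s n : ℤ) (G : Laurent r), G * consPoly (constL r) (qh s • monoL r ε) n₀ =
    currentPoly (constL r) (qh s • monoL r ε) n → ∀ i < b, G.coeff i = 0
  bound : ∀ i < 1, ψ.coeff i = 0

theorem f_eq (j : ℤ) : f r j = qh (-j) • dualM r (-j) := by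
  rw [dualM]; simpa using f_neg (r := r) (-j)

theorem monoL_central (s ε : ℤ) (b : Laurent r) : Commute (qh s • monoL r ε) b :=
  (monoL_commute ε b).smul_left _

namespace IsExpansion

variable {n₀ ε b : ℤ} {ψ : Laurent r} (h : IsExpansion n₀ ε b ψ)

include h

/-- The candidates C(ζ)⁻¹ g_n(ζ) at ζ = q^{1/2} z and g_n(ζ') C(ζ')⁻¹ at ζ' = q^{-1/2} z obey the
same inhomogeneous recursion. Their difference obeys the homogeneous one and has no negative powers,
so it vanishes; then `current_bracket_dual` applies. -/
theorem exists_current (hr : 1 ≤ r) : ∃ G : ℤ → Laurent r,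
    (∀ n, consPoly (constL r) (qh 1 • monoL r ε) n₀ * G n =
      currentPoly (constL r) (qh 1 • monoL r ε) n) ∧
    (∀ n, G n = constL r (M r 1 n) + qh 1 • (monoL r ε * G (n + 1))) ∧
    (∀ n i, i < b → (G n).coeff i = 0) ∧
    ∀ n, G n * constL r (dualM r n) - constL r (dualM r n) * G n =
      ((1 - qp 1) * qp (-n)) • ψ := by
  obtain ⟨u, hu⟩ := h.unit 1
  obtain ⟨v, hv⟩ := h.unit (-1)
  have e1 : ∀ n, consPoly (constL r) (qh 1 • monoL r ε) n₀ *
      ((u⁻¹ : (Laurent r)ˣ) * currentPoly (constL r) (qh 1 • monoL r ε) n) =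
      currentPoly (constL r) (qh 1 • monoL r ε) n := fun n => by
    rw [← hu, Units.mul_inv_cancel_left]
  have e2 : ∀ n, (currentPoly (constL r) (qh (-1) • monoL r ε) n * (v⁻¹ : (Laurent r)ˣ)) *
      consPoly (constL r) (qh (-1) • monoL r ε) n₀ =
      currentPoly (constL r) (qh (-1) • monoL r ε) n := fun n => by
    rw [← hv, Units.inv_mul_cancel_right]
  set G : ℤ → Laurent r := fun n =>
    (u⁻¹ : (Laurent r)ˣ) * currentPoly (constL r) (qh 1 • monoL r ε) n with hG
  set G' : ℤ → Laurent r := fun n =>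
    currentPoly (constL r) (qh (-1) • monoL r ε) n * (v⁻¹ : (Laurent r)ˣ) with hG'
  have b1 : ∀ n i, i < b → (G n).coeff i = 0 := fun n i hi => h.bound_left 1 n _ (e1 n) i hi
  have b2 : ∀ n i, i < b → (G' n).coeff i = 0 := fun n i hi => h.bound_right (-1) n _ (e2 n) i hi
  have r1 : ∀ n, G n = constL r (M r 1 n) + qh 1 • (monoL r ε * G (n + 1)) := fun n => by
    refine (h.unit 1).mul_left_cancel ?_
    rw [e1, mul_add, consPoly_mul_M _ hr (monoL_central 1 ε), mul_smul_comm, ← mul_assoc,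
      ← (monoL_commute ε _).eq, mul_assoc, e1, smul_mul_assoc, sub_add_cancel]
  have r2 : ∀ n, G' n = constL r (M r 1 n) + qh 1 • (monoL r ε * G' (n + 1)) := fun n => by
    refine (h.unit (-1)).mul_right_cancel ?_
    rw [e2, add_mul, M_mul_consPoly _ hr (monoL_central (-1) ε),
      smul_mul_assoc (qh 1) (monoL r ε * _), mul_assoc, e2, smul_mul_assoc, qp_smul_qh,
      show 2 * (1 : ℤ) + -1 = 1 by norm_num, sub_add_cancel]
  have hGG : ∀ n, G n - G' n = 0 := by
    refine eq_zero_of_shift h.sign 1 (fun n => ?_) fun n i hi => ?_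
    · rw [r1, r2, mul_sub, smul_sub]; abel
    · have hb := h.nonneg
      rw [HahnSeries.coeff_sub, b1 n i (by omega), b2 n i (by omega), sub_zero]
  refine ⟨G, e1, r1, b1, fun n => ?_⟩
  refine current_bracket_dual (constL r) (monoL_commute ε) (h.unit 1) (h.unit (-1)) h.eqn (e1 n) ?_
  rw [sub_eq_zero.1 (hGG n)]
  exact e2 n

theorem cartan_current (hr : 1 ≤ r) {ψ' : Dist (U r)} (hψ' : ∀ i, ψ' i = ψ.coeff (ε * i)) :
    linMul 1 (-qp 1) (prodZW ψ' (e r)) + linMul (-qp 1) 1 (prodWZ (e r) ψ') = 0 := by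
  funext i j
  have h1 := cartan_mul_current (constL r) hr (monoL_commute ε) (h.unit 1) (h.unit (-1)) h.eqn
    (j - 1)
  have h2 := congrArg (fun y : Laurent r => qh (j + 1) • y.coeff (ε * i)) h1
  simp only [mul_sub, sub_mul, mul_smul_comm, smul_mul_assoc, HahnSeries.coeff_sub, coeff_smul',
    coeff_mul_constL, coeff_constL_mul, sub_add_cancel, smul_sub, qp_smul_qh, qh_smul_smul] at h2
  rw [← mul_assoc, ← (monoL_commute ε ψ).eq, mul_assoc, mul_assoc, coeff_monoL_mul,
    coeff_monoL_mul, coeff_mul_constL, coeff_constL_mul,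
    show ε * i - ε = ε * (i - 1) by ring, ← hψ', ← hψ'] at h2
  simp only [Pi.add_apply, Pi.zero_apply, linMul, prodZW, prodWZ, e, m, one_smul, mul_smul_comm,
    smul_mul_assoc, neg_smul, qp_smul_qh]
  simp only [qp, qh_smul_smul] at h2
  rw [show 2 * 1 + (j - 1) = j + 1 by ring, show 2 * 1 + j = j + 1 + (2 * -1 + 3) by ring,
    show j - 1 = j + 1 + 2 * -1 by ring] at *
  rw [show j + 1 + 2 * -1 = j - 1 by ring] at *
  rw [show j + 1 + -1 = j by ring] at h2
  rw [← sub_eq_zero] at h2 ⊢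
  rw [sub_zero]
  have h3 := congrArg Neg.neg h2
  rw [neg_zero] at h3
  rw [← h3]
  abel

theorem cartan_dual (hr : 1 ≤ r) {ψ' : Dist (U r)} (hψ' : ∀ i, ψ' i = ψ.coeff (ε * i)) :
    linMul 1 (-qp (-1)) (prodZW ψ' (f r)) + linMul (-qp (-1)) 1 (prodWZ (f r) ψ') = 0 := by
  set T : ℤ → Laurent r := fun n => qp (-1) • (ψ * (constL r (dualM r (n + 1)) -
      qh 1 • (monoL r ε * constL r (dualM r n)))) -
      (constL r (dualM r (n + 1)) - qh (-3) • (monoL r ε * constL r (dualM r n))) * ψ with hT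
  have hc : ∀ n i, (T n).coeff i = qp (-1) • (ψ.coeff i * dualM r (n + 1)) -
      qh (-1) • (ψ.coeff (i - ε) * dualM r n) - (dualM r (n + 1) * ψ.coeff i -
      qh (-3) • (dualM r n * ψ.coeff (i - ε))) := by
    intro n i
    simp only [hT, mul_sub, sub_mul, mul_smul_comm, smul_mul_assoc, HahnSeries.coeff_sub,
      coeff_smul', coeff_mul_constL, coeff_constL_mul, smul_sub, qp_smul_qh]
    rw [← mul_assoc, ← (monoL_commute ε ψ).eq, mul_assoc, mul_assoc, coeff_monoL_mul,
      coeff_monoL_mul, coeff_mul_constL, coeff_constL_mul]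
    norm_num
  have hrec := cartan_mul_dual (constL r) hr (monoL_commute ε) (h.unit 1) (h.unit (-1)) h.eqn
    (T := T) fun n => rfl
  -- Reversing the index puts the recursion T(n+1) = q^{-1/2} z T(n) into the form required by
  -- `eq_zero_of_shift`.
  have h0 : ∀ n, T (-n) = 0 := by
    refine eq_zero_of_shift h.sign (-1) (fun n => ?_) fun n i hi => ?_
    · rw [← hrec]; congr 1; ring
    -- For ε = -1 the exponent i - ε is i + 1, which is why ψ is required to vanish also in exponent
    -- 0.
    · have h1 : ψ.coeff (i - ε) = 0 := h.bound _ (by rcases h.sign with h | h <;> omega)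
      simp [hc, h1, h.bound i (by omega)]
  funext i j
  have h2 := congrArg (fun y : Laurent r => -(qh (1 - j) • y.coeff (ε * i))) (h0 j)
  simp only [hc, HahnSeries.coeff_zero, smul_zero, neg_zero, smul_sub, qp, qh_smul_smul] at h2
  rw [show ε * i - ε = ε * (i - 1) by ring, ← hψ', ← hψ'] at h2
  simp only [Pi.add_apply, Pi.zero_apply, linMul, prodZW, prodWZ, f_eq, one_smul, mul_smul_comm,
    smul_mul_assoc, neg_smul, qp, qh_smul_smul]
  rw [← h2, show -(j - 1) = -j + 1 by ring, show 1 - j = -j + 1 by ring,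
    show -j + 1 + -1 = -j by ring, show -j + 1 + -3 = 2 * -1 + -j by ring,
    show -j + 1 + 2 * -1 = 2 * -1 + (-j + 1) by ring]
  abel

end IsExpansion

/-- Without negative powers the recursion has the unique solution ∑_{k≥0} (q^{1/2} z)^k M_{n+k}. -/
theorem coeff_current {G : ℤ → Laurent r}
    (hG : ∀ n, G n = constL r (M r 1 n) + qh 1 • (monoL r 1 * G (n + 1)))
    (hb : ∀ n i, i < 0 → (G n).coeff i = 0) (k : ℕ) :
    ∀ n, (G n).coeff k = qh k • M r 1 (n + k) := by
  induction k with
  | zero =>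
    intro n
    rw [hG, HahnSeries.coeff_add, coeff_smul', coeff_monoL_mul, hb _ _ (by simp), coeff_constL]
    simp [qh_zero_smul]
  | succ k ih =>
    intro n
    rw [hG, HahnSeries.coeff_add, coeff_smul', coeff_monoL_mul, coeff_constL,
      if_neg (by omega), Nat.cast_succ, add_sub_cancel_right, ih, qh_smul_smul, zero_add]
    congr 2 <;> ring

theorem IsExpansion.bracket_nonneg (hr : 1 ≤ r) {n₀ : ℤ} {ψ : Laurent r}
    (h : IsExpansion n₀ 1 0 ψ) (n : ℤ) (k : ℕ) :
    M r 1 (n + k) * dualM r n - dualM r n * M r 1 (n + k) =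
      ((1 - qp 1) * (qp (-n) * qh (-k))) • ψ.coeff k := by
  obtain ⟨G, -, hG, hb, hF⟩ := h.exists_current hr
  have hc := coeff_current hG hb
  have h1 := congrArg (fun y : Laurent r => qh (-k) • y.coeff k) (hF n)
  simp only [HahnSeries.coeff_sub, coeff_mul_constL, coeff_constL_mul, hc, coeff_smul', smul_sub,
    smul_mul_assoc, mul_smul_comm, qh_smul_smul, neg_add_cancel, qh_zero_smul] at h1
  rw [h1, smul_smul]
  congr 1; ring

theorem IsExpansion.bracket_neg (hr : 1 ≤ r) {n₀ : ℤ} {ψ : Laurent r}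
    (h : IsExpansion n₀ (-1) 1 ψ) (n : ℤ) (k : ℕ) :
    M r 1 (n - (k + 1)) * dualM r n - dualM r n * M r 1 (n - (k + 1)) =
      -(((1 - qp 1) * (qp (-n) * qh (k + 1))) • ψ.coeff (k + 1)) := by
  obtain ⟨G, -, hG, hb, hF⟩ := h.exists_current hr
  -- At infinity G starts in exponent 1, so coefficient 0 of the recursion at n-1 forces the first
  -- coefficient of G n; the recursion then gives the others.
  have hc : ∀ (k : ℕ) n, (G n).coeff (k + 1) = -(qh (-(k + 1)) • M r 1 (n - (k + 1))) := by
    intro k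
    induction k with
    | zero =>
      intro n
      have h0 := hb (n - 1) 0 (by norm_num)
      rw [hG, HahnSeries.coeff_add, coeff_smul', coeff_monoL_mul, coeff_constL, if_pos rfl,
        sub_add_cancel] at h0
      have h1 := congrArg (fun y => qh (-1) • y) (eq_neg_of_add_eq_zero_right h0)
      simp only [qh_smul_smul, neg_add_cancel, qh_zero_smul, smul_neg] at h1
      simpa using h1
    | succ k ih =>
      intro n
      have h0 := ih (n - 1)
      rw [hG, HahnSeries.coeff_add, coeff_smul', coeff_monoL_mul, coeff_constL,
        if_neg (by omega), sub_add_cancel, zero_add] at h0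
      have h1 := congrArg (fun y => qh (-1) • y) h0
      simp only [qh_smul_smul, neg_add_cancel, qh_zero_smul, smul_neg] at h1
      rw [sub_neg_eq_add] at h1
      rw [Nat.cast_succ, h1]
      congr 3 <;> ring
  have h1 := congrArg (fun y : Laurent r => -(qh (k + 1) • y.coeff (k + 1))) (hF n)
  simp only [HahnSeries.coeff_sub, coeff_mul_constL, coeff_constL_mul, hc, coeff_smul', smul_sub,
    neg_mul, mul_neg, smul_neg,
    smul_mul_assoc, mul_smul_comm, qh_smul_smul, add_neg_cancel, qh_zero_smul] at h1
  rw [smul_smul] at h1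
  rw [mul_comm (qp (-n)), ← mul_assoc, mul_comm (1 - qp 1), mul_assoc, ← h1]
  abel

theorem IsExpansion.current_current (hr : 1 ≤ r) {n₀ : ℤ} {ψ : Laurent r}
    (h : IsExpansion n₀ 1 0 ψ) (n : ℤ) (k : ℕ) :
    M r 1 n * M r 1 (n + 1 + k) - qp 1 • (M r 1 (n + 1 + k) * M r 1 n) +
      (M r 1 (n + k) * M r 1 (n + 1) - qp 1 • (M r 1 (n + 1) * M r 1 (n + k))) = 0 := by
  have hq : ∀ j, M r 1 j * M r 1 (j + 1) = qp 1 • (M r 1 (j + 1) * M r 1 j) := fun j =>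
    (qcomm_M_succ 1 1 j).eq
  obtain ⟨G, hcG, hG, hb, -⟩ := h.exists_current hr
  obtain _ | k := k
  · simp [hq]
  have hc := coeff_current hG hb
  have h1 := current_quadratic (constL r) hr (monoL_central 1 1) n₀ n (h.unit 1) (hcG (n + 1))
  have h2 := congrArg (fun y : Laurent r => qh (-((k + 1 : ℕ) : ℤ)) • y.coeff (k + 1 : ℕ)) h1
  rw [smul_mul_assoc (qh 1) (monoL r 1)] at h2
  simp only [HahnSeries.coeff_add, HahnSeries.coeff_sub, coeff_smul', coeff_monoL_mul] at h2
  rw [show ((k + 1 : ℕ) : ℤ) - 1 = k by push_cast; ring] at h2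
  simp only [coeff_mul_constL, coeff_constL_mul, hc, smul_sub, smul_add, smul_mul_assoc,
      mul_smul_comm, HahnSeries.coeff_zero, smul_zero, qp,
    qh_smul_smul] at h2
  rw [← h2]
  simp only [qp, Nat.cast_succ, show n + 1 + (k : ℤ) = n + (k + 1) by ring,
    show -((k : ℤ) + 1) + (k + 1) = 0 by ring, show -((k : ℤ) + 1) + (1 + k) = 0 by ring,
    show -((k : ℤ) + 1) + (2 * 1 + (k + 1)) = 2 * 1 by ring,
    show -((k : ℤ) + 1) + (1 + (2 * 1 + k)) = 2 * 1 by ring, qh_zero_smul]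

end Expansion

section Instances

variable {r : ℕ}

/-! ### The two expansions of the Cartan current -/

theorem coeff_neg_of_mem_range {b : Laurent r} (hb : b ∈ (seriesL r).range) {i : ℤ} (hi : i < 0) :
    b.coeff i = 0 := by
  obtain ⟨s, rfl⟩ := hb
  rw [coeff_seriesL, ofSeries, if_neg (by omega)]

theorem constL_mem (a : U r) : constL r a ∈ (seriesL r).range := ⟨_, seriesL_C a⟩

theorem monoL_mem (k : ℕ) : monoL r k ∈ (seriesL r).range :=
  ⟨PowerSeries.X ^ k, by rw [map_pow, seriesL_X, monoL_pow, mul_one]⟩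

theorem smul_mem_range (s : Rq) {b : Laurent r} (hb : b ∈ (seriesL r).range) :
    s • b ∈ (seriesL r).range := by
  have h : s • b = constL r (s • 1) * b := by
    rw [map_smul, map_one, smul_mul_assoc, one_mul]
  rw [h]
  exact mul_mem (constL_mem _) hb

theorem miuraCont_mem (s n : ℤ) (i l : ℕ) :
    miuraCont (constL r) (qh s • monoL r 1) n i l ∈ (seriesL r).range := by
  have hz : ∀ a : U r, qh s • monoL r 1 * constL r a ∈ (seriesL r).range := fun a =>
    mul_mem (smul_mem_range _ (monoL_mem 1)) (constL_mem a)
  induction l using Nat.strong_induction_on with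
  | _ l ih =>
    match l with
    | 0 => exact one_mem _
    | 1 => exact sub_mem (one_mem _) (hz _)
    | l + 2 =>
      exact sub_mem (mul_mem (sub_mem (one_mem _) (hz _)) (ih _ (by omega)))
        (mul_mem (hz _) (ih _ (by omega)))

/-- A continuant of length l has degree at most l in ζ, here a multiple of t⁻¹. As g_n has degree at
most r while C has degree r+1, this yields the bound b = 1 for the expansion at infinity. -/
theorem monoL_mul_miuraCont_mem (s n : ℤ) (i l : ℕ) :
    monoL r l * miuraCont (constL r) (qh s • monoL r (-1)) n i l ∈ (seriesL r).range := by
  have hz : ∀ a : U r, monoL r 1 * (qh s • monoL r (-1) * constL r a) = qh s • constL r a := by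
    intro a
    rw [← mul_assoc, mul_smul_comm, monoL_mul, add_neg_cancel, monoL_zero, smul_mul_assoc, one_mul]
  have hz' : ∀ a : U r, monoL r 1 * (qh s • monoL r (-1) * constL r a) ∈ (seriesL r).range :=
    fun a => hz a ▸ smul_mem_range _ (constL_mem a)
  have h1 : ∀ a : U r, monoL r 1 * (1 - qh s • monoL r (-1) * constL r a) ∈ (seriesL r).range :=
    fun a => by
      rw [mul_sub, mul_one]
      exact sub_mem (monoL_mem 1) (hz' a)
  have hsucc : ∀ l : ℕ, monoL r ((l + 1 : ℕ) : ℤ) = monoL r 1 * monoL r l := fun l => by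
    rw [monoL_mul, Nat.cast_succ, add_comm]
  have hcomm : ∀ (l : ℕ) (a b : Laurent r),
      monoL r ((l + 1 : ℕ) : ℤ) * (a * b) = (monoL r 1 * a) * (monoL r l * b) := fun l a b => by
    rw [hsucc, mul_assoc, ← mul_assoc _ a, (monoL_commute l a).eq]
    simp only [mul_assoc]
  induction l using Nat.strong_induction_on with
  | _ l ih =>
    match l with
    | 0 => rw [miuraCont_zero, mul_one]; exact monoL_mem 0
    | 1 => rw [miuraCont_one, Nat.cast_one]; exact h1 _
    | l + 2 =>
      rw [miuraCont_top, mul_sub, hcomm]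
      refine sub_mem (mul_mem (h1 _) (ih _ (by omega))) ?_
      rw [hcomm, hsucc, mul_assoc (monoL r 1) (monoL r l)]
      exact mul_mem (hz' _) (mul_mem (monoL_mem 1) (ih _ (by omega)))

theorem invOfUnit_mul_of_mul {B : Type} [Ring B] {φ : PowerSeries B} {u : Bˣ}
    (h : φ * PowerSeries.invOfUnit φ u = 1) : PowerSeries.invOfUnit φ u * φ = 1 := by
  refine PowerSeries.invOfUnit_mul φ u ?_
  have h1 := congrArg PowerSeries.constantCoeff h
  rw [map_mul, PowerSeries.constantCoeff_invOfUnit, map_one] at h1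
  rw [← Units.mul_left_inj u⁻¹, h1, Units.mul_inv]

/-- C(q^{1/2} z) commutes with A and with powers of z, so it can be moved up to its inverse. -/
theorem eqn_of_inverse {ε n : ℤ} {D : ℤ → Laurent r} {ψ : Laurent r} {t : Rq}
    (h1 : ∀ s, consPoly (constL r) (qh s • monoL r ε) n * D s = 1)
    (h2 : ∀ s, D s * consPoly (constL r) (qh s • monoL r ε) n = 1)
    (hψ : ψ = monoL r ε ^ (r + 1) * (t • constL r (Ap r 1)) * D 1 * D (-1)) :
    consPoly (constL r) (qh 1 • monoL r ε) n * ψ * consPoly (constL r) (qh (-1) • monoL r ε) n =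
      t • (monoL r ε ^ (r + 1) * constL r (Ap r 1)) := by
  have hc : Commute (consPoly (constL r) (qh 1 • monoL r ε) n)
      (monoL r ε ^ (r + 1) * (t • constL r (Ap r 1))) :=
    ((monoL_commute ε _).symm.pow_right _).mul_right
      (((commute_A_consPoly (constL r) (monoL_central 1 ε) n).symm).smul_right t)
  rw [hψ, mul_assoc _ _ (consPoly _ _ n), mul_assoc _ (D (-1)), h2, mul_one, ← mul_assoc, hc.eq,
    mul_assoc, h1, mul_one, mul_smul_comm]

theorem isUnit_of_inverse {B : Type} [Ring B] {a b : B} (h1 : a * b = 1) (h2 : b * a = 1) :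
    IsUnit a := ⟨⟨a, b, h1, h2⟩, rfl⟩

theorem mul_central_rearrange {B : Type} [Ring B] {m' c m a b d : B} (h : m' = c * m * m)
    (hm : ∀ x, Commute m x) : m' * a * b * d = c * a * (m * b) * (m * d) := by
  have h1 : m' = m * (m * c) := by rw [h, (hm _).eq, mul_assoc, (hm c).eq, mul_assoc]
  have h2 : ∀ u v : B, u * (m * v) = m * (u * v) := fun u v => by
    rw [← mul_assoc, ← (hm u).eq, mul_assoc]
  rw [h1, h2 (c * a) b, h2 _ d]
  simp only [mul_assoc]

variable (r) in
/-- The power series underlying `ψ⁺`. -/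
def psiPlusSeries (n : ℤ) : PowerSeries (U r) :=
  PowerSeries.X ^ (r + 1) *
    PowerSeries.C (((-1) ^ (r + 1) * qh (-(r + 1))) • (A r : U r)) *
    PowerSeries.invOfUnit (consSeries r n 1) 1 * PowerSeries.invOfUnit (consSeries r n (-1)) 1

variable (r) in
/-- The power series underlying `ψ⁻`. -/
def psiMinusSeries (n : ℤ) : PowerSeries (U r) :=
  PowerSeries.X ^ (r + 1) *
    PowerSeries.C (((-1) ^ (r + 1) * qh (-(r + 1))) • (A r : U r)) *
    PowerSeries.invOfUnit (consSeriesInv r n 1) ((-1) ^ (r + 1) * A r) *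
    PowerSeries.invOfUnit (consSeriesInv r n (-1)) ((-1) ^ (r + 1) * A r)

theorem psiPlus_eq (n i : ℤ) : psiPlus r n i = (seriesL r (psiPlusSeries r n)).coeff i :=
  (coeff_seriesL _ i).symm

theorem psiMinus_eq (n i : ℤ) : psiMinus r n i = (seriesL r (psiMinusSeries r n)).coeff (-i) :=
  (coeff_seriesL_neg _ i).symm

theorem coe_A : ((A r : (U r)ˣ) : U r) = Ap r 1 := by simp [Ap]

theorem coeff_X_pow_series {a b c : PowerSeries (U r)} {i : ℤ} (hi : i < r + 1) :
    (seriesL r (PowerSeries.X ^ (r + 1) * a * b * c)).coeff i = 0 := by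
  rw [coeff_seriesL, ofSeries]
  split_ifs with h
  · rw [mul_assoc, mul_assoc, PowerSeries.coeff_X_pow_mul', if_neg (by omega)]
  · rfl

theorem isExpansion_plus (n : ℤ) : IsExpansion n 1 0 (seriesL r (psiPlusSeries r n)) := by
  have h1 : ∀ s, consPoly (constL r) (qh s • monoL r 1) n *
      seriesL r (PowerSeries.invOfUnit (consSeries r n s) 1) = 1 := fun s => by
    rw [← seriesL_consSeries, ← map_mul, consSeries_mul_inv, map_one]
  have h2 : ∀ s, seriesL r (PowerSeries.invOfUnit (consSeries r n s) 1) *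
      consPoly (constL r) (qh s • monoL r 1) n = 1 := fun s => by
    rw [← seriesL_consSeries, ← map_mul, invOfUnit_mul_of_mul (consSeries_mul_inv n s), map_one]
  have hg : ∀ s k, currentPoly (constL r) (qh s • monoL r 1) k ∈ (seriesL r).range := fun s k =>
    mul_mem (miuraCont_mem s _ _ _) (constL_mem _)
  refine ⟨.inl rfl, le_rfl, fun s => isUnit_of_inverse (h1 s) (h2 s), eqn_of_inverse h1 h2 ?_,
    fun s k G hG i hi => ?_, fun s k G hG i hi => ?_, fun i hi => coeff_X_pow_series (by omega)⟩
  · rw [psiPlusSeries, map_mul, map_mul, map_mul, map_pow, seriesL_X, seriesL_C, map_smul, coe_A]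
  · have h : G = seriesL r (PowerSeries.invOfUnit (consSeries r n s) 1) *
        currentPoly (constL r) (qh s • monoL r 1) k := by
      rw [← hG, ← mul_assoc, h2, one_mul]
    rw [h]
    exact coeff_neg_of_mem_range (mul_mem ⟨_, rfl⟩ (hg s k)) hi
  · have h : G = currentPoly (constL r) (qh s • monoL r 1) k *
        seriesL r (PowerSeries.invOfUnit (consSeries r n s) 1) := by
      rw [← hG, mul_assoc, h1, mul_one]
    rw [h]
    exact coeff_neg_of_mem_range (mul_mem (hg s k) ⟨_, rfl⟩) hi

theorem isExpansion_minus (n : ℤ) : IsExpansion n (-1) 1 (seriesL r (psiMinusSeries r n)) := by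
  set I : ℤ → Laurent r := fun s =>
    seriesL r (PowerSeries.invOfUnit (consSeriesInv r n s) ((-1) ^ (r + 1) * A r)) with hI
  -- With z = t⁻¹, this restores the factor (q^{s/2} z)^{r+1} divided out in `consSeriesInv`. In ψ⁻
  -- the powers of q from s = 1 and s = -1 cancel.
  set D : ℤ → Laurent r := fun s => qh (-(s * (r + 1))) • (monoL r (r + 1) * I s) with hD
  have h1 : ∀ s, consPoly (constL r) (qh s • monoL r (-1)) n * D s = 1 := fun s => by
    rw [← seriesL_consSeriesInv, hD, smul_mul_assoc, mul_smul_comm, qh_smul_smul, add_neg_cancel,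
      qh_zero_smul, (monoL_commute (-((r : ℤ) + 1)) _).eq, mul_assoc, ← mul_assoc (monoL r _),
      monoL_mul, neg_add_cancel, monoL_zero, one_mul, hI, ← map_mul, consSeriesInv_mul_inv, map_one]
  have h2 : ∀ s, D s * consPoly (constL r) (qh s • monoL r (-1)) n = 1 := fun s => by
    rw [← seriesL_consSeriesInv, hD, smul_mul_assoc, mul_smul_comm, qh_smul_smul, neg_add_cancel,
      qh_zero_smul, (monoL_commute ((r : ℤ) + 1) _).eq, mul_assoc, ← mul_assoc (monoL r _),
      monoL_mul, add_neg_cancel, monoL_zero, one_mul, hI, ← map_mul,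
      invOfUnit_mul_of_mul (consSeriesInv_mul_inv n s), map_one]
  have hg : ∀ s k, monoL r r * currentPoly (constL r) (qh s • monoL r (-1)) k ∈
      (seriesL r).range := fun s k => by
    rw [currentPoly, ← mul_assoc]
    exact mul_mem (monoL_mul_miuraCont_mem s _ _ _) (constL_mem _)
  have hb : ∀ G : Laurent r, monoL r (-1) * G ∈ (seriesL r).range → ∀ i < 1, G.coeff i = 0 := by
    intro G hG i hi
    have h := coeff_neg_of_mem_range hG (i := i - 1) (by omega)
    rwa [coeff_monoL_mul, sub_neg_eq_add, sub_add_cancel] at h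
  refine ⟨.inr rfl, zero_le_one, fun s => isUnit_of_inverse (h1 s) (h2 s),
    eqn_of_inverse h1 h2 ?_, fun s k G hG => hb G ?_, fun s k G hG => hb G ?_,
    fun i hi => coeff_X_pow_series (by omega)⟩
  · rw [psiMinusSeries, map_mul, map_mul, map_mul, map_pow, seriesL_X, seriesL_C, map_smul, coe_A]
    simp only [hD, monoL_pow, mul_smul_comm, smul_mul_assoc, qh_smul_smul]
    rw [show -(-1 * ((r : ℤ) + 1)) + -(1 * (r + 1)) = 0 by ring, qh_zero_smul]
    congr 1
    refine mul_central_rearrange ?_ (monoL_commute _)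
    rw [monoL_mul, monoL_mul]
    congr 1
    push_cast; ring
  · have h : monoL r (-1) * G = qh (-(s * (r + 1))) • (I s *
        (monoL r r * currentPoly (constL r) (qh s • monoL r (-1)) k)) := by
      have h3 : G = D s * currentPoly (constL r) (qh s • monoL r (-1)) k := by
        rw [← hG, ← mul_assoc, h2, one_mul]
      rw [h3, hD, smul_mul_assoc, mul_smul_comm, ← mul_assoc, ← mul_assoc, monoL_mul,
        (monoL_commute _ (I s)).eq, mul_assoc, show -1 + ((r : ℤ) + 1) = r by ring]
    rw [h]
    exact smul_mem_range _ (mul_mem ⟨_, rfl⟩ (hg s k))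
  · have h : monoL r (-1) * G = qh (-(s * (r + 1))) •
        ((monoL r r * currentPoly (constL r) (qh s • monoL r (-1)) k) * I s) := by
      have h3 : G = currentPoly (constL r) (qh s • monoL r (-1)) k * D s := by
        rw [← hG, mul_assoc, h1, mul_one]
      rw [h3, hD, mul_smul_comm, mul_smul_comm, ← mul_assoc, ← mul_assoc, mul_assoc (monoL r (-1)),
        ← (monoL_commute ((r : ℤ) + 1) _).eq, ← mul_assoc, monoL_mul,
        show -1 + ((r : ℤ) + 1) = r by ring]
    rw [h]
    exact smul_mem_range _ (mul_mem (hg s k) ⟨_, rfl⟩)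

end Instances

section Relations

variable {r : ℕ}

/-! ### The relations between the currents -/

theorem M_quadratic (hr : 1 ≤ r) (a b : ℤ) :
    M r 1 a * M r 1 b - qp 1 • (M r 1 b * M r 1 a) +
      (M r 1 (b - 1) * M r 1 (a + 1) - qp 1 • (M r 1 (a + 1) * M r 1 (b - 1))) = 0 := by
  have key : ∀ a b : ℤ, a + 1 ≤ b → M r 1 a * M r 1 b - qp 1 • (M r 1 b * M r 1 a) +
      (M r 1 (b - 1) * M r 1 (a + 1) - qp 1 • (M r 1 (a + 1) * M r 1 (b - 1))) = 0 := by
    intro a b hab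
    obtain ⟨k, hk⟩ := Int.eq_ofNat_of_zero_le (show 0 ≤ b - (a + 1) by omega)
    have h := (isExpansion_plus (r := r) 0).current_current hr a k
    rwa [show a + 1 + (k : ℤ) = b by omega, show a + (k : ℤ) = b - 1 by omega] at h
  rcases le_total (a + 1) b with hab | hab
  · exact key a b hab
  -- The relation is invariant under (a, b) ↦ (b-1, a+1), so the expansion in nonnegative powers of
  -- z is enough.
  · have h := key (b - 1) (a + 1) (by omega)
    rw [add_sub_cancel_right, sub_add_cancel, add_comm] at h
    exact h

theorem e_quadratic (hr : 1 ≤ r) (i j : ℤ) :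
    e r (i - 1) * e r j - qp 1 • (e r i * e r (j - 1)) +
      (-(qp 1 • (e r j * e r (i - 1))) + e r (j - 1) * e r i) = 0 := by
  have h := congrArg (fun y => qh (i + j - 1) • y) (M_quadratic hr (i - 1) j)
  simp only [e, m, smul_mul_assoc, mul_smul_comm, qh_smul_smul, smul_comm (qp 1)]
  simp only [smul_add, smul_sub, smul_zero, sub_add_cancel] at h
  rw [← h, show i - 1 + j = i + j - 1 by ring, show j + (i - 1) = i + j - 1 by ring,
    show i + (j - 1) = i + j - 1 by ring, show j - 1 + i = i + j - 1 by ring]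
  abel

theorem e_e (hr : 1 ≤ r) : linMul 1 (-qp 1) (prodZW (e r) (e r)) +
    linMul (-qp 1) 1 (prodWZ (e r) (e r)) = 0 := by
  funext i j
  simp only [Pi.add_apply, Pi.zero_apply, linMul, prodZW, prodWZ, one_smul, neg_smul,
    ← sub_eq_add_neg]
  exact e_quadratic hr i j

/-- The anti-homomorphism στ reverses the products in the 𝔢𝔢 relation; multiplication by -q⁻¹ brings
the result to the stated form. -/
theorem f_f (hr : 1 ≤ r) : linMul 1 (-qp (-1)) (prodZW (f r) (f r)) +
    linMul (-qp (-1)) 1 (prodWZ (f r) (f r)) = 0 := by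
  funext i j
  have h := congrArg (fun y => -(qp (-1) • sigma r (tau r y).unop)) (e_quadratic hr i j)
  simp only [map_add, map_sub, map_neg, map_smul, map_mul, map_zero, MulOpposite.unop_add,
    MulOpposite.unop_sub, MulOpposite.unop_neg, MulOpposite.unop_smul, MulOpposite.unop_mul,
    MulOpposite.unop_zero, smul_add, smul_sub, smul_neg, smul_zero, smul_smul, neg_zero,
    ← qp_add, neg_add_cancel, qp_zero, one_smul] at h
  simp only [Pi.add_apply, Pi.zero_apply, linMul, prodZW, prodWZ, one_smul, neg_smul,
    ← sub_eq_add_neg]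
  simp only [f]
  rw [← h]
  abel

theorem psiPlus_e (hr : 1 ≤ r) (n : ℤ) :
    linMul 1 (-qp 1) (prodZW (psiPlus r n) (e r)) +
      linMul (-qp 1) 1 (prodWZ (e r) (psiPlus r n)) = 0 :=
  (isExpansion_plus n).cartan_current hr fun i => by rw [one_mul, psiPlus_eq]

theorem psiMinus_e (hr : 1 ≤ r) (n : ℤ) :
    linMul 1 (-qp 1) (prodZW (psiMinus r n) (e r)) +
      linMul (-qp 1) 1 (prodWZ (e r) (psiMinus r n)) = 0 :=
  (isExpansion_minus n).cartan_current hr fun i => by rw [neg_one_mul, psiMinus_eq]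

theorem psiPlus_f (hr : 1 ≤ r) (n : ℤ) :
    linMul 1 (-qp (-1)) (prodZW (psiPlus r n) (f r)) +
      linMul (-qp (-1)) 1 (prodWZ (f r) (psiPlus r n)) = 0 :=
  (isExpansion_plus n).cartan_dual hr fun i => by rw [one_mul, psiPlus_eq]

theorem psiMinus_f (hr : 1 ≤ r) (n : ℤ) :
    linMul 1 (-qp (-1)) (prodZW (psiMinus r n) (f r)) +
      linMul (-qp (-1)) 1 (prodWZ (f r) (psiMinus r n)) = 0 :=
  (isExpansion_minus n).cartan_dual hr fun i => by rw [neg_one_mul, psiMinus_eq]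

/-! ### Valuations -/

theorem psiPlus_eq_zero (n : ℤ) {i : ℤ} (hi : i < r + 1) : psiPlus r n i = 0 := by
  rw [psiPlus_eq]
  exact coeff_X_pow_series hi

theorem psiMinus_eq_zero (n : ℤ) {i : ℤ} (hi : -(r + 1) < i) : psiMinus r n i = 0 := by
  rw [psiMinus_eq]
  exact coeff_X_pow_series (by omega)

theorem coeff_X_pow_series_leading (s : Rq) (a : U r) (b c : PowerSeries (U r)) :
    (seriesL r (PowerSeries.X ^ (r + 1) * PowerSeries.C (s • a) * b * c)).coeff (r + 1) =
      s • (a * PowerSeries.constantCoeff b * PowerSeries.constantCoeff c) := by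
  rw [coeff_seriesL, ofSeries, if_pos (by omega), show ((r : ℤ) + 1).toNat = r + 1 by omega,
    mul_assoc, mul_assoc, PowerSeries.coeff_X_pow_mul', if_pos le_rfl, Nat.sub_self,
    PowerSeries.coeff_zero_eq_constantCoeff_apply]
  simp [mul_assoc]

theorem psiPlus_leading (n : ℤ) :
    psiPlus r n (r + 1) = ((-1) ^ (r + 1) * qh (-(r + 1))) • (A r : U r) := by
  rw [psiPlus_eq, psiPlusSeries, coeff_X_pow_series_leading]
  simp

theorem psiMinus_leading (n : ℤ) :
    psiMinus r n (-(r + 1)) =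
      ((-1) ^ (r + 1) * qh (-(r + 1))) • (((A r)⁻¹ : (U r)ˣ) : U r) := by
  rw [psiMinus_eq, neg_neg, psiMinusSeries, coeff_X_pow_series_leading]
  congr 1
  rw [PowerSeries.constantCoeff_invOfUnit, PowerSeries.constantCoeff_invOfUnit, mul_inv_rev,
    ← Units.val_mul, ← Units.val_mul]
  congr 1
  rw [mul_inv_cancel_left]
  have h : ((-1 : (U r)ˣ) ^ (r + 1)) * (-1) ^ (r + 1) = 1 := by
    rw [← pow_add, Even.neg_one_pow ⟨r + 1, rfl⟩]
  rw [inv_eq_of_mul_eq_one_right h, ((Commute.neg_one_right ((A r)⁻¹)).pow_right _).eq,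
    ← mul_assoc, h, one_mul]

/-! ### The bracket of the two currents -/

theorem e_f (hr : 1 ≤ r) (n : ℤ) : prodZW (e r) (f r) - prodWZ (f r) (e r) =
    (1 - qp 1) • deltaMul (psiPlus r n - psiMinus r n) := by
  funext i j
  have hs : ∀ y : U r, ((1 - qp 1) * (qp j * qh (-(i + j)))) • y =
      qh (j - i) • ((1 - qp 1) • y) := fun y => by
    rw [smul_smul, mul_comm (1 - qp 1), qp, ← qh_add]
    congr 3; ring
  have he : e r i * f r j - f r j * e r i =
      qh (i - j) • (M r 1 i * dualM r (-j) - dualM r (-j) * M r 1 i) := by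
    rw [f_eq, e, m, smul_sub]
    simp only [smul_mul_assoc, mul_smul_comm, qh_smul_smul]
    rw [← sub_eq_add_neg, show -j + i = i - j by ring]
  have hfin : ∀ y : U r, qh (i - j) • (qh (j - i) • y) = y := fun y => by
    rw [qh_smul_smul, sub_add_sub_cancel, sub_self, qh_zero_smul]
  simp only [Pi.sub_apply, Pi.smul_apply, prodZW, prodWZ, deltaMul_apply]
  rw [he]
  -- The coefficient of δ(z/w) ψ(z) at z^i w^j is ψ_{i+j}: ψ⁻ vanishes in nonnegative degrees and ψ⁺
  -- in negative ones, so each sign of i + j uses one expansion.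
  rcases le_or_gt 0 (i + j) with hk | hk
  · obtain ⟨k, hk⟩ := Int.eq_ofNat_of_zero_le hk
    have h := (isExpansion_plus (r := r) n).bracket_nonneg hr (-j) k
    rw [show -j + (k : ℤ) = i by omega, neg_neg, ← hk, hs] at h
    rw [h, hfin, ← psiPlus_eq, psiMinus_eq_zero n (by omega), sub_zero]
  · obtain ⟨k, hk⟩ := Int.eq_ofNat_of_zero_le (show 0 ≤ -(i + j) - 1 by omega)
    have h := (isExpansion_minus (r := r) n).bracket_neg hr (-j) k
    have hk' : (k : ℤ) + 1 = -(i + j) := by omega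
    rw [hk', show -j - -(i + j) = i by ring, neg_neg, hs] at h
    rw [h, smul_neg, hfin, ← psiMinus_eq, psiPlus_eq_zero n (by omega), zero_sub, smul_neg]

end Relations

/-! ### A representation at `q = 1` -/

section Specialization

/-- The product `(t + 1) ⋯ (t + a)`. -/
def risingProd (t : ℚ) (a : ℕ) : ℚ := ∏ i ∈ Finset.range a, (t + i + 1)

/-- The product of `t + i + j + 1` over `i < a` and `j < b`. -/
def boxProd (t : ℚ) (a b : ℕ) : ℚ := ∏ i ∈ Finset.range a, risingProd (t + i) b

theorem risingProd_succ' (t : ℚ) (a : ℕ) :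
    risingProd t (a + 1) = (t + 1) * risingProd (t + 1) a := by
  rw [risingProd, Finset.prod_range_succ', risingProd, mul_comm]
  push_cast
  rw [add_zero]
  congr 1
  exact Finset.prod_congr rfl fun i _ => by ring

theorem risingProd_shift (t : ℚ) (a : ℕ) :
    (t + 1) * risingProd (t + 1) a = risingProd t a * (t + a + 1) := by
  rw [← risingProd_succ', risingProd, Finset.prod_range_succ, risingProd]

theorem boxProd_succ_left (t : ℚ) (a b : ℕ) :
    boxProd t (a + 1) b = boxProd t a b * risingProd (t + a) b := Finset.prod_range_succ _ _

theorem boxProd_succ_right (t : ℚ) (a b : ℕ) :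
    boxProd t a (b + 1) = boxProd t a b * risingProd (t + b) a := by
  rw [boxProd, boxProd, risingProd, ← Finset.prod_mul_distrib]
  refine Finset.prod_congr rfl fun i _ => ?_
  rw [risingProd, Finset.prod_range_succ, ← risingProd]
  ring

theorem boxProd_shift (t : ℚ) (a b : ℕ) :
    boxProd (t + 1) a b * risingProd t b = boxProd t a b * risingProd (t + a) b := by
  rw [← boxProd_succ_left, boxProd, boxProd, Finset.prod_range_succ']
  push_cast
  rw [add_zero]
  congr 1
  exact Finset.prod_congr rfl fun i _ => by rw [add_right_comm, add_assoc]

theorem risingProd_ne_zero {t : ℚ} (h : ∀ k : ℕ, t + k + 1 ≠ 0) (a : ℕ) : risingProd t a ≠ 0 :=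
  Finset.prod_ne_zero_iff.2 fun i _ => h i

theorem boxProd_ne_zero {t : ℚ} (h : ∀ k : ℕ, t + k + 1 ≠ 0) (a b : ℕ) : boxProd t a b ≠ 0 :=
  Finset.prod_ne_zero_iff.2 fun i _ => risingProd_ne_zero (fun k => by
    have := h (i + k)
    push_cast at this
    rwa [← add_assoc] at this) b

theorem boxProd_time {t : ℚ} (h : ∀ k : ℤ, t + k ≠ 0) (a b : ℕ) :
    boxProd (t + 1) a b * boxProd (t - 1) a b * ((t + a) * (t + b)) =
      boxProd t a b ^ 2 * (t * (t + a + b)) := by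
  have hn : ∀ (j : ℤ) (k : ℕ), t + j + k + 1 ≠ 0 := fun j k => by
    have := h (j + k + 1)
    push_cast at this
    rwa [← add_assoc, ← add_assoc] at this
  have n1 : risingProd t b ≠ 0 := risingProd_ne_zero (by simpa using hn 0) b
  have n2 : risingProd (t - 1 + a) b ≠ 0 := risingProd_ne_zero (by
    have := hn (-1 + a)
    push_cast at this
    rwa [← add_assoc, ← sub_eq_add_neg] at this) b
  have e1 := boxProd_shift t a b
  have e2 := boxProd_shift (t - 1) a b
  have e3 := risingProd_shift (t - 1) b
  have e4 := risingProd_shift (t - 1 + a) b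
  rw [sub_add_cancel] at e2 e3
  rw [show t - 1 + a + 1 = t + a by ring] at e4
  refine mul_right_cancel₀ (mul_ne_zero n1 n2) ?_
  linear_combination (boxProd (t - 1) a b * ((t + a) * (t + b)) * risingProd (t - 1 + a) b) * e1 -
    (boxProd t a b * risingProd (t + a) b * ((t + a) * (t + b))) * e2 +
    (boxProd t a b ^ 2 * risingProd (t - 1) b * (t + b)) * e4 -
    (boxProd t a b ^ 2 * risingProd (t - 1 + a) b * (t + a + b)) * e3

theorem boxProd_neighbours (t : ℚ) (a b : ℕ) :
    boxProd t (a + 2) b * boxProd t a (b + 2) * ((t + (a + 1)) * (t + (b + 1))) =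
      boxProd t (a + 1) (b + 1) ^ 2 := by
  have e1 := boxProd_succ_left t (a + 1) b
  have e2 := boxProd_succ_right t a (b + 1)
  have e3 := boxProd_succ_left t a (b + 1)
  have e4 := boxProd_succ_right t (a + 1) b
  rw [risingProd_succ'] at e3 e4
  push_cast at e1 e2
  rw [← add_assoc] at e1 e2
  rw [sq]
  nth_rewrite 1 [e3]
  rw [e4, e1, e2]
  ring

/-- The values of `M_{α,n}` in the representation at `q = 1`. -/
def specM (r α : ℕ) (n : ℤ) : ℚ :=
  if α ≤ r + 1 then boxProd (n + 1 / 2) α (r + 1 - α) / boxProd 0 α (r + 1 - α) else 0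

/-- The roots of the polynomials `boxProd` in t are integers, so evaluation at half-integers keeps
every M_{α,n} with α ≤ r+1 invertible. -/
theorem half_ne_zero (n k : ℤ) : (n : ℚ) + 1 / 2 + k ≠ 0 := by
  intro h
  have h2 : ((2 * n + 1 + 2 * k : ℤ) : ℚ) = 0 := by push_cast; linarith
  have h3 : 2 * n + 1 + 2 * k = 0 := by exact_mod_cast h2
  omega

theorem boxProd_zero_ne_zero (a b : ℕ) : boxProd 0 a b ≠ 0 :=
  boxProd_ne_zero (fun k => by positivity) a b

variable {r : ℕ}

theorem specM_ne_zero {α : ℕ} (h : α ≤ r + 1) (n : ℤ) : specM r α n ≠ 0 := by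
  rw [specM, if_pos h]
  refine div_ne_zero (boxProd_ne_zero (fun k => ?_) _ _) (boxProd_zero_ne_zero _ _)
  have := half_ne_zero n (k + 1)
  push_cast at this
  rwa [← add_assoc] at this

theorem specM_zero (n : ℤ) : specM r 0 n = 1 := by simp [specM, boxProd]

theorem specM_top (n : ℤ) : specM r (r + 1) n = 1 := by simp [specM, boxProd, risingProd]

theorem specM_rank {α : ℕ} (h : r + 2 ≤ α) (n : ℤ) : specM r α n = 0 :=
  if_neg (by omega)

/-- As functions of t these are the Weyl dimension polynomials of the representations of GL_{r+1}
with rectangular highest weight t ω_α, which solve the classical Q-system identically in t. -/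
theorem specM_msys {α : ℕ} (h1 : 1 ≤ α) (h2 : α ≤ r + 1) (n : ℤ) :
    specM r α (n + 1) * specM r α (n - 1) =
      specM r α n * specM r α n - specM r (α + 1) n * specM r (α - 1) n := by
  obtain ⟨a, rfl⟩ : ∃ a, α = a + 1 := ⟨α - 1, by omega⟩
  rw [Nat.add_sub_cancel]
  obtain rfl | h3 : a = r ∨ a + 1 ≤ r := by omega
  · rw [specM_top, specM_top, specM_top, specM_rank le_rfl]; norm_num
  obtain ⟨b, rfl⟩ : ∃ b, r = a + 1 + b := ⟨r - (a + 1), by omega⟩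
  have c1 : a + 1 + b + 1 - (a + 1) = b + 1 := by omega
  have c2 : a + 1 + b + 1 - (a + 1 + 1) = b := by omega
  have c3 : a + 1 + b + 1 - a = b + 2 := by omega
  simp only [specM, if_pos h2, if_pos (show a + 1 + 1 ≤ a + 1 + b + 1 by omega),
    if_pos (show a ≤ a + 1 + b + 1 by omega), c1, c2, c3]
  push_cast
  set t : ℚ := (n : ℚ) + 1 / 2 with ht
  rw [show (n : ℚ) + 1 + 1 / 2 = t + 1 by rw [ht]; ring,
    show (n : ℚ) - 1 + 1 / 2 = t - 1 by rw [ht]; ring]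
  have e1 := boxProd_time (half_ne_zero n) (a + 1) (b + 1)
  have e2 := boxProd_neighbours t a b
  have e3 := boxProd_neighbours 0 a b
  have n1 := boxProd_zero_ne_zero (a + 1) (b + 1)
  have n2 := boxProd_zero_ne_zero (a + 2) b
  have n3 := boxProd_zero_ne_zero a (b + 2)
  have n4 : t + (a + 1) ≠ 0 := by exact_mod_cast half_ne_zero n (a + 1)
  have n5 : t + (b + 1) ≠ 0 := by exact_mod_cast half_ne_zero n (b + 1)
  rw [← ht] at e1
  push_cast at e1
  rw [zero_add, zero_add] at e3
  have e4 : boxProd t (a + 1 + 1) b / boxProd 0 (a + 1 + 1) b *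
      (boxProd t a (b + 2) / boxProd 0 a (b + 2)) * ((t + (a + 1)) * (t + (b + 1))) =
      (boxProd t (a + 1) (b + 1) / boxProd 0 (a + 1) (b + 1)) ^ 2 * ((a + 1) * (b + 1)) := by
    rw [div_pow, ← e2, ← e3]
    have n6 : (a : ℚ) + 1 ≠ 0 := by positivity
    have n7 : (b : ℚ) + 1 ≠ 0 := by positivity
    field_simp
  have e5 : boxProd (t + 1) (a + 1) (b + 1) / boxProd 0 (a + 1) (b + 1) *
      (boxProd (t - 1) (a + 1) (b + 1) / boxProd 0 (a + 1) (b + 1)) *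
        ((t + (a + 1)) * (t + (b + 1))) =
      (boxProd t (a + 1) (b + 1) / boxProd 0 (a + 1) (b + 1)) ^ 2 *
        (t * (t + (a + 1) + (b + 1))) := by
    rw [div_mul_div_comm, div_mul_eq_mul_div, e1, ← sq, div_pow, div_mul_eq_mul_div]
  -- After division by the square of M_{α,n} the claim is t(t + a + b + 2) = (t + a + 1)(t + b + 1)
  -- - (a + 1)(b + 1).
  refine mul_right_cancel₀ (mul_ne_zero n4 n5) ?_
  rw [sub_mul, e4, e5]
  ring

/-- The values of the generators in the representation at `q = 1`. -/
def specGen (r : ℕ) : Gen → ℚ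
  | .M α n => specM r α n
  | .Mi α n => (specM r α n)⁻¹
  | .A => 1
  | .Ai => 1
  | .D => 1
  | .Di => 1

/-- A ring homomorphism to ℚ sending q^{1/2} to 1 suffices: in a nontrivial ring the unit A is
nonzero. -/
instance nontrivial_U : Nontrivial (U r) := by
  let : Algebra Rq ℚ :=
    (LaurentPolynomial.eval₂ (Int.castRingHom ℚ) (1 : ℚˣ)).toAlgebra
  have hq : ∀ (k : ℤ) (y : ℚ), qp k • y = y := fun k y => by
    rw [Algebra.smul_def]
    change LaurentPolynomial.eval₂ (Int.castRingHom ℚ) (1 : ℚˣ) (LaurentPolynomial.T (2 * k)) * y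
        = y
    simp
  have h : ∀ ⦃x y⦄, Rel r x y →
      FreeAlgebra.lift Rq (specGen r) x = FreeAlgebra.lift Rq (specGen r) y := by
    intro x y h
    cases h with
    | M_zero n => simp [specGen, specM_zero]
    | M_rank α n h => simp [specGen, specM_rank h]
    | Mi_rank α n h => simp [specGen, specM_rank h]
    | M_Mi α n h => simp [specGen, specM_ne_zero h]
    | Mi_M α n h => simp [specGen, specM_ne_zero h]
    | A_Ai => simp [specGen]
    | Ai_A => simp [specGen]
    | D_Di => simp [specGen]
    | Di_D => simp [specGen]
    | msys α n h1 h2 => simp [specGen, hq, specM_msys h1 h2]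
    | comm_zero α β n => simp [specGen, mul_comm]
    | comm_one α β n => simp [specGen, hq, mul_comm]
    | degree α n => simp [specGen, hq]
    | top_zero => simp [specGen, specM_top]
    | top_succ n => simp [specGen, specM_top]
  exact (lift (specGen r) h).toRingHom.domain_nontrivial

theorem isUnit_leading (r : ℕ) : IsUnit ((-1) ^ (r + 1) * qh (-(r + 1)) : Rq) := by
  refine (isUnit_one.neg.pow _).mul (IsUnit.of_mul_eq_one (qh (r + 1)) ?_)
  rw [← qh_add, neg_add_cancel, qh_zero]

theorem smul_unit_ne_zero {s : Rq} (hs : IsUnit s) (u : (U r)ˣ) : s • (u : U r) ≠ 0 := by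
  rw [Ne, hs.smul_eq_zero]
  exact u.ne_zero

theorem psiPlus_leading_ne_zero (n : ℤ) : psiPlus r n (r + 1) ≠ 0 := by
  rw [psiPlus_leading]
  exact smul_unit_ne_zero (isUnit_leading r) _

theorem psiMinus_leading_ne_zero (n : ℤ) : psiMinus r n (-(r + 1)) ≠ 0 := by
  rw [psiMinus_leading]
  exact smul_unit_ne_zero (isUnit_leading r) _

end Specialization
end QSystem
end

theorem mainTheorem9 (r : ℕ) (hr : 1 ≤ r) (n : ℤ) :
    -- `(z - q w) 𝔢(z) 𝔢(w) + (w - q z) 𝔢(w) 𝔢(z) = 0`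
    QSystem.linMul 1 (-QSystem.qp 1) (QSystem.prodZW (QSystem.e r) (QSystem.e r)) +
        QSystem.linMul (-QSystem.qp 1) 1 (QSystem.prodWZ (QSystem.e r) (QSystem.e r)) = 0 ∧
    -- `(z - q⁻¹ w) 𝔣(z) 𝔣(w) + (w - q⁻¹ z) 𝔣(w) 𝔣(z) = 0`
    QSystem.linMul 1 (-QSystem.qp (-1)) (QSystem.prodZW (QSystem.f r) (QSystem.f r)) +
        QSystem.linMul (-QSystem.qp (-1)) 1 (QSystem.prodWZ (QSystem.f r) (QSystem.f r)) = 0 ∧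
    -- `(z - q w) ψ^±(z) 𝔢(w) + (w - q z) 𝔢(w) ψ^±(z) = 0`
    QSystem.linMul 1 (-QSystem.qp 1) (QSystem.prodZW (QSystem.psiPlus r n) (QSystem.e r)) +
        QSystem.linMul (-QSystem.qp 1) 1
          (QSystem.prodWZ (QSystem.e r) (QSystem.psiPlus r n)) = 0 ∧
    QSystem.linMul 1 (-QSystem.qp 1) (QSystem.prodZW (QSystem.psiMinus r n) (QSystem.e r)) +
        QSystem.linMul (-QSystem.qp 1) 1
          (QSystem.prodWZ (QSystem.e r) (QSystem.psiMinus r n)) = 0 ∧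
    -- `(z - q⁻¹ w) ψ^±(z) 𝔣(w) + (w - q⁻¹ z) 𝔣(w) ψ^±(z) = 0`
    QSystem.linMul 1 (-QSystem.qp (-1)) (QSystem.prodZW (QSystem.psiPlus r n) (QSystem.f r)) +
        QSystem.linMul (-QSystem.qp (-1)) 1
          (QSystem.prodWZ (QSystem.f r) (QSystem.psiPlus r n)) = 0 ∧
    QSystem.linMul 1 (-QSystem.qp (-1)) (QSystem.prodZW (QSystem.psiMinus r n) (QSystem.f r)) +
        QSystem.linMul (-QSystem.qp (-1)) 1
          (QSystem.prodWZ (QSystem.f r) (QSystem.psiMinus r n)) = 0 ∧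
    -- `[𝔢(z), 𝔣(w)] = (1 - q) δ(z/w) (ψ⁺(z) - ψ⁻(z))`
    QSystem.prodZW (QSystem.e r) (QSystem.f r) - QSystem.prodWZ (QSystem.f r) (QSystem.e r) =
      (1 - QSystem.qp 1) • QSystem.deltaMul (QSystem.psiPlus r n - QSystem.psiMinus r n) ∧
    -- `ψ⁺` has valuation `r + 1` in `z`, with leading coefficient `(-q^{-1/2})^{r+1} A`
    (∀ i : ℤ, i < r + 1 → QSystem.psiPlus r n i = 0) ∧
    QSystem.psiPlus r n (r + 1) =
      ((-1) ^ (r + 1) * QSystem.qh (-(r + 1))) • (QSystem.A r : QSystem.U r) ∧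
    QSystem.psiPlus r n (r + 1) ≠ 0 ∧
    -- `ψ⁻` has valuation `r + 1` in `z⁻¹`, with leading coefficient `(-q^{1/2})^{-r-1} A⁻¹`
    (∀ i : ℤ, -(r + 1) < i → QSystem.psiMinus r n i = 0) ∧
    QSystem.psiMinus r n (-(r + 1)) =
      ((-1) ^ (r + 1) * QSystem.qh (-(r + 1))) •
        (((QSystem.A r)⁻¹ : (QSystem.U r)ˣ) : QSystem.U r) ∧
    QSystem.psiMinus r n (-(r + 1)) ≠ 0 :=
  ⟨QSystem.e_e hr, QSystem.f_f hr, QSystem.psiPlus_e hr n, QSystem.psiMinus_e hr n,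
    QSystem.psiPlus_f hr n, QSystem.psiMinus_f hr n, QSystem.e_f hr n,
    fun _ hi => QSystem.psiPlus_eq_zero n hi, QSystem.psiPlus_leading n,
    QSystem.psiPlus_leading_ne_zero n, fun _ hi => QSystem.psiMinus_eq_zero n hi,
    QSystem.psiMinus_leading n, QSystem.psiMinus_leading_ne_zero n⟩
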